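/- Let $N\ge 1$, $h\in\mathbb R$, $T>0$, $\eta,\beta\in\mathbb C$ with $\sinh(\beta/N)\neq0$ and $\sinh(\beta/N-\eta)\ne 0$, and put $$\widehat{\mathfrak a}(\omega)=e^{-h/T}\prod_{k=1}^N\frac{\sinh(\omega-\lambda_k+\eta)}{\sinh(\omega-\lambda_k-\eta)}\left[\frac{\sinh(\omega+\beta/N-\eta)\sinh(\omega-\beta/N)}{\sinh(\omega-\beta/N+\eta)\sinh(\omega+\beta/N)}\right]^N ,$$ where $\lambda_1,\dots,\lambda_N\in\mathbb C$ solve the Bethe equations $\widehat{\mathfrak a}(\lambda_p)=-1$, $p=1,\dots,N$, and satisfy $\sinh(\lambda_j-\lambda_k)\ne0$ for $j\neq k$ and $\sinh(\lambda_j+\lambda_k)\neq 0$ for all $j,k$. Define $$U_{jk}=\frac{-e^{-h/T}\sinh(2\lambda_k+\eta)}{\sinh(\lambda_k+\lambda_j)\sinh(\lambda_j-\lambda_k+\eta)}\,\frac{\prod_{a=1}^N\sinh(\lambda_k-\lambda_a+\eta)}{\prod_{a\ne k}\sinh(\lambda_k-\lambda_a)}\prod_{a=1}^N\frac{\sinh(\lambda_a+\lambda_k)}{\sinh(\lambda_a+\lambda_k+\eta)},$$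 $$\widehat f(\omega)=e^{-2h/T}\prod_{a=1}^N\frac{\sinh(\lambda_a+\omega-\eta)\sinh(\lambda_a-\omega-\eta)}{\sinh(\lambda_a+\omega+\eta)\sinh(\lambda_a-\omega+\eta)},$$ $$\widehat U(\omega,\omega')=\frac{-e^{-h/T}\sinh(2\omega'+\eta)}{\sinh(\omega'+\omega)\sinh(\omega-\omega'+\eta)}\prod_{a=1}^N\frac{\sinh(\lambda_a+\omega')\sinh(\omega'-\lambda_a+\eta)}{\sinh(\omega'-\lambda_a)\sinh(\lambda_a+\omega'+\eta)} .$$ Let $\mathscr C_1\supset\mathscr C_2\supset\cdots$ be encased piecewise $C^1$ closed contours in the strip $|\mathrm{Im}\,\omega|<\pi/2$ (a contour encircles a point if it has winding number $1$ around it, excludes it if the winding number is $0$; $\mathscr C\supset\mathscr D$ means that $\mathscr C$ encircles all points of $\mathscr D$ and $\mathscr D$ excludes all points of $\mathscr C$) such that every $\mathscr C_p$ encircles $0$ and all $\pm\lambda_a$ and excludes all points of $\lambda_a\pm\eta+i\pi\mathbb Z$ and $-\lambda_a-\eta+i\pi\mathbb Z$, such that $\mathscr C_p\supset-\mathscr C_q$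 for $p<q$, and such that $\mathscr C_q$ excludes all points of $\mathscr C_p\pm\eta+i\pi\mathbb Z$ for $p\neq q$. For $\kappa\in\mathbb C$ let, with $\omega_{n+1}\equiv\omega_1$ in an $n$-fold integral, $$\mathcal F_N^{(\kappa)}=\sum_{k=0}^{\infty}\kappa^{2k+1}\oint_{\mathscr C_1\supset\dots\supset\mathscr C_{2k+1}}\sum_{n=k}^\infty\frac{[\kappa^2\widehat f(\omega_{2k+1})]^{n-k}}{2n+1}\prod_{p=1}^{2k+1}\widehat U(\omega_p,\omega_{p+1})\frac{d^{2k+1}\omega}{(2i\pi)^{2k+1}}$$ $$\qquad-\sum_{k=1}^{\infty}\kappa^{2k}\oint_{\mathscr C_1\supset\dots\supset\mathscr C_{2k}}\sum_{n=k}^\infty\frac{[\kappa^2\widehat f(\omega_{2k})]^{n-k}}{2n}\prod_{p=1}^{2k}\widehat U(\omega_p,\omega_{p+1})\frac{d^{2k}\omega}{(2i\pi)^{2k}},\qquad \mathcal F_N=\mathcal F_N^{(1)} .$$ Say that the series $\mathcal F_N^{(\kappa)}$ converges if $|\kappa^2\widehat f|<1$ on all the contours and both double series over $(k,n)$ of multiple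 integrals converge absolutely. Let $$P(\kappa)=\prod_{p=1}^N[1+\kappa^2\widehat{\mathfrak a}(-\lambda_p)]^{1/2}\left(\frac{1+\kappa\,\widehat{\mathfrak a}(0)}{1-\kappa\,\widehat{\mathfrak a}(0)}\right)^{1/4}$$ with principal roots. Then: (i) There is $r>0$ such that for $|\kappa|<r$ the series $\mathcal F_N^{(\kappa)}$ converges and $\det_N[\delta_{jk}+\kappa U_{jk}]=P(\kappa)\,e^{\mathcal F_N^{(\kappa)}}$. (ii) Let $\gamma$ be a path from $0$ to $1$ in $\mathbb C$ on which none of $1+\kappa^2\widehat{\mathfrak a}(-\lambda_p)$ and $1\pm\kappa\,\widehat{\mathfrak a}(0)$ vanishes. Then the germs at $\kappa=0$ of $P(\kappa)$ and of $e^{\mathcal F_N^{(\kappa)}}$ continue analytically along $\gamma$; their values $P_\gamma$, $E_\gamma$ obtained at $\kappa=1$ do not depend on the choice of the continuations along $\gamma$, $P_\gamma^4=\prod_p[1+\widehat{\mathfrak a}(-\lambda_p)]^2\,\frac{1+\widehat{\mathfrak a}(0)}{1-\widehat{\mathfrak a}(0)}$, and $\det_N[\delta_{jk}+U_{jk}]=P_\gamma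 E_\gamma$. (iii) If no $1+\widehat{\mathfrak a}(-\lambda_p)$ lies in $(-\infty,0]$, and $\widehat{\mathfrak a}(0)\notin(-\infty,-1]\cup[1,\infty)$, then $e^{\mathcal F_N^{(\kappa)}}$ continues analytically along the segment $[0,1]$, and with $e^{\mathcal F_N}$ defined as the value of this continuation at $\kappa=1$ and with principal roots, $$\det_N[\delta_{jk}+U_{jk}]=\prod_{p=1}^N[1+\widehat{\mathfrak a}(-\lambda_p)]^{1/2}\left(\frac{1+\widehat{\mathfrak a}(0)}{1-\widehat{\mathfrak a}(0)}\right)^{1/4}e^{\mathcal F_N}.$$ If moreover the series converges at $\kappa=1$, this value is the exponential of its sum $\mathcal F_N$. -/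

import Mathlib

open scoped Topology BigOperators

noncomputable section

namespace OpenXXZ

/-! ### Contours, winding numbers, iterated contour integrals -/

/-- A contour in `ℂ`: a continuous closed curve, parametrised by `[0, 1]`, which is `C¹` with
bounded derivative off finitely many points. -/
structure Contour where
  toFun : ℝ → ℂ
  continuousOn : ContinuousOn toFun (Set.Icc 0 1)
  closed : toFun 0 = toFun 1
  piecewiseC1 : ∃ (S : Finset ℝ) (M : ℝ), ∀ t ∈ Set.Ioo (0 : ℝ) 1, t ∉ S →
    DifferentiableAt ℝ toFun t ∧ ContinuousAt (deriv toFun) t ∧ ‖deriv toFun t‖ ≤ M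

/-- The contour integral `∮_C g(ω) dω`. -/
def Contour.integral (C : Contour) (g : ℂ → ℂ) : ℂ :=
  ∫ t in (0 : ℝ)..1, g (C.toFun t) * deriv C.toFun t

/-- The winding number of `C` around a point `w` off `C`. -/
def Contour.winding (C : Contour) (w : ℂ) : ℂ :=
  (2 * Real.pi * Complex.I)⁻¹ * C.integral (fun z => (z - w)⁻¹)

/-- `C` goes once, counterclockwise, around `w`. -/
def Contour.Encircles (C : Contour) (w : ℂ) : Prop :=
  (∀ t ∈ Set.Icc (0 : ℝ) 1, C.toFun t ≠ w) ∧ C.winding w = 1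

/-- `w` lies outside `C`. -/
def Contour.Excludes (C : Contour) (w : ℂ) : Prop :=
  (∀ t ∈ Set.Icc (0 : ℝ) 1, C.toFun t ≠ w) ∧ C.winding w = 0

/-- The contour `-C`. -/
def Contour.neg (C : Contour) : Contour where
  toFun := fun t => -C.toFun t
  continuousOn := C.continuousOn.neg
  closed := by rw [C.closed]
  piecewiseC1 := by
    obtain ⟨S, M, h⟩ := C.piecewiseC1
    refine ⟨S, M, fun t ht hS => ?_⟩
    obtain ⟨h1, h2, h3⟩ := h t ht hS
    have hd : deriv (fun t => -C.toFun t) = fun t => -deriv C.toFun t := by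
      funext s
      exact deriv.fun_neg
    refine ⟨h1.fun_neg, ?_, ?_⟩
    · rw [hd]
      exact h2.neg
    · rw [hd]
      simpa using h3

/-- The encasing relation `C ⊃ D` of contours: `D` runs inside `C`, and `C` runs outside `D`. -/
def Contour.Encases (C D : Contour) : Prop :=
  (∀ t ∈ Set.Icc (0 : ℝ) 1, C.Encircles (D.toFun t)) ∧
  (∀ t ∈ Set.Icc (0 : ℝ) 1, D.Excludes (C.toFun t))

/-- The iterated integral `∮_{C 0} dω₁ ∮_{C 1} dω₂ ⋯ ∮_{C (n-1)} dω_n G(ω₁, …, ω_n)`;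
the `p`-th variable (counted from `0`) runs through `C p`. -/
def multiIntegral : (n : ℕ) → (ℕ → Contour) → ((Fin n → ℂ) → ℂ) → ℂ
  | 0, _, G => G Fin.elim0
  | n + 1, C, G =>
      (C 0).integral fun z => multiIntegral n (fun p => C (p + 1)) fun w => G (Fin.cons z w)

/-! ### Analytic continuation along a path -/

/-- `G t` represents, near `γ t`, the germ obtained by analytic continuation along `γ`
of the germ of `g` at the starting point of `γ`. -/
structure IsContinuationAlong {a b : ℂ} (γ : Path a b) (g : ℂ → ℂ)
    (G : unitInterval → ℂ → ℂ) : Prop where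
  start : G 0 =ᶠ[𝓝 a] g
  analytic : ∀ t, AnalyticAt ℂ (G t) (γ t)
  compatible : ∀ t, ∀ᶠ s in 𝓝 t, G s =ᶠ[𝓝 (γ s)] G t

/-- The germ of `g` at the starting point `a` of `γ` has an analytic continuation along `γ`,
and any such continuation takes the value `v` at the end point `b`. -/
def ContinuesTo {a b : ℂ} (γ : Path a b) (g : ℂ → ℂ) (v : ℂ) : Prop :=
  (∃ G, IsContinuationAlong γ g G) ∧ ∀ G, IsContinuationAlong γ g G → G 1 b = v

/-! ### The functions attached to the Bethe roots -/

section Functions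

variable {N : ℕ} (h T : ℝ) (η β : ℂ) (lam : Fin N → ℂ)

/-- The function `â`. -/
def aHat (ω : ℂ) : ℂ :=
  Complex.exp (-((h : ℂ) / T)) *
    (∏ k, Complex.sinh (ω - lam k + η) / Complex.sinh (ω - lam k - η)) *
    ((Complex.sinh (ω + β / N - η) * Complex.sinh (ω - β / N)) /
      (Complex.sinh (ω - β / N + η) * Complex.sinh (ω + β / N))) ^ N

/-- The Bethe equations with `N` roots at Trotter number `N`. -/
def BetheEquations : Prop :=
  ∀ p, -1 = Complex.exp (-((h : ℂ) / T)) *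
    (∏ k, Complex.sinh (lam p - lam k + η) / Complex.sinh (lam p - lam k - η)) *
    ((Complex.sinh (lam p + β / N - η) * Complex.sinh (lam p - β / N)) /
      (Complex.sinh (lam p - β / N + η) * Complex.sinh (lam p + β / N))) ^ N

/-- The matrix `U`. -/
def matU : Matrix (Fin N) (Fin N) ℂ := fun j k =>
  (-Complex.exp (-((h : ℂ) / T)) * Complex.sinh (2 * lam k + η)) /
      (Complex.sinh (lam k + lam j) * Complex.sinh (lam j - lam k + η)) *
    ((∏ a, Complex.sinh (lam k - lam a + η)) /
      ∏ a ∈ Finset.univ.erase k, Complex.sinh (lam k - lam a)) *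
    ∏ a, Complex.sinh (lam a + lam k) / Complex.sinh (lam a + lam k + η)

/-- The function `f̂`. -/
def fHat (ω : ℂ) : ℂ :=
  Complex.exp (-(2 * (h : ℂ) / T)) *
    ∏ a, (Complex.sinh (lam a + ω - η) * Complex.sinh (lam a - ω - η)) /
      (Complex.sinh (lam a + ω + η) * Complex.sinh (lam a - ω + η))

/-- The kernel `Û(ω, ω')`. -/
def UHat (ω ω' : ℂ) : ℂ :=
  (-Complex.exp (-((h : ℂ) / T)) * Complex.sinh (2 * ω' + η)) /
      (Complex.sinh (ω' + ω) * Complex.sinh (ω - ω' + η)) *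
    ∏ a, (Complex.sinh (lam a + ω') * Complex.sinh (ω' - lam a + η)) /
      (Complex.sinh (ω' - lam a) * Complex.sinh (lam a + ω' + η))

/-- Encased contours `C 0 ⊃ C 1 ⊃ C 2 ⊃ ⋯` adapted to the roots `lam`: in the strip
`|Im ω| < π/2`, around the points `lam a`, `-lam a` and `0`, but around no pole of `f̂` or of the
kernel coming from the roots shifted by `± η`; moreover `C p` encases `-C q` for `p < q`
(position of the poles at `ω_p = -ω_{p+1}`), and no point of `C p ± η + iπℤ` lies inside `C q`
(position of the poles at `ω_{p+1} = ω_p + η`). -/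
structure AdaptedContours (C : ℕ → Contour) : Prop where
  strip : ∀ p, ∀ t ∈ Set.Icc (0 : ℝ) 1, |((C p).toFun t).im| < Real.pi / 2
  root : ∀ p a, (C p).Encircles (lam a)
  neg_root : ∀ p a, (C p).Encircles (-lam a)
  origin : ∀ p, (C p).Encircles 0
  root_add : ∀ p a (m : ℤ), (C p).Excludes (lam a + η + m * (Real.pi * Complex.I))
  root_sub : ∀ p a (m : ℤ), (C p).Excludes (lam a - η + m * (Real.pi * Complex.I))
  neg_root_sub : ∀ p a (m : ℤ), (C p).Excludes (-lam a - η + m * (Real.pi * Complex.I))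
  encased : ∀ p q, p < q → (C p).Encases (C q)
  encased_neg : ∀ p q, p < q → (C p).Encases (C q).neg
  shift_add : ∀ p q, p ≠ q → ∀ t ∈ Set.Icc (0 : ℝ) 1, ∀ m : ℤ,
    (C q).Excludes ((C p).toFun t + η + m * (Real.pi * Complex.I))
  shift_sub : ∀ p q, p ≠ q → ∀ t ∈ Set.Icc (0 : ℝ) 1, ∀ m : ℤ,
    (C q).Excludes ((C p).toFun t - η + m * (Real.pi * Complex.I))

variable (C : ℕ → Contour)

/-- `∮_{C₁ ⊃ ⋯ ⊃ C_{n+1}} φ(ω_{n+1}) ∏_{p=1}^{n+1} Û(ω_p, ω_{p+1}) d^{n+1}ω / (2iπ)^{n+1}`, with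
`ω_{n+2} = ω₁` (addition in `Fin (n + 1)` is cyclic). -/
def cyclicIntegral (n : ℕ) (φ : ℂ → ℂ) : ℂ :=
  ((2 * Real.pi * Complex.I) ^ (n + 1))⁻¹ *
    multiIntegral (n + 1) C fun ω =>
      φ (ω (Fin.last n)) * ∏ p : Fin (n + 1), UHat h T η lam (ω p) (ω (p + 1))

/-- The series `F_N^{(κ)}`. The inner summation index is `j = n - k`, and the index of the second
outer sum is shifted by one, so that it starts at `0`. -/
def seriesF (κ : ℂ) : ℂ :=
  (∑' k : ℕ, κ ^ (2 * k + 1) * cyclicIntegral h T η lam C (2 * k) fun ω =>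
      ∑' j : ℕ, (κ ^ 2 * fHat h T η lam ω) ^ j / (2 * ((k : ℂ) + j) + 1)) -
  ∑' k : ℕ, κ ^ (2 * (k + 1)) * cyclicIntegral h T η lam C (2 * k + 1) fun ω =>
      ∑' j : ℕ, (κ ^ 2 * fHat h T η lam ω) ^ j / (2 * ((k : ℂ) + 1 + j))

/-- Convergence of the series `F_N^{(κ)}`: the inner series converge geometrically on the contours
and the two double series of multiple integrals converge absolutely. -/
def SeriesConverges (κ : ℂ) : Prop :=
  (∀ p, ∀ t ∈ Set.Icc (0 : ℝ) 1, ‖κ ^ 2 * fHat h T η lam ((C p).toFun t)‖ < 1) ∧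
  (Summable fun q : ℕ × ℕ => κ ^ (2 * (q.1 + q.2) + 1) / (2 * ((q.1 : ℂ) + q.2) + 1) *
      cyclicIntegral h T η lam C (2 * q.1) fun ω => fHat h T η lam ω ^ q.2) ∧
  (Summable fun q : ℕ × ℕ => κ ^ (2 * (q.1 + 1 + q.2)) / (2 * ((q.1 : ℂ) + 1 + q.2)) *
      cyclicIntegral h T η lam C (2 * q.1 + 1) fun ω => fHat h T η lam ω ^ q.2)

/-- The function `∏_p [1 + κ² â(-λ_p)]^{1/2} ((1 + κ â(0)) / (1 - κ â(0)))^{1/4}`, with principal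
determinations of the roots. -/
def prefactor (κ : ℂ) : ℂ :=
  (∏ p, (1 + κ ^ 2 * aHat h T η β lam (-lam p)) ^ (1 / 2 : ℂ)) *
    ((1 + κ * aHat h T η β lam 0) / (1 - κ * aHat h T η β lam 0)) ^ (1 / 4 : ℂ)

/-- `κ` is neither a branch point nor a singularity of the continuations of `prefactor`. -/
def IsRegularCoupling (κ : ℂ) : Prop :=
  (∀ p, 1 + κ ^ 2 * aHat h T η β lam (-lam p) ≠ 0) ∧
  1 + κ * aHat h T η β lam 0 ≠ 0 ∧ 1 - κ * aHat h T η β lam 0 ≠ 0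

end Functions

end OpenXXZ

end

/-!
The series `F_N` is, for small `κ`, the difference between `log det (1 + κ U)` and the logarithm of
the prefactor; everything else is analytic continuation in `κ`.

*Residues.* The iterated integrals are computed from the innermost contour outwards. Since contours
are only assumed closed and piecewise `C¹`, with winding numbers given by integrals, Cauchy's
theorem is proved in its homological form by Dixon's argument
(`Contour.integral_eq_zero_of_differentiableOn`), and the residue theorem for simple poles follows
(`Contour.integral_eq_sum_residues`). The kernel factors as `Û(x, z) = K(x, z) W(z)`, where `W` has
poles at the roots `lam k` and zeros at the points `-lam k`. Writing `R(x, k)` for the residue of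
`Û(x, z)` at `z = lam k`, one has `R(lam j, k) = U j k`, and an open chain of kernels reduces to
`∑ R(x, l) (U ^ n) l k Û(lam k, y)`: the pole of `R(z, k)` at `z = -lam k` is cancelled by a zero of
`W` (`AdaptedContours.multiIntegral_chain`). Only in the last, outermost, integration do two poles
meet at `-lam k`, so that one survives the zero of `W`; its residue is `-f̂(lam k)`. A cycle of
length one has instead an additional pole at the origin. In this way the cyclic integral with test
function `φ` is a finite combination of the values of `φ` at the roots and at `0`
(`AdaptedContours.cyclicIntegral_eq`):
`∑ φ(lam k) U k k - φ(0) â(0) / 2` for length one, and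
`∑ φ(lam k) ((U ^ (n + 2)) k k - f̂(lam k) (U ^ n) k k)` for length `n + 2`.

*Telescoping.* Summed along the antidiagonals of the double series, with `φ = f̂ ^ j`, these
expressions telescope. As `f̂(0) = â(0) ^ 2`, and `f̂(lam p) = -â(-lam p)` by the Bethe equations,
the coefficients of `F_N` are those of `log det (1 + κ U)`, namely the traces of the powers of `U`,
minus those of `log` of the prefactor (`AdaptedContours.seriesF_hasSum`,
`AdaptedContours.exists_det_eq_prefactor_mul_exp`). That `|κ² f̂| < 1` on a contour implies the same
bound at all points inside is the maximum principle in terms of winding numbers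
(`Contour.excludes_of_norm_ge`); it makes the inner series a legitimate test function.

*Continuation.* Continuations along a path are unique by the identity theorem
(`IsContinuationAlong.eventuallyEq`). The logarithm of a function without zeros on the path
continues by lifting through the covering `exp`, hence the prefactor does, and `det / prefactor`
continues `exp F_N`. On the segment `[0, 1]` the arguments of the principal roots stay in the slit
plane, so the prefactor is its own continuation. If the series converges at `κ = 1`, it defines a
function continuous on the closed unit disc and analytic inside, which must agree with the
continuation on `[0, 1)` and therefore at `1`.
-/

noncomputable section

namespace OpenXXZ

open Complex Set Filter MeasureTheory
open scoped Interval

/-! ### Contour integrals and the residue theorem -/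

namespace Contour

variable (C : Contour)

/-- The set of points of a contour. -/
def trace : Set ℂ := C.toFun '' Icc 0 1

lemma mem_trace {t : ℝ} (ht : t ∈ Icc (0 : ℝ) 1) : C.toFun t ∈ C.trace := ⟨t, ht, rfl⟩

lemma isCompact_trace : IsCompact C.trace := isCompact_Icc.image_of_continuousOn C.continuousOn

lemma comp_continuousOn {g : ℂ → ℂ} (hg : ContinuousOn g C.trace) :
    ContinuousOn (fun t => g (C.toFun t)) (Icc 0 1) :=
  hg.comp C.continuousOn fun _ ht => C.mem_trace ht

lemma intervalIntegrable_deriv : IntervalIntegrable (deriv C.toFun) volume 0 1 := by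
  obtain ⟨S, M, h⟩ := C.piecewiseC1
  rw [intervalIntegrable_iff_integrableOn_Ioo_of_le zero_le_one]
  refine Measure.integrableOn_of_bounded (M := M) (by simp)
    (measurable_deriv _).aestronglyMeasurable ?_
  rw [ae_restrict_iff' measurableSet_Ioo]
  have : ∀ᵐ t : ℝ, t ∉ (S : Set ℝ) := S.countable_toSet.ae_notMem _
  filter_upwards [this] with t ht htI using (h t htI (by simpa using ht)).2.2

lemma intervalIntegrable_mul_deriv {φ : ℝ → ℂ} (hφ : ContinuousOn φ (Icc 0 1)) :
    IntervalIntegrable (fun t => φ t * deriv C.toFun t) volume 0 1 :=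
  C.intervalIntegrable_deriv.continuousOn_mul (by rwa [uIcc_of_le zero_le_one])

lemma integral_congr {f g : ℂ → ℂ} (h : ∀ t ∈ Icc (0 : ℝ) 1, f (C.toFun t) = g (C.toFun t)) :
    C.integral f = C.integral g := by
  refine intervalIntegral.integral_congr fun t ht => ?_
  rw [uIcc_of_le zero_le_one] at ht
  simp only [h t ht]

lemma integral_const_mul (c : ℂ) (f : ℂ → ℂ) : C.integral (fun z => c * f z) = c * C.integral f := by
  simp only [integral, mul_assoc]
  exact intervalIntegral.integral_const_mul _ _

lemma integral_sub {f g : ℂ → ℂ} (hf : ContinuousOn f C.trace) (hg : ContinuousOn g C.trace) :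
    C.integral (fun z => f z - g z) = C.integral f - C.integral g := by
  simp only [integral, sub_mul]
  exact intervalIntegral.integral_sub (C.intervalIntegrable_mul_deriv (C.comp_continuousOn hf))
    (C.intervalIntegrable_mul_deriv (C.comp_continuousOn hg))

lemma integral_finset_sum {ι : Type*} (s : Finset ι) {f : ι → ℂ → ℂ}
    (hf : ∀ i ∈ s, ContinuousOn (f i) C.trace) :
    C.integral (fun z => ∑ i ∈ s, f i z) = ∑ i ∈ s, C.integral (f i) := by
  simp only [integral, Finset.sum_mul]
  exact intervalIntegral.integral_finsetSum fun i hi =>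
    C.intervalIntegrable_mul_deriv (C.comp_continuousOn (hf i hi))

lemma norm_integral_le {f : ℂ → ℂ} {M : ℝ} (hf : ∀ w ∈ C.trace, ‖f w‖ ≤ M) :
    ‖C.integral f‖ ≤ M * ∫ t in (0 : ℝ)..1, ‖deriv C.toFun t‖ := by
  rw [← intervalIntegral.integral_const_mul]
  refine intervalIntegral.norm_integral_le_of_norm_le zero_le_one (ae_of_all _ fun t ht => ?_)
    (C.intervalIntegrable_deriv.norm.const_mul M)
  rw [norm_mul]
  gcongr
  exact hf _ (C.mem_trace ⟨ht.1.le, ht.2⟩)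

/-- The fundamental theorem of calculus along a closed contour. -/
lemma integral_eq_zero_of_hasDerivAt {F f : ℂ → ℂ} (hF : ∀ w ∈ C.trace, HasDerivAt F (f w) w)
    (hf : ContinuousOn f C.trace) : C.integral f = 0 := by
  obtain ⟨S, M, h⟩ := C.piecewiseC1
  have key := integral_eq_of_hasDerivAt_off_countable_of_le (fun t => F (C.toFun t))
    (fun t => f (C.toFun t) * deriv C.toFun t) zero_le_one S.countable_toSet
    (C.comp_continuousOn fun w hw => (hF w hw).continuousAt.continuousWithinAt)
    (fun t ht => (hF _ (C.mem_trace (Ioo_subset_Icc_self ht.1))).comp_of_eq t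
      (h t ht.1 (by simpa using ht.2)).1.hasDerivAt rfl)
    (C.intervalIntegrable_mul_deriv (C.comp_continuousOn hf))
  rw [integral, key, C.closed, sub_self]

lemma continuousOn_inv_sub {w : ℂ} (hw : w ∉ C.trace) :
    ContinuousOn (fun z => (z - w)⁻¹) C.trace :=
  ContinuousOn.inv₀ (by fun_prop) fun z hz h => hw (by rwa [← sub_eq_zero.1 h])

/-- A contour does not wind around the points which a line separates from it. -/
lemma winding_eq_zero_of_halfPlane {w u : ℂ} (hu : ∀ z ∈ C.trace, 0 < (u * (z - w)).re) :
    w ∉ C.trace ∧ C.winding w = 0 := by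
  have hw : w ∉ C.trace := fun h => by simpa using hu w h
  refine ⟨hw, ?_⟩
  rw [winding, C.integral_eq_zero_of_hasDerivAt (F := fun z => log (u * (z - w))) ?_
    (C.continuousOn_inv_sub hw), mul_zero]
  intro z hz
  have h1 : HasDerivAt (fun z => u * (z - w)) (u * 1) z :=
    ((hasDerivAt_id z).sub_const w).const_mul u
  have h2 := h1.clog (Or.inl (hu z hz))
  have hne : u * (z - w) ≠ 0 := fun h => by simpa [h] using hu z hz
  convert h2 using 1
  have := left_ne_zero_of_mul hne
  have := right_ne_zero_of_mul hne
  field_simp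

/-- A contour integral depending holomorphically, and locally boundedly, on a parameter is
holomorphic in that parameter. -/
lemma differentiableAt_integral_param {U : Set ℂ} {z₀ : ℂ} (hU : U ∈ 𝓝 z₀) {g : ℂ → ℝ → ℂ}
    (hc : ∀ z ∈ U, ContinuousOn (g z) (Icc 0 1))
    (hd : ∀ t ∈ Icc (0 : ℝ) 1, DifferentiableOn ℂ (fun z => g z t) U)
    {M : ℝ} (hM : ∀ z ∈ U, ∀ t ∈ Icc (0 : ℝ) 1, ‖g z t‖ ≤ M) :
    DifferentiableAt ℂ (fun z => ∫ t in (0 : ℝ)..1, g z t * deriv C.toFun t) z₀ := by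
  obtain ⟨δ, hδ, hball⟩ := Metric.mem_nhds_iff.1 hU
  have hIoc : ∀ t ∈ Ι (0 : ℝ) 1, t ∈ Icc (0 : ℝ) 1 := fun t ht => by
    rw [uIoc_of_le zero_le_one] at ht
    exact Ioc_subset_Icc_self ht
  have hdiff : ∀ t ∈ Icc (0 : ℝ) 1, ∀ z ∈ Metric.ball z₀ (δ / 2),
      HasDerivAt (fun z => g z t) (deriv (fun z => g z t) z) z := by
    intro t ht z hz
    refine ((hd t ht).differentiableAt (mem_of_superset ?_ hball)).hasDerivAt
    exact Metric.isOpen_ball.mem_nhds (Metric.ball_subset_ball (by linarith) hz)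
  have hint : ∀ z ∈ U, IntervalIntegrable (fun t => g z t * deriv C.toFun t) volume 0 1 :=
    fun z hz => C.intervalIntegrable_mul_deriv (hc z hz)
  have hz₀ := mem_of_mem_nhds hU
  have hb : Metric.ball z₀ (δ / 2) ∈ 𝓝 z₀ := Metric.ball_mem_nhds _ (by linarith)
  refine (intervalIntegral.hasDerivAt_integral_of_dominated_loc_of_deriv_le
    (F' := fun z t => deriv (fun z => g z t) z * deriv C.toFun t)
    (bound := fun t => M / (δ / 3) * ‖deriv C.toFun t‖) hb ?_ (hint _ hz₀) ?_ ?_ ?_ ?_).2.differentiableAt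
  · filter_upwards [hU] with z hz using (intervalIntegrable_iff.1 (hint z hz)).aestronglyMeasurable
  · -- the derivative is an almost everywhere limit of difference quotients
    have hseq : Tendsto (fun n : ℕ => ((1 / ((n : ℝ) + 1) : ℝ) : ℂ)) atTop (𝓝[≠] 0) := by
      rw [tendsto_nhdsWithin_iff]
      refine ⟨?_, Eventually.of_forall fun n => ?_⟩
      · rw [← ofReal_zero]
        exact (continuous_ofReal.tendsto 0).comp tendsto_one_div_add_atTop_nhds_zero_nat
      · simp only [mem_compl_iff, mem_singleton_iff, ofReal_eq_zero]
        positivity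
    have hev : ∀ᶠ n : ℕ in atTop, z₀ + ((1 / ((n : ℝ) + 1) : ℝ) : ℂ) ∈ U := by
      have : Tendsto (fun n : ℕ => z₀ + ((1 / ((n : ℝ) + 1) : ℝ) : ℂ)) atTop (𝓝 z₀) := by
        simpa using (tendsto_const_nhds (x := z₀)).add (hseq.mono_right nhdsWithin_le_nhds)
      exact this hU
    obtain ⟨n₀, hn₀⟩ := eventually_atTop.1 hev
    refine aestronglyMeasurable_of_tendsto_ae atTop
      (f := fun n t => ((1 / (((n + n₀ : ℕ) : ℝ) + 1) : ℝ) : ℂ)⁻¹ *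
        (g (z₀ + ((1 / (((n + n₀ : ℕ) : ℝ) + 1) : ℝ) : ℂ)) t * deriv C.toFun t -
          g z₀ t * deriv C.toFun t)) (fun n => ?_) ?_
    · exact ((intervalIntegrable_iff.1 (hint _ (hn₀ (n + n₀) (by omega)))).aestronglyMeasurable.sub
        (intervalIntegrable_iff.1 (hint _ hz₀)).aestronglyMeasurable).const_mul _
    · rw [ae_restrict_iff' measurableSet_uIoc]
      refine ae_of_all _ fun t ht => ?_
      have h1 := (hdiff t (hIoc t ht) z₀ (Metric.mem_ball_self (by linarith))).tendsto_slope_zero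
      have h2 := (h1.comp (hseq.comp (tendsto_add_atTop_nat n₀))).mul_const (deriv C.toFun t)
      refine h2.congr fun n => ?_
      simp only [Function.comp_apply, smul_eq_mul]
      ring
  · refine ae_of_all _ fun t ht z hz => ?_
    rw [norm_mul]
    gcongr
    refine norm_deriv_le_of_forall_mem_sphere_norm_le (by positivity) ⟨?_, ?_⟩ ?_
    · refine (hd t (hIoc t ht)).mono fun y hy => hball ?_
      rw [Metric.mem_ball] at *
      linarith [dist_triangle y z z₀]
    · refine (hd t (hIoc t ht)).continuousOn.mono fun y hy => hball ?_
      have := Metric.closure_ball_subset_closedBall hy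
      rw [Metric.mem_closedBall] at this
      rw [Metric.mem_ball] at *
      linarith [dist_triangle y z z₀]
    · intro y hy
      refine hM y (hball ?_) t (hIoc t ht)
      rw [Metric.mem_sphere] at hy
      rw [Metric.mem_ball] at *
      linarith [dist_triangle y z z₀]
  · exact C.intervalIntegrable_deriv.norm.const_mul _
  · exact ae_of_all _ fun t ht z hz => (hdiff t (hIoc t ht) z hz).mul_const _

lemma exists_ball_disjoint {z₀ : ℂ} (hz₀ : z₀ ∉ C.trace) :
    ∃ δ > 0, ∀ z ∈ Metric.ball z₀ δ, ∀ w ∈ C.trace, δ ≤ ‖w - z‖ := by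
  obtain ⟨δ, hδ, h⟩ := Metric.isOpen_iff.1 C.isCompact_trace.isClosed.isOpen_compl z₀ hz₀
  refine ⟨δ / 2, by positivity, fun z hz w hw => ?_⟩
  by_contra! hlt
  refine h (a := w) ?_ hw
  rw [Metric.mem_ball] at *
  rw [← dist_eq_norm] at hlt
  linarith [dist_triangle w z z₀]

/-- Cauchy type integrals are holomorphic off the contour. -/
lemma differentiableAt_cauchyTransform {f : ℂ → ℂ} (hf : ContinuousOn f C.trace) {z₀ : ℂ}
    (hz₀ : z₀ ∉ C.trace) :
    DifferentiableAt ℂ (fun z => C.integral fun w => f w * (w - z)⁻¹) z₀ := by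
  obtain ⟨δ, hδ, h⟩ := C.exists_ball_disjoint hz₀
  obtain ⟨M, hM⟩ := C.isCompact_trace.exists_bound_of_continuousOn hf
  have hne : ∀ z ∈ Metric.ball z₀ δ, ∀ w ∈ C.trace, w - z ≠ 0 := fun z hz w hw h0 => by
    have := h z hz w hw
    rw [h0, norm_zero] at this
    linarith
  refine C.differentiableAt_integral_param (g := fun z t => f (C.toFun t) * (C.toFun t - z)⁻¹)
    (M := M * δ⁻¹) (Metric.ball_mem_nhds z₀ hδ) (fun z hz => ?_) (fun t ht => ?_) fun z hz t ht => ?_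
  · exact C.comp_continuousOn (g := fun w => f w * (w - z)⁻¹)
      (hf.mul (ContinuousOn.inv₀ (by fun_prop) fun w hw => hne z hz w hw))
  · refine DifferentiableOn.const_mul (DifferentiableOn.inv (by fun_prop) fun z hz => ?_) _
    exact hne z hz _ (C.mem_trace ht)
  · rw [norm_mul, norm_inv]
    have h1 := hM _ (C.mem_trace ht)
    have h2 := h z hz _ (C.mem_trace ht)
    gcongr
    exact (norm_nonneg _).trans h1

/-- The winding number is locally constant off the contour. -/
lemma eventually_winding_eq {z₀ : ℂ} (hz₀ : z₀ ∉ C.trace) :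
    ∀ᶠ z in 𝓝 z₀, C.winding z = C.winding z₀ := by
  obtain ⟨δ, hδ, h⟩ := C.exists_ball_disjoint hz₀
  have hne : ∀ z ∈ Metric.ball z₀ δ, z ∉ C.trace := fun z hz hz' => by
    have := h z hz z hz'
    simp at this
    linarith
  filter_upwards [Metric.ball_mem_nhds z₀ hδ] with z hz
  -- `log ((w - z) / (w - z₀))` is a primitive of `1 / (w - z) - 1 / (w - z₀)` on the contour
  suffices C.integral (fun w => (w - z)⁻¹ - (w - z₀)⁻¹) = 0 by
    rw [C.integral_sub (C.continuousOn_inv_sub (hne z hz)) (C.continuousOn_inv_sub hz₀),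
      sub_eq_zero] at this
    rw [winding, winding, this]
  refine C.integral_eq_zero_of_hasDerivAt (F := fun w => log ((w - z) / (w - z₀))) ?_
    ((C.continuousOn_inv_sub (hne z hz)).sub (C.continuousOn_inv_sub hz₀))
  intro w hw
  have h0 : w - z₀ ≠ 0 := fun h0 => hz₀ (by rwa [← sub_eq_zero.1 h0])
  have h1 : w - z ≠ 0 := fun h0 => hne z hz (by rwa [← sub_eq_zero.1 h0])
  have hmem : (w - z) / (w - z₀) ∈ slitPlane := by
    have : (w - z) / (w - z₀) = 1 + -((z - z₀) / (w - z₀)) := by field_simp; ring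
    rw [this]
    refine mem_slitPlane_of_norm_lt_one ?_
    rw [norm_neg, norm_div, div_lt_one (norm_pos_iff.2 h0)]
    exact (mem_ball_iff_norm.1 hz).trans_le (h z₀ (Metric.mem_ball_self hδ) w hw)
  have hd : HasDerivAt (fun w => (w - z) / (w - z₀))
      ((1 * (w - z₀) - (w - z) * 1) / (w - z₀) ^ 2) w :=
    ((hasDerivAt_id w).sub_const z).div ((hasDerivAt_id w).sub_const z₀) h0
  convert hd.clog hmem using 1
  field_simp

/-- The part of Dixon's argument that bounds difference quotients uniformly. -/
lemma exists_dslope_bound {Ω : Set ℂ} (hΩ : IsOpen Ω) {f : ℂ → ℂ} (hf : DifferentiableOn ℂ f Ω)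
    {K : Set ℂ} (hK : IsCompact K) (hKΩ : K ⊆ Ω) {z₀ : ℂ} (hz₀ : z₀ ∈ Ω) :
    ∃ U ∈ 𝓝 z₀, U ⊆ Ω ∧ ∃ M, ∀ z ∈ U, ∀ w ∈ K, ‖dslope f z w‖ ≤ M := by
  obtain ⟨ε, hε, hball⟩ := Metric.nhds_basis_closedBall.mem_iff.1 (hΩ.mem_nhds hz₀)
  have hcomp := isCompact_closedBall z₀ ε
  obtain ⟨M₁, hM₁⟩ := hcomp.exists_bound_of_continuousOn
    ((hf.deriv hΩ).continuousOn.mono hball)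
  obtain ⟨M₂, hM₂⟩ := hK.exists_bound_of_continuousOn (hf.continuousOn.mono hKΩ)
  obtain ⟨M₃, hM₃⟩ := hcomp.exists_bound_of_continuousOn (hf.continuousOn.mono hball)
  refine ⟨Metric.ball z₀ (ε / 2), Metric.ball_mem_nhds _ (by positivity), fun z hz => hball ?_,
    max M₁ ((M₂ + M₃) / (ε / 2)), fun z hz w hw => ?_⟩
  · rw [Metric.mem_ball] at hz
    rw [Metric.mem_closedBall]
    linarith
  · rw [Metric.mem_ball] at hz
    have hz' : z ∈ Metric.closedBall z₀ ε := by
      rw [Metric.mem_closedBall]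
      linarith
    rcases eq_or_ne w z with rfl | hne
    · rw [dslope_same]
      exact (hM₁ _ hz').trans (le_max_left _ _)
    · rw [dslope_of_ne _ hne, slope_def_module, norm_smul, norm_inv, inv_mul_le_iff₀
        (norm_pos_iff.2 (sub_ne_zero.2 hne))]
      by_cases hw' : w ∈ Metric.closedBall z₀ ε
      · refine ((convex_closedBall z₀ ε).norm_image_sub_le_of_norm_deriv_le
          (fun y hy => hf.differentiableAt (hΩ.mem_nhds (hball hy))) hM₁ hz' hw').trans ?_
        rw [mul_comm]
        gcongr
        exact le_max_left _ _
      · have hdist : ε / 2 ≤ ‖w - z‖ := by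
          rw [Metric.mem_closedBall, not_le] at hw'
          rw [← dist_eq_norm]
          linarith [dist_triangle w z z₀]
        have h0 : 0 ≤ M₂ + M₃ :=
          add_nonneg ((norm_nonneg _).trans (hM₂ w hw)) ((norm_nonneg _).trans (hM₃ z hz'))
        calc ‖f w - f z‖ ≤ M₂ + M₃ := (norm_sub_le _ _).trans (add_le_add (hM₂ w hw) (hM₃ z hz'))
          _ = ε / 2 * ((M₂ + M₃) / (ε / 2)) := by field_simp
          _ ≤ _ := by
            gcongr
            exact le_max_right _ _

lemma dslope_comm (f : ℂ → ℂ) (z w : ℂ) : dslope f z w = dslope f w z := by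
  rcases eq_or_ne w z with rfl | hne
  · rfl
  · rw [dslope_of_ne _ hne, dslope_of_ne _ hne.symm, slope_comm]

lemma trace_subset {Ω : Set ℂ} (hex : ∀ w ∉ Ω, C.Excludes w) : C.trace ⊆ Ω := by
  rintro _ ⟨t, ht, rfl⟩
  by_contra h
  exact (hex _ h).1 t ht rfl

lemma Excludes.notMem {C : Contour} {w : ℂ} (h : C.Excludes w) : w ∉ C.trace := by
  rintro ⟨t, ht, rfl⟩
  exact h.1 t ht rfl

lemma Encircles.notMem {C : Contour} {w : ℂ} (h : C.Encircles w) : w ∉ C.trace := by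
  rintro ⟨t, ht, rfl⟩
  exact h.1 t ht rfl

/-- Dixon's lemma: the difference quotients of a function that is holomorphic wherever the contour
winds have integral `0`. -/
lemma integral_dslope_eq_zero {Ω : Set ℂ} (hΩ : IsOpen Ω) {f : ℂ → ℂ}
    (hf : DifferentiableOn ℂ f Ω) (hex : ∀ w ∉ Ω, C.Excludes w) {z₀ : ℂ} (hz₀ : z₀ ∈ Ω) :
    C.integral (dslope f z₀) = 0 := by
  classical
  have htr := C.trace_subset hex
  have hfc : ContinuousOn f C.trace := hf.continuousOn.mono htr
  -- the entire function of Dixon's proof, glued from two integrals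
  set H : ℂ → ℂ := fun z =>
    if z ∈ Ω then C.integral (dslope f z) else C.integral fun w => f w * (w - z)⁻¹ with hH
  have hout : ∀ z, z ∉ C.trace → C.winding z = 0 → H z = C.integral fun w => f w * (w - z)⁻¹ := by
    intro z hz hw
    by_cases hzΩ : z ∈ Ω
    · have h0 : C.integral (fun w => (w - z)⁻¹) = 0 := by
        rw [winding] at hw
        exact (mul_eq_zero.1 hw).resolve_left (by simp [Real.pi_ne_zero])
      rw [hH]
      simp only [hzΩ, if_true]
      rw [C.integral_congr (g := fun w => f w * (w - z)⁻¹ - f z * (w - z)⁻¹) fun t ht => ?_,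
        C.integral_sub (f := fun w => f w * (w - z)⁻¹) (g := fun w => f z * (w - z)⁻¹)
          (hfc.mul (C.continuousOn_inv_sub hz))
          (continuousOn_const.mul (C.continuousOn_inv_sub hz)), C.integral_const_mul, h0, mul_zero,
        sub_zero]
      have hne : C.toFun t ≠ z := fun h => hz (h ▸ C.mem_trace ht)
      rw [dslope_of_ne _ hne, slope_def_field, div_eq_mul_inv, sub_mul]
    · rw [hH]
      simp only [hzΩ, if_false]
  have hdiff : Differentiable ℂ H := by
    intro z
    by_cases hzΩ : z ∈ Ω
    · have heq : H =ᶠ[𝓝 z] fun z => C.integral (dslope f z) := by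
        filter_upwards [hΩ.mem_nhds hzΩ] with y hy
        simp only [hH, hy, if_true]
      refine DifferentiableAt.congr_of_eventuallyEq ?_ heq
      obtain ⟨U, hU, hUΩ, M, hM⟩ := exists_dslope_bound hΩ hf C.isCompact_trace htr hzΩ
      refine C.differentiableAt_integral_param (g := fun z t => dslope f z (C.toFun t)) hU
        (fun y hy => ?_) (fun t ht => ?_) fun y hy t ht => hM y hy _ (C.mem_trace ht)
      · exact C.comp_continuousOn (g := dslope f y)
          (((differentiableOn_dslope (hΩ.mem_nhds (hUΩ hy))).2 hf).continuousOn.mono htr)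
      · simp only [dslope_comm f _ (C.toFun t)]
        exact ((differentiableOn_dslope (hΩ.mem_nhds (htr (C.mem_trace ht)))).2 hf).mono hUΩ
    · have hz := (hex z hzΩ).notMem
      have heq : H =ᶠ[𝓝 z] fun z => C.integral fun w => f w * (w - z)⁻¹ := by
        filter_upwards [C.eventually_winding_eq hz,
          C.isCompact_trace.isClosed.isOpen_compl.mem_nhds hz] with y hy hy'
        exact hout y hy' (hy.trans (hex z hzΩ).2)
      exact (C.differentiableAt_cauchyTransform hfc hz).congr_of_eventuallyEq heq
  -- far away only the second integral occurs, so `H` tends to `0` at infinity; Liouville concludes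
  obtain ⟨R, hR⟩ := C.isCompact_trace.isBounded.exists_norm_le
  obtain ⟨M, hM⟩ := C.isCompact_trace.exists_bound_of_continuousOn hfc
  have hfar : ∀ z : ℂ, R < ‖z‖ →
      ‖H z‖ ≤ M * (‖z‖ - R)⁻¹ * ∫ t in (0 : ℝ)..1, ‖deriv C.toFun t‖ := by
    intro z hz
    have hw := C.winding_eq_zero_of_halfPlane (w := z) (u := -(starRingEnd ℂ) z) fun w hw => by
      have h1 : (-(starRingEnd ℂ) z * (w - z)).re = ‖z‖ ^ 2 - ((starRingEnd ℂ) z * w).re := by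
        rw [mul_sub, sub_re, neg_mul, neg_mul, neg_re, neg_re, ← normSq_eq_conj_mul_self,
          ofReal_re, normSq_eq_norm_sq]
        ring
      have h2 : ((starRingEnd ℂ) z * w).re ≤ ‖z‖ * ‖w‖ := by
        refine (re_le_norm _).trans ?_
        rw [norm_mul, RCLike.norm_conj]
      have h3 := hR w hw
      have h4 := norm_nonneg w
      rw [h1]
      nlinarith
    rw [hout z hw.1 hw.2]
    refine C.norm_integral_le fun w hw => ?_
    have h1 := hM w hw
    have h2 : ‖z‖ - R ≤ ‖w - z‖ := by
      have := norm_sub_norm_le z w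
      rw [norm_sub_rev]
      linarith [hR w hw]
    rw [norm_mul, norm_inv]
    have : 0 < ‖z‖ - R := sub_pos.2 hz
    gcongr
    exact (norm_nonneg _).trans h1
  have hlim : Tendsto H (cocompact ℂ) (𝓝 0) := by
    rw [tendsto_zero_iff_norm_tendsto_zero]
    refine squeeze_zero' (Eventually.of_forall fun z => norm_nonneg _)
      (((tendsto_norm_cocompact_atTop (E := ℂ)).eventually_gt_atTop R).mono hfar) ?_
    have h1 : Tendsto (fun z : ℂ => (‖z‖ - R)⁻¹) (cocompact ℂ) (𝓝 0) :=
      (tendsto_atTop_add_const_right _ (-R) tendsto_norm_cocompact_atTop).inv_tendsto_atTop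
    simpa using (h1.const_mul M).mul_const (∫ t in (0 : ℝ)..1, ‖deriv C.toFun t‖)
  have := hdiff.apply_eq_of_tendsto_cocompact z₀ hlim
  simpa only [hH, hz₀, if_true] using this

/-- **Cauchy's theorem**: the integral of a function vanishes if the contour does not wind around
any point off the domain of holomorphy. -/
theorem integral_eq_zero_of_differentiableOn {Ω : Set ℂ} (hΩ : IsOpen Ω) {f : ℂ → ℂ}
    (hf : DifferentiableOn ℂ f Ω) (hex : ∀ w ∉ Ω, C.Excludes w) : C.integral f = 0 := by
  have hz₀ : C.toFun 0 ∈ Ω := C.trace_subset hex (C.mem_trace ⟨le_rfl, zero_le_one⟩)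
  -- `f` is itself a difference quotient, of `(w - z₀) f w` at a point `z₀` of the contour
  have h1 : dslope (fun w => (w - C.toFun 0) • f w) (C.toFun 0) = f := by
    have hd := (hf.differentiableAt (hΩ.mem_nhds hz₀)).hasDerivAt
    have h : HasDerivAt (fun w => (w - C.toFun 0) • f w) (f (C.toFun 0)) (C.toFun 0) := by
      have h0 := ((hasDerivAt_id (C.toFun 0)).sub_const (C.toFun 0)).fun_smul hd
      simpa using h0
    rw [dslope_sub_smul, h.deriv, Function.update_eq_self]
  have h2 := C.integral_dslope_eq_zero hΩ (f := fun w => (w - C.toFun 0) • f w)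
    (((differentiableOn_id.sub_const _)).smul hf) hex hz₀
  rwa [h1] at h2

/-- **Residue theorem** for simple poles. -/
theorem integral_eq_sum_residues {ι : Type*} (s : Finset ι) (a r : ι → ℂ)
    (hinj : Set.InjOn a s) {Ω : Set ℂ} (hΩ : IsOpen Ω) (haΩ : ∀ i ∈ s, a i ∈ Ω)
    (ha : ∀ i ∈ s, C.Encircles (a i)) (hex : ∀ w ∉ Ω, C.Excludes w) {f : ℂ → ℂ}
    (hf : DifferentiableOn ℂ f (Ω \ a '' s))
    (hr : ∀ i ∈ s, Tendsto (fun z => (z - a i) * f z) (𝓝[≠] a i) (𝓝 (r i))) :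
    C.integral f = 2 * Real.pi * I * ∑ i ∈ s, r i := by
  classical
  induction s using Finset.induction_on generalizing f with
  | empty =>
    simp only [Finset.coe_empty, image_empty, sdiff_empty] at hf
    simpa using C.integral_eq_zero_of_differentiableOn hΩ hf hex
  | insert i s hi ih =>
    have hne : ∀ j ∈ s, a j ≠ a i := fun j hj h => hi <| by
      rwa [hinj (by simp [hj]) (by simp) h] at hj
    have hai := (ha i (by simp)).notMem
    -- subtract the principal part at `a i` and remove the singularity
    set g₀ : ℂ → ℂ := fun z => f z - r i * (z - a i)⁻¹ with hg₀
    set g := Function.update g₀ (a i) (limUnder (𝓝[≠] a i) g₀) with hg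
    have hopen : IsOpen (Ω \ a '' s) := hΩ.sdiff (s.finite_toSet.image a).isClosed
    have hmem : a i ∈ Ω \ a '' s := by
      refine ⟨haΩ i (by simp), ?_⟩
      rintro ⟨j, hj, h⟩
      exact hne j hj h
    have hg₀d : DifferentiableOn ℂ g₀ ((Ω \ a '' s) \ {a i}) := by
      refine DifferentiableOn.sub (hf.mono ?_) (DifferentiableOn.const_mul
        (DifferentiableOn.inv (by fun_prop) fun z hz => sub_ne_zero.2 hz.2) _)
      rw [sdiff_sdiff, Finset.coe_insert, image_insert_eq, insert_eq, union_comm]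
    have hlim : Tendsto (fun z => (z - a i) * g₀ z) (𝓝[≠] a i) (𝓝 0) := by
      have h1 := (hr i (by simp)).sub_const (r i)
      rw [sub_self] at h1
      refine h1.congr' ?_
      filter_upwards [self_mem_nhdsWithin] with z hz
      have : z - a i ≠ 0 := sub_ne_zero.2 hz
      rw [hg₀]
      field_simp
    have hgd : DifferentiableOn ℂ g (Ω \ a '' s) := by
      refine differentiableOn_update_limUnder_of_isLittleO (hopen.mem_nhds hmem) hg₀d ?_
      rw [Asymptotics.isLittleO_iff_tendsto' (by
        filter_upwards [self_mem_nhdsWithin] with z hz h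
        exact absurd (inv_eq_zero.1 h) (sub_ne_zero.2 hz))]
      have h2 : Tendsto (fun z => (z - a i) * g₀ (a i)) (𝓝[≠] a i) (𝓝 0) := by
        have : Tendsto (fun z => (z - a i) * g₀ (a i)) (𝓝 (a i)) (𝓝 ((a i - a i) * g₀ (a i))) :=
          Continuous.tendsto (by fun_prop) _
        rw [sub_self, zero_mul] at this
        exact this.mono_left nhdsWithin_le_nhds
      have h3 := hlim.sub h2
      rw [sub_zero] at h3
      refine h3.congr fun z => ?_
      rw [div_inv_eq_mul]
      ring
    have hgr : ∀ j ∈ s, Tendsto (fun z => (z - a j) * g z) (𝓝[≠] a j) (𝓝 (r j)) := by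
      intro j hj
      have hji := sub_ne_zero.2 (hne j hj)
      have h1 : Tendsto (fun z => (z - a j) * (r i * (z - a i)⁻¹)) (𝓝[≠] a j) (𝓝 0) := by
        have hcont : ContinuousAt (fun z => (z - a j) * (r i * (z - a i)⁻¹)) (a j) := by
          refine ContinuousAt.mul (by fun_prop) (ContinuousAt.mul continuousAt_const
            (ContinuousAt.inv₀ (by fun_prop) hji))
        have := hcont.tendsto
        rw [sub_self, zero_mul] at this
        exact this.mono_left nhdsWithin_le_nhds
      have h2 := (hr j (by simp [hj])).sub h1
      rw [sub_zero] at h2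
      refine h2.congr' ?_
      filter_upwards [mem_nhdsWithin_of_mem_nhds (isOpen_ne.mem_nhds (hne j hj))] with z hz
      rw [hg, Function.update_of_ne hz, hg₀]
      ring
    have hig := ih (hinj.mono (by simp)) (fun j hj => haΩ j (by simp [hj]))
      (fun j hj => ha j (by simp [hj])) hgd hgr
    have htr : C.trace ⊆ Ω \ a '' (insert i s : Finset ι) := fun w hw =>
      ⟨C.trace_subset hex hw, by
        rintro ⟨j, hj, rfl⟩
        exact (ha j hj).notMem hw⟩
    have h1 : C.integral g = C.integral f - r i * C.integral fun z => (z - a i)⁻¹ := by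
      rw [← C.integral_const_mul, ← C.integral_sub (g := fun z => r i * (z - a i)⁻¹)
        (hf.continuousOn.mono htr) (continuousOn_const.mul (C.continuousOn_inv_sub hai))]
      refine C.integral_congr fun t ht => ?_
      have hne' : C.toFun t ≠ a i := fun h => hai (h ▸ C.mem_trace ht)
      rw [hg, Function.update_of_ne hne']
    have h2 : C.integral (fun z => (z - a i)⁻¹) = 2 * Real.pi * I := by
      have := (ha i (by simp)).2
      rw [winding] at this
      have h0 : (2 * Real.pi * I : ℂ) ≠ 0 := by simp [Real.pi_ne_zero]
      rwa [inv_mul_eq_one₀ h0, eq_comm] at this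
    rw [Finset.sum_insert hi, mul_add, ← hig, h1, h2]
    ring

/-- A point `z` where a function `f` exceeds in modulus its values on the contour is not encircled:
this is the maximum principle, in terms of winding numbers. By Cauchy's formula, `f z ^ j` times the
winding number is a Cauchy integral of `f ^ j`, which tends to `0` as `j → ∞`. -/
lemma excludes_of_norm_ge {Ω : Set ℂ} (hΩ : IsOpen Ω) {f : ℂ → ℂ} (hf : DifferentiableOn ℂ f Ω)
    (hex : ∀ w ∉ Ω, C.Excludes w) (hlt : ∀ w ∈ C.trace, ‖f w‖ < 1) {z : ℂ} (hz : z ∈ Ω)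
    (hge : 1 ≤ ‖f z‖) : C.Excludes z := by
  have htr := C.trace_subset hex
  have hzt : z ∉ C.trace := fun h => (hlt z h).not_ge hge
  refine ⟨fun t ht h => hzt (h ▸ C.mem_trace ht), ?_⟩
  have hfc : ContinuousOn f C.trace := hf.continuousOn.mono htr
  obtain ⟨ρ, hρ0, hρ1, hρ⟩ : ∃ ρ : ℝ, 0 ≤ ρ ∧ ρ < 1 ∧ ∀ w ∈ C.trace, ‖f w‖ ≤ ρ := by
    obtain ⟨w, hw, hmax⟩ := C.isCompact_trace.exists_isMaxOn
      ⟨_, C.mem_trace (t := 0) ⟨le_rfl, zero_le_one⟩⟩ hfc.norm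
    exact ⟨‖f w‖, norm_nonneg _, hlt w hw, fun y hy => hmax hy⟩
  have hcauchy : ∀ j : ℕ, f z ^ j * C.integral (fun w => (w - z)⁻¹) =
      C.integral fun w => f w ^ j * (w - z)⁻¹ := by
    intro j
    have h := C.integral_dslope_eq_zero hΩ (f := fun w => f w ^ j) (hf.pow j) hex hz
    rw [C.integral_congr (g := fun w => f w ^ j * (w - z)⁻¹ - f z ^ j * (w - z)⁻¹) fun t ht => ?_,
      C.integral_sub (f := fun w => f w ^ j * (w - z)⁻¹) (g := fun w => f z ^ j * (w - z)⁻¹)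
        ((hfc.pow j).mul (C.continuousOn_inv_sub hzt))
        (continuousOn_const.mul (C.continuousOn_inv_sub hzt)), C.integral_const_mul] at h
    · exact (sub_eq_zero.1 h).symm
    · have hne : C.toFun t ≠ z := fun h => hzt (h ▸ C.mem_trace ht)
      rw [dslope_of_ne _ hne, slope_def_field, div_eq_mul_inv, sub_mul]
  obtain ⟨K, hK⟩ := C.isCompact_trace.exists_bound_of_continuousOn (C.continuousOn_inv_sub hzt)
  set L := ∫ t in (0 : ℝ)..1, ‖deriv C.toFun t‖
  have hbound : ∀ j : ℕ, ‖C.integral fun w => (w - z)⁻¹‖ ≤ ρ ^ j * K * L := by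
    intro j
    calc ‖C.integral fun w => (w - z)⁻¹‖ ≤ ‖f z ^ j * C.integral fun w => (w - z)⁻¹‖ := by
          rw [norm_mul, norm_pow]
          exact le_mul_of_one_le_left (norm_nonneg _) (one_le_pow₀ hge)
      _ ≤ ρ ^ j * K * L := by
          rw [hcauchy]
          refine C.norm_integral_le fun w hw => ?_
          rw [norm_mul, norm_pow]
          have := hρ w hw
          have := hK w hw
          gcongr
  have hlim : Tendsto (fun j : ℕ => ρ ^ j * K * L) atTop (𝓝 0) := by
    simpa using ((tendsto_pow_atTop_nhds_zero_of_lt_one hρ0 hρ1).mul_const K).mul_const L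
  have := norm_le_zero_iff.1 (ge_of_tendsto' hlim hbound)
  rw [winding, this, mul_zero]

/-- A contour in the strip `|Im z| < π / 2` winds only around points of this strip. -/
lemma excludes_of_strip (hC : ∀ t ∈ Icc (0 : ℝ) 1, |(C.toFun t).im| < Real.pi / 2) {w : ℂ}
    (hw : Real.pi / 2 ≤ |w.im|) : C.Excludes w := by
  obtain ⟨h1, h2⟩ : w ∉ C.trace ∧ C.winding w = 0 := by
    rcases le_abs.1 hw with hw | hw
    · refine C.winding_eq_zero_of_halfPlane (u := I) ?_
      rintro _ ⟨t, ht, rfl⟩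
      have := abs_lt.1 (hC t ht)
      simp
      linarith
    · refine C.winding_eq_zero_of_halfPlane (u := -I) ?_
      rintro _ ⟨t, ht, rfl⟩
      have := abs_lt.1 (hC t ht)
      simp
      linarith
  exact ⟨fun t ht h => h1 (h ▸ C.mem_trace ht), h2⟩

lemma Encircles.not_excludes {C : Contour} {w : ℂ} (h : C.Encircles w) :
    ¬ C.Excludes w := fun h' => by
  have := h.2.symm.trans h'.2
  norm_num at this

end Contour

/-! ### The kernel and its residues -/

lemma sinh_eq_zero_iff {z : ℂ} : sinh z = 0 ↔ ∃ m : ℤ, z = m * (Real.pi * I) := by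
  have h1 : sinh z = 0 ↔ exp (2 * z) = 1 := by
    rw [Complex.sinh, div_eq_zero_iff, sub_eq_zero, or_iff_left (by norm_num), two_mul,
      exp_add, exp_neg, ← mul_eq_one_iff_eq_inv₀ (exp_ne_zero z)]
  rw [h1, exp_eq_one_iff]
  refine exists_congr fun m => ⟨fun h => ?_, fun h => ?_⟩
  · linear_combination h / 2
  · linear_combination 2 * h

lemma eq_of_sinh_sub_eq_zero {z w : ℂ} (hz : |z.im| < Real.pi / 2) (hw : |w.im| < Real.pi / 2)
    (h : sinh (z - w) = 0) : z = w := by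
  obtain ⟨m, hm⟩ := sinh_eq_zero_iff.1 h
  have him := congrArg im hm
  simp only [sub_im, mul_im, intCast_re, ofReal_im, I_re, mul_zero, ofReal_re, I_im, mul_one,
    intCast_im, mul_re, sub_self, add_zero] at him
  rw [abs_lt] at hz hw
  have hpi := Real.pi_pos
  have hm0 : m = 0 := by
    have h1 : (m : ℝ) < 1 := by nlinarith
    have h2 : (-1 : ℝ) < m := by nlinarith
    have h3 : m < 1 := by exact_mod_cast h1
    have h4 : -1 < m := by exact_mod_cast h2
    omega
  rw [hm0, Int.cast_zero, zero_mul, sub_eq_zero] at hm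
  exact hm

lemma Contour.excludes_of_sinh_eq_zero {C : Contour} {w z : ℂ}
    (h : ∀ m : ℤ, C.Excludes (w + m * (Real.pi * I))) (hz : sinh (z - w) = 0) : C.Excludes z := by
  obtain ⟨m, hm⟩ := sinh_eq_zero_iff.1 hz
  rw [sub_eq_iff_eq_add'.1 hm]
  exact h m

/-- Simple poles of functions built from `1 / sinh`. -/
lemma tendsto_mul_inv_sinh {p : ℂ} {g : ℂ → ℂ} (hg : ContinuousAt g p) :
    Tendsto (fun z => (z - p) * ((sinh (z - p))⁻¹ * g z)) (𝓝[≠] p) (𝓝 (g p)) := by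
  have h1 : HasDerivAt (fun z => sinh (z - p)) 1 p := by
    have := ((hasDerivAt_id p).sub_const p).csinh
    simpa using this
  have h2 : Tendsto (fun z => (z - p)⁻¹ * sinh (z - p)) (𝓝[≠] p) (𝓝 1) := by
    refine (hasDerivAt_iff_tendsto_slope.1 h1).congr fun z => ?_
    rw [slope_def_field]
    simp [div_eq_inv_mul]
  have h3 := (h2.inv₀ one_ne_zero).mul (hg.tendsto.mono_left nhdsWithin_le_nhds)
  rw [inv_one, one_mul] at h3
  refine h3.congr fun z => ?_
  rw [mul_inv, inv_inv, mul_assoc]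

section Kernel

variable {N : ℕ} (h T : ℝ) (η : ℂ) (lam : Fin N → ℂ)

/-- The factor of `Û(x, z)` which depends on both variables. -/
def kernelPole (x z : ℂ) : ℂ := (sinh (z + x) * sinh (x - z + η))⁻¹

/-- The factor of `Û(x, z)` which depends on `z` only. -/
def kernelWeight (z : ℂ) : ℂ :=
  -exp (-((h : ℂ) / T)) * sinh (2 * z + η) *
    ∏ a, (sinh (lam a + z) * sinh (z - lam a + η)) / (sinh (z - lam a) * sinh (lam a + z + η))

/-- The regular cofactor of the pole of the weight at `lam k`. -/
def weightAtRoot (k : Fin N) (z : ℂ) : ℂ :=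
  -exp (-((h : ℂ) / T)) * sinh (2 * z + η) *
    ((∏ a, sinh (z - lam a + η)) / ∏ a ∈ Finset.univ.erase k, sinh (z - lam a)) *
    ∏ a, sinh (lam a + z) / sinh (lam a + z + η)

/-- The regular cofactor of the zero of the weight at `-lam k`. -/
def weightAtNeg (k : Fin N) (z : ℂ) : ℂ :=
  -exp (-((h : ℂ) / T)) * sinh (2 * z + η) * (∏ a ∈ Finset.univ.erase k, sinh (lam a + z)) *
    ∏ a, sinh (z - lam a + η) / (sinh (z - lam a) * sinh (lam a + z + η))

/-- The residue of `Û(x, z)` at `z = lam k`. -/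
def kernelRes (x : ℂ) (k : Fin N) : ℂ :=
  kernelPole η x (lam k) * weightAtRoot h T η lam k (lam k)

lemma UHat_eq (x z : ℂ) : UHat h T η lam x z = kernelPole η x z * kernelWeight h T η lam z := by
  simp only [UHat, kernelPole, kernelWeight, div_eq_mul_inv]
  ring

lemma matU_eq (j k : Fin N) : matU h T η lam j k = kernelRes h T η lam (lam j) k := by
  simp only [matU, kernelRes, kernelPole, weightAtRoot, div_eq_mul_inv]
  ring

lemma kernelWeight_eq_atRoot (k : Fin N) (z : ℂ) :
    kernelWeight h T η lam z = (sinh (z - lam k))⁻¹ * weightAtRoot h T η lam k z := by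
  simp only [kernelWeight, weightAtRoot, Finset.prod_div_distrib, Finset.prod_mul_distrib]
  rw [← Finset.mul_prod_erase _ (fun a => sinh (z - lam a)) (Finset.mem_univ k)]
  simp only [div_eq_mul_inv, mul_inv]
  ring

lemma kernelWeight_eq_atNeg (k : Fin N) (z : ℂ) :
    kernelWeight h T η lam z = sinh (z + lam k) * weightAtNeg h T η lam k z := by
  simp only [kernelWeight, weightAtNeg, Finset.prod_div_distrib, Finset.prod_mul_distrib]
  rw [← Finset.mul_prod_erase _ (fun a => sinh (lam a + z)) (Finset.mem_univ k), add_comm z]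
  simp only [div_eq_mul_inv]
  ring

variable {η lam}

lemma differentiableAt_kernelWeight {z : ℂ} (h1 : ∀ a, sinh (z - lam a) ≠ 0)
    (h2 : ∀ a, sinh (lam a + z + η) ≠ 0) : DifferentiableAt ℂ (kernelWeight h T η lam) z := by
  unfold kernelWeight
  refine DifferentiableAt.mul (by fun_prop) (DifferentiableAt.fun_finsetProd fun a _ => ?_)
  exact DifferentiableAt.div (by fun_prop) (by fun_prop) (mul_ne_zero (h1 a) (h2 a))

lemma differentiableAt_weightAtRoot {k : Fin N} {z : ℂ} (h1 : ∀ a, a ≠ k → sinh (z - lam a) ≠ 0)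
    (h2 : ∀ a, sinh (lam a + z + η) ≠ 0) :
    DifferentiableAt ℂ (weightAtRoot h T η lam k) z := by
  unfold weightAtRoot
  refine DifferentiableAt.mul (DifferentiableAt.mul (by fun_prop) (DifferentiableAt.div ?_ ?_ ?_))
    (DifferentiableAt.fun_finsetProd fun a _ => ?_)
  · exact DifferentiableAt.fun_finsetProd fun a _ => by fun_prop
  · exact DifferentiableAt.fun_finsetProd fun a _ => by fun_prop
  · exact Finset.prod_ne_zero_iff.2 fun a ha => h1 a (Finset.ne_of_mem_erase ha)
  · exact DifferentiableAt.div (by fun_prop) (by fun_prop) (h2 a)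

lemma differentiableAt_weightAtNeg {k : Fin N} {z : ℂ} (h1 : ∀ a, sinh (z - lam a) ≠ 0)
    (h2 : ∀ a, sinh (lam a + z + η) ≠ 0) :
    DifferentiableAt ℂ (weightAtNeg h T η lam k) z := by
  unfold weightAtNeg
  refine DifferentiableAt.mul (DifferentiableAt.mul (by fun_prop) ?_)
    (DifferentiableAt.fun_finsetProd fun a _ => ?_)
  · exact DifferentiableAt.fun_finsetProd fun a _ => by fun_prop
  · exact DifferentiableAt.div (by fun_prop) (by fun_prop) (mul_ne_zero (h1 a) (h2 a))

lemma differentiableAt_kernelPole_right {x z : ℂ} (h1 : sinh (z + x) ≠ 0)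
    (h2 : sinh (x - z + η) ≠ 0) : DifferentiableAt ℂ (fun z => kernelPole η x z) z := by
  unfold kernelPole
  exact DifferentiableAt.inv (by fun_prop) (mul_ne_zero h1 h2)

lemma differentiableAt_kernelPole_left {y z : ℂ} (h1 : sinh (y + z) ≠ 0)
    (h2 : sinh (z - y + η) ≠ 0) : DifferentiableAt ℂ (fun z => kernelPole η z y) z := by
  unfold kernelPole
  exact DifferentiableAt.inv (by fun_prop) (mul_ne_zero h1 h2)

lemma differentiableAt_fHat {z : ℂ} (h1 : ∀ a, sinh (lam a + z + η) ≠ 0)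
    (h2 : ∀ a, sinh (lam a - z + η) ≠ 0) : DifferentiableAt ℂ (fHat h T η lam) z := by
  unfold fHat
  refine DifferentiableAt.mul (by fun_prop) (DifferentiableAt.fun_finsetProd fun a _ => ?_)
  exact DifferentiableAt.div (by fun_prop) (by fun_prop) (mul_ne_zero (h1 a) (h2 a))

lemma exp_two_mul_div : exp (-(2 * (h : ℂ) / T)) = exp (-((h : ℂ) / T)) ^ 2 := by
  rw [← exp_nat_mul]
  congr 1
  push_cast
  ring

/-- The weight has opposite behaviour at `lam k` and at `-lam k`: the product of its residue and of
its slope there is governed by `f̂ (lam k)`. -/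
lemma weightAtNeg_mul_weightAtRoot (k : Fin N) (hη1 : sinh (-lam k - lam k + η) ≠ 0)
    (hη2 : sinh (lam k + lam k + η) ≠ 0) (hdist : ∀ a, a ≠ k → sinh (lam k - lam a) ≠ 0)
    (hsum : ∀ a, sinh (lam a + lam k) ≠ 0) :
    weightAtNeg h T η lam k (-lam k) * weightAtRoot h T η lam k (lam k) *
      (sinh (-lam k - lam k + η) * sinh (lam k + lam k + η))⁻¹ = -fHat h T η lam (lam k) := by
  have e1 : ∏ a ∈ Finset.univ.erase k, sinh (lam a + -lam k) =
      (-1) ^ (N - 1) * ∏ a ∈ Finset.univ.erase k, sinh (lam k - lam a) := by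
    have hc : (Finset.univ.erase k).card = N - 1 := by simp
    rw [← hc, ← Finset.prod_const, ← Finset.prod_mul_distrib]
    refine Finset.prod_congr rfl fun a _ => ?_
    rw [neg_one_mul, ← sinh_neg]
    congr 1
    ring
  have e2 : (∏ a, sinh (-lam k - lam a + η) / (sinh (-lam k - lam a) * sinh (lam a + -lam k + η))) *
      ((∏ a, sinh (lam k - lam a + η)) * ∏ a, sinh (lam a + lam k) / sinh (lam a + lam k + η)) =
      (-1) ^ N * ∏ a, (sinh (lam a + lam k - η) * sinh (lam a - lam k - η)) /
        (sinh (lam a + lam k + η) * sinh (lam a - lam k + η)) := by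
    have hc : (-1 : ℂ) ^ N = ∏ _a : Fin N, (-1 : ℂ) := by simp
    rw [hc, ← Finset.prod_mul_distrib, ← Finset.prod_mul_distrib, ← Finset.prod_mul_distrib]
    refine Finset.prod_congr rfl fun a _ => ?_
    have s1 : sinh (-lam k - lam a + η) = -sinh (lam a + lam k - η) := by
      rw [← sinh_neg]; congr 1; ring
    have s2 : sinh (lam k - lam a + η) = -sinh (lam a - lam k - η) := by
      rw [← sinh_neg]; congr 1; ring
    have s3 : sinh (-lam k - lam a) = -sinh (lam a + lam k) := by
      rw [← sinh_neg]; congr 1; ring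
    have s4 : lam a + -lam k + η = lam a - lam k + η := by ring
    rw [s1, s2, s3, s4]
    have := hsum a
    simp only [div_eq_mul_inv, mul_inv, inv_neg]
    linear_combination (-sinh (lam a + lam k - η) * (sinh (lam a - lam k + η))⁻¹ *
      sinh (lam a - lam k - η) * (sinh (lam a + lam k + η))⁻¹) * mul_inv_cancel₀ this
  have hD : ∏ a ∈ Finset.univ.erase k, sinh (lam k - lam a) ≠ 0 :=
    Finset.prod_ne_zero_iff.2 fun a ha => hdist a (Finset.ne_of_mem_erase ha)
  have hpow : ((-1 : ℂ)) ^ (N - 1) * (-1) ^ N = -1 := by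
    obtain ⟨n, rfl⟩ := Nat.exists_eq_add_one.2 (Fin.pos k)
    rw [Nat.add_sub_cancel, pow_succ, ← mul_assoc, ← mul_pow]
    norm_num
  simp only [weightAtNeg, weightAtRoot, fHat]
  rw [exp_two_mul_div, e1]
  have t1 : 2 * -lam k + η = -lam k - lam k + η := by ring
  have t2 : 2 * lam k + η = lam k + lam k + η := by ring
  rw [t1, t2]
  generalize (∏ a, (sinh (lam a + lam k - η) * sinh (lam a - lam k - η)) /
        (sinh (lam a + lam k + η) * sinh (lam a - lam k + η))) = F at e2 ⊢
  generalize (∏ a, sinh (-lam k - lam a + η) / (sinh (-lam k - lam a) *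
    sinh (lam a + -lam k + η))) = A at e2 ⊢
  generalize (∏ a, sinh (lam k - lam a + η)) = B at e2 ⊢
  generalize (∏ a, sinh (lam a + lam k) / sinh (lam a + lam k + η)) = G at e2 ⊢
  generalize (∏ a ∈ Finset.univ.erase k, sinh (lam k - lam a)) = D at hD ⊢
  generalize sinh (-lam k - lam k + η) = s₁ at hη1 ⊢
  generalize sinh (lam k + lam k + η) = s₂ at hη2 ⊢
  field_simp
  linear_combination (-1 : ℂ) ^ (N - 1) * e2 + F * hpow

lemma exp_mul_prod_eq_aHat_zero {β : ℂ} (hβ : sinh (β / N) ≠ 0)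
    (hβη : sinh (β / N - η) ≠ 0) :
    exp (-((h : ℂ) / T)) * ∏ a, sinh (lam a - η) / sinh (lam a + η) = aHat h T η β lam 0 := by
  have e1 : (sinh (0 + β / N - η) * sinh (0 - β / N)) / (sinh (0 - β / N + η) * sinh (0 + β / N))
      = 1 := by
    have s1 : sinh (0 - β / N) = -sinh (β / N) := by rw [← sinh_neg]; congr 1; ring
    have s2 : sinh (0 - β / N + η) = -sinh (β / N - η) := by rw [← sinh_neg]; congr 1; ring
    rw [s1, s2, zero_add, mul_neg, neg_mul, div_self]
    exact neg_ne_zero.2 (mul_ne_zero hβη hβ)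
  rw [aHat, e1, one_pow, mul_one]
  congr 1
  refine Finset.prod_congr rfl fun a _ => ?_
  have s1 : sinh (0 - lam a + η) = -sinh (lam a - η) := by rw [← sinh_neg]; congr 1; ring
  have s2 : sinh (0 - lam a - η) = -sinh (lam a + η) := by rw [← sinh_neg]; congr 1; ring
  rw [s1, s2, neg_div_neg_eq]

/-- At the origin the driving factor of `â` is `1`, and `f̂` is a square. -/
lemma fHat_zero {β : ℂ} (hβ : sinh (β / N) ≠ 0) (hβη : sinh (β / N - η) ≠ 0) :
    fHat h T η lam 0 = aHat h T η β lam 0 ^ 2 := by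
  rw [← exp_mul_prod_eq_aHat_zero h T hβ hβη, fHat, exp_two_mul_div, mul_pow,
    ← Finset.prod_pow]
  congr 1
  refine Finset.prod_congr rfl fun a _ => ?_
  rw [add_zero, sub_zero, div_pow, sq, sq]

/-- The Bethe equations turn the values of `f̂` at the roots into values of `â`. -/
lemma fHat_root {β : ℂ} (hBethe : BetheEquations h T η β lam) (p : Fin N) :
    fHat h T η lam (lam p) = -aHat h T η β lam (-lam p) := by
  have hB := hBethe p
  rw [aHat, fHat, exp_two_mul_div]
  set b := β / N
  set E := exp (-((h : ℂ) / T))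
  set X := ∏ k, sinh (lam p - lam k + η) / sinh (lam p - lam k - η) with hX
  set g := (sinh (lam p + b - η) * sinh (lam p - b)) / (sinh (lam p - b + η) * sinh (lam p + b))
    with hg
  have hgN : g ^ N ≠ 0 := fun h0 => by
    rw [h0, mul_zero] at hB
    norm_num at hB
  have eg : (sinh (-lam p + b - η) * sinh (-lam p - b)) /
      (sinh (-lam p - b + η) * sinh (-lam p + b)) = g⁻¹ := by
    have s1 : sinh (-lam p + b - η) = -sinh (lam p - b + η) := by rw [← sinh_neg]; congr 1; ring
    have s2 : sinh (-lam p - b) = -sinh (lam p + b) := by rw [← sinh_neg]; congr 1; ring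
    have s3 : sinh (-lam p - b + η) = -sinh (lam p + b - η) := by rw [← sinh_neg]; congr 1; ring
    have s4 : sinh (-lam p + b) = -sinh (lam p - b) := by rw [← sinh_neg]; congr 1; ring
    rw [s1, s2, s3, s4, neg_mul_neg, neg_mul_neg, hg, inv_div]
  have eY : (∏ a, (sinh (lam a + lam p - η) * sinh (lam a - lam p - η)) /
        (sinh (lam a + lam p + η) * sinh (lam a - lam p + η))) =
      X * ∏ k, sinh (-lam p - lam k + η) / sinh (-lam p - lam k - η) := by
    rw [hX, ← Finset.prod_mul_distrib]
    refine Finset.prod_congr rfl fun a _ => ?_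
    have s1 : sinh (lam p - lam a + η) = -sinh (lam a - lam p - η) := by
      rw [← sinh_neg]; congr 1; ring
    have s2 : sinh (lam p - lam a - η) = -sinh (lam a - lam p + η) := by
      rw [← sinh_neg]; congr 1; ring
    have s3 : sinh (-lam p - lam a + η) = -sinh (lam a + lam p - η) := by
      rw [← sinh_neg]; congr 1; ring
    have s4 : sinh (-lam p - lam a - η) = -sinh (lam a + lam p + η) := by
      rw [← sinh_neg]; congr 1; ring
    rw [s1, s2, s3, s4, neg_div_neg_eq, neg_div_neg_eq]
    simp only [div_eq_mul_inv, mul_inv]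
    ring
  rw [eY, eg, inv_pow]
  generalize (∏ k, sinh (-lam p - lam k + η) / sinh (-lam p - lam k - η)) = Y
  field_simp
  linear_combination -E * Y * hB

end Kernel

/-! ### Residue computations for one integration -/

/-- `φ` is holomorphic at all points around which the contour may wind. -/
def Contour.HolomorphicInside (C : Contour) (φ : ℂ → ℂ) : Prop :=
  ∃ Ω : Set ℂ, IsOpen Ω ∧ DifferentiableOn ℂ φ Ω ∧ ∀ w ∉ Ω, C.Excludes w

namespace AdaptedContours

variable {N : ℕ} {η : ℂ} {lam : Fin N → ℂ} {C : ℕ → Contour} (hC : AdaptedContours η lam C)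
include hC

lemma abs_im_lt_of_encircles {q : ℕ} {w : ℂ} (hw : (C q).Encircles w) :
    |w.im| < Real.pi / 2 := by
  by_contra! h
  exact hw.not_excludes ((C q).excludes_of_strip (hC.strip q) h)

omit hC in
lemma sinh_sub_ne_zero {C : Contour} {z w : ℂ} (hz : C.Encircles z)
    (hw : ∀ m : ℤ, C.Excludes (w + m * (Real.pi * I))) : sinh (z - w) ≠ 0 :=
  fun h0 => hz.not_excludes (Contour.excludes_of_sinh_eq_zero hw h0)

lemma sinh_add_add_ne_zero {q : ℕ} {z : ℂ} (hz : (C q).Encircles z) (a : Fin N) :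
    sinh (lam a + z + η) ≠ 0 := by
  have := sinh_sub_ne_zero hz (hC.neg_root_sub q a)
  rwa [show z - (-lam a - η) = lam a + z + η by ring] at this

lemma sinh_sub_add_ne_zero {q : ℕ} {z : ℂ} (hz : (C q).Encircles z) (a : Fin N) :
    sinh (z - lam a + η) ≠ 0 := by
  have := sinh_sub_ne_zero hz (hC.root_sub q a)
  rwa [show z - (lam a - η) = z - lam a + η by ring] at this

lemma sinh_root_sub_add_ne_zero {q : ℕ} {z : ℂ} (hz : (C q).Encircles z) (a : Fin N) :
    sinh (lam a - z + η) ≠ 0 := by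
  have := sinh_sub_ne_zero hz (hC.root_add q a)
  rwa [show z - (lam a + η) = -(lam a - z + η) by ring, sinh_neg, neg_ne_zero] at this

lemma sinh_eta_ne_zero (hN : 0 < N) : sinh η ≠ 0 := by
  have := hC.sinh_sub_add_ne_zero (hC.root 0 ⟨0, hN⟩) ⟨0, hN⟩
  rwa [sub_self, zero_add] at this

/-- The zeros of `sinh (z + x)` and `sinh (x - z + η)`, for `x` on an outer contour, lie outside. -/
lemma excludes_pole_right {p q : ℕ} (hpq : p < q) {x : ℂ} (hx : x ∈ (C p).trace) {z : ℂ}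
    (hz : ¬ (|z.im| < Real.pi / 2 ∧ sinh (z + x) ≠ 0 ∧ sinh (x - z + η) ≠ 0)) :
    (C q).Excludes z := by
  obtain ⟨t, ht, rfl⟩ := hx
  by_cases hs : |z.im| < Real.pi / 2
  swap
  · exact (C q).excludes_of_strip (hC.strip q) (not_lt.1 hs)
  by_cases h1 : sinh (z + (C p).toFun t) = 0
  · have hz : z = -(C p).toFun t := by
      refine eq_of_sinh_sub_eq_zero hs ?_ (by rwa [sub_neg_eq_add])
      rw [neg_im, abs_neg]
      exact hC.strip p t ht
    have h2 := (hC.encased_neg p q hpq).2 t ht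
    rw [hz]
    refine ⟨fun s hs h0 => h2.1 s hs ?_, ?_⟩
    · simp [Contour.neg, h0]
    · rw [← h2.2, Contour.winding, Contour.winding, Contour.integral, Contour.integral]
      congr 1
      refine intervalIntegral.integral_congr fun s _ => ?_
      simp only [Contour.neg, deriv.fun_neg]
      rw [show -(C q).toFun s - (C p).toFun t = -((C q).toFun s - -(C p).toFun t) by ring, inv_neg]
      ring
  · have h2 : sinh ((C p).toFun t - z + η) = 0 := by
      by_contra h2
      exact hz ⟨hs, h1, h2⟩
    refine Contour.excludes_of_sinh_eq_zero (hC.shift_add p q hpq.ne t ht) ?_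
    rw [← neg_eq_zero, ← sinh_neg, ← h2]
    congr 1
    ring

/-- The zeros of `sinh (y + z)` and `sinh (z - y + η)`, for `y` on an outer contour, lie outside. -/
lemma excludes_pole_left {p q : ℕ} (hpq : p < q) {y : ℂ} (hy : y ∈ (C p).trace) {z : ℂ}
    (hz : ¬ (|z.im| < Real.pi / 2 ∧ sinh (y + z) ≠ 0 ∧ sinh (z - y + η) ≠ 0)) :
    (C q).Excludes z := by
  by_cases h1 : |z.im| < Real.pi / 2 ∧ sinh (z + y) ≠ 0 ∧ sinh (y - z + η) ≠ 0
  swap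
  · exact hC.excludes_pole_right hpq hy h1
  obtain ⟨t, ht, rfl⟩ := hy
  have h2 : sinh (z - (C p).toFun t + η) = 0 := by
    by_contra h2
    exact hz ⟨h1.1, by rw [add_comm]; exact h1.2.1, h2⟩
  refine Contour.excludes_of_sinh_eq_zero (hC.shift_sub p q hpq.ne t ht) ?_
  rw [← h2]
  congr 1
  ring

end AdaptedContours

namespace Contour

lemma Encircles.mem_of_excludes {C : Contour} {w : ℂ} (hw : C.Encircles w) {Ω : Set ℂ}
    (hΩ : ∀ w ∉ Ω, C.Excludes w) : w ∈ Ω := by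
  by_contra h
  exact hw.not_excludes (hΩ w h)

lemma HolomorphicInside.mul {C : Contour} {φ ψ : ℂ → ℂ} (hφ : C.HolomorphicInside φ)
    (hψ : C.HolomorphicInside ψ) : C.HolomorphicInside fun z => φ z * ψ z := by
  obtain ⟨Ω₁, ho₁, hd₁, he₁⟩ := hφ
  obtain ⟨Ω₂, ho₂, hd₂, he₂⟩ := hψ
  refine ⟨Ω₁ ∩ Ω₂, ho₁.inter ho₂, (hd₁.mono inter_subset_left).mul (hd₂.mono inter_subset_right),
    fun w hw => ?_⟩
  by_cases h : w ∈ Ω₁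
  · exact he₂ w fun h' => hw ⟨h, h'⟩
  · exact he₁ w h

lemma HolomorphicInside.differentiableAt {C : Contour} {φ : ℂ → ℂ} (hφ : C.HolomorphicInside φ)
    {w : ℂ} (hw : C.Encircles w) : DifferentiableAt ℂ φ w := by
  obtain ⟨Ω, ho, hd, he⟩ := hφ
  exact hd.differentiableAt (ho.mem_nhds (hw.mem_of_excludes he))

lemma HolomorphicInside.pow {C : Contour} {φ : ℂ → ℂ} (hφ : C.HolomorphicInside φ) (j : ℕ) :
    C.HolomorphicInside fun z => φ z ^ j := by
  obtain ⟨Ω, ho, hd, he⟩ := hφ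
  exact ⟨Ω, ho, hd.pow j, he⟩

end Contour

lemma isOpen_strip : IsOpen {z : ℂ | |z.im| < Real.pi / 2} :=
  isOpen_lt (by fun_prop) continuous_const

namespace AdaptedContours

variable {N : ℕ} {h T : ℝ} {η : ℂ} {lam : Fin N → ℂ} {C : ℕ → Contour}
  (hC : AdaptedContours η lam C)
include hC

lemma holomorphicInside_pole_right {p q : ℕ} (hpq : p < q) {x : ℂ} (hx : x ∈ (C p).trace) :
    (C q).HolomorphicInside fun z => kernelPole η x z := by
  refine ⟨{z | |z.im| < Real.pi / 2} ∩ ({z | sinh (z + x) ≠ 0} ∩ {z | sinh (x - z + η) ≠ 0}),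
    isOpen_strip.inter ((isOpen_ne_fun (by fun_prop) continuous_const).inter
      (isOpen_ne_fun (by fun_prop) continuous_const)), fun z hz => ?_,
    fun w hw => hC.excludes_pole_right hpq hx hw⟩
  exact (differentiableAt_kernelPole_right hz.2.1 hz.2.2).differentiableWithinAt

lemma holomorphicInside_pole_left {p q : ℕ} (hpq : p < q) {y : ℂ} (hy : y ∈ (C p).trace) :
    (C q).HolomorphicInside fun z => kernelPole η z y := by
  refine ⟨{z | |z.im| < Real.pi / 2} ∩ ({z | sinh (y + z) ≠ 0} ∩ {z | sinh (z - y + η) ≠ 0}),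
    isOpen_strip.inter ((isOpen_ne_fun (by fun_prop) continuous_const).inter
      (isOpen_ne_fun (by fun_prop) continuous_const)), fun z hz => ?_,
    fun w hw => hC.excludes_pole_left hpq hy hw⟩
  exact (differentiableAt_kernelPole_left hz.2.1 hz.2.2).differentiableWithinAt

lemma holomorphicInside_fHat (q : ℕ) : (C q).HolomorphicInside (fHat h T η lam) := by
  refine ⟨(⋂ a, {z | sinh (lam a + z + η) ≠ 0}) ∩ ⋂ a, {z | sinh (lam a - z + η) ≠ 0},
    (isOpen_iInter_of_finite fun a => isOpen_ne_fun (by fun_prop) continuous_const).inter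
      (isOpen_iInter_of_finite fun a => isOpen_ne_fun (by fun_prop) continuous_const),
    fun z hz => ?_, fun w hw => ?_⟩
  · simp only [mem_inter_iff, mem_iInter] at hz
    exact (differentiableAt_fHat h T hz.1 hz.2).differentiableWithinAt
  · simp only [mem_inter_iff, mem_iInter, mem_ofPred_eq, not_and_or, not_forall, not_not] at hw
    rcases hw with ⟨a, ha⟩ | ⟨a, ha⟩
    · refine Contour.excludes_of_sinh_eq_zero (hC.neg_root_sub q a) ?_
      rw [← ha]
      congr 1
      ring
    · refine Contour.excludes_of_sinh_eq_zero (hC.root_add q a) ?_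
      rw [← neg_eq_zero, ← sinh_neg, ← ha]
      congr 1
      ring

/-- The integral of the kernel weight against a function `H` with finitely many further poles
inside the contour. -/
lemma integral_mul_kernelWeight (hdist : ∀ j k, j ≠ k → sinh (lam j - lam k) ≠ 0) (q : ℕ)
    {ι : Type*} [Fintype ι] {b r : ι → ℂ} (hbinj : Function.Injective b)
    (hb : ∀ i, (C q).Encircles (b i)) (hbl : ∀ i a, b i ≠ lam a) {H : ℂ → ℂ} {Ω : Set ℂ}
    (hΩ : IsOpen Ω) (hH : DifferentiableOn ℂ H (Ω \ range b)) (hex : ∀ w ∉ Ω, (C q).Excludes w)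
    (hr : ∀ i, Tendsto (fun z => (z - b i) * (H z * kernelWeight h T η lam z)) (𝓝[≠] b i)
      (𝓝 (r i))) :
    (2 * Real.pi * I)⁻¹ * (C q).integral (fun z => H z * kernelWeight h T η lam z) =
      (∑ k, H (lam k) * weightAtRoot h T η lam k (lam k)) + ∑ i, r i := by
  have hlinj : Function.Injective lam := fun j k hjk => by
    by_contra hne
    exact hdist j k hne (by rw [hjk, sub_self, sinh_zero])
  set Ω' : Set ℂ := Ω ∩ ({z | |z.im| < Real.pi / 2} ∩ ⋂ a, {z | sinh (lam a + z + η) ≠ 0}) with hΩ'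
  have hex' : ∀ w ∉ Ω', (C q).Excludes w := by
    intro w hw
    by_cases h1 : w ∈ Ω
    swap
    · exact hex w h1
    by_cases h2 : |w.im| < Real.pi / 2
    swap
    · exact (C q).excludes_of_strip (hC.strip q) (not_lt.1 h2)
    obtain ⟨a, ha⟩ : ∃ a, sinh (lam a + w + η) = 0 := by
      by_contra! h3
      exact hw ⟨h1, h2, mem_iInter.2 h3⟩
    refine Contour.excludes_of_sinh_eq_zero (hC.neg_root_sub q a) ?_
    rw [← ha]
    congr 1
    ring
  have hopen : IsOpen (Ω \ range b) := hΩ.sdiff (finite_range b).isClosed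
  have key := (C q).integral_eq_sum_residues (f := fun z => H z * kernelWeight h T η lam z)
    (Finset.univ : Finset (Fin N ⊕ ι)) (Sum.elim lam b)
    (Sum.elim (fun k => H (lam k) * weightAtRoot h T η lam k (lam k)) r)
    (Function.Injective.injOn (Function.Injective.sumElim hlinj hbinj fun a i => (hbl i a).symm))
    (Ω := Ω')
    (hΩ.inter (isOpen_strip.inter (isOpen_iInter_of_finite fun a =>
      isOpen_ne_fun (by fun_prop) continuous_const)))
    (by
      rintro (a | i) -
      · exact (hC.root q a).mem_of_excludes hex'
      · exact (hb i).mem_of_excludes hex')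
    (by
      rintro (a | i) -
      · exact hC.root q a
      · exact hb i)
    hex'
    (by
      rintro z ⟨⟨hz1, hz2, hz3⟩, hz4⟩
      rw [mem_iInter] at hz3
      have hzb : z ∉ range b := by
        rintro ⟨i, rfl⟩
        exact hz4 ⟨Sum.inr i, by simp, rfl⟩
      refine DifferentiableAt.differentiableWithinAt (DifferentiableAt.mul
        (hH.differentiableAt (hopen.mem_nhds ⟨hz1, hzb⟩))
        (differentiableAt_kernelWeight h T (fun a ha => hz4 ⟨Sum.inl a, by simp, ?_⟩) hz3))
      exact (eq_of_sinh_sub_eq_zero hz2 (hC.abs_im_lt_of_encircles (hC.root q a)) ha).symm)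
    (by
      rintro (k | i) -
      · have hmem : lam k ∈ Ω \ range b := ⟨(hC.root q k).mem_of_excludes hex, by
          rintro ⟨i, hi⟩
          exact hbl i k hi⟩
        have h1 : ContinuousAt (fun z => H z * weightAtRoot h T η lam k z) (lam k) :=
          ((hH.differentiableAt (hopen.mem_nhds hmem)).mul
            (differentiableAt_weightAtRoot h T (fun a ha => hdist k a ha.symm)
              (hC.sinh_add_add_ne_zero (hC.root q k)))).continuousAt
        refine (tendsto_mul_inv_sinh h1).congr fun z => ?_
        rw [Sum.elim_inl, kernelWeight_eq_atRoot h T η lam k]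
        ring
      · exact hr i)
  rw [key, Fintype.sum_sum_type, ← mul_assoc, inv_mul_cancel₀ (by simp [Real.pi_ne_zero]), one_mul]
  rfl

/-- The innermost of at least two integrations. -/
lemma integral_UHat_mul_UHat (hdist : ∀ j k, j ≠ k → sinh (lam j - lam k) ≠ 0) {p p' q : ℕ}
    (hp : p < q) (hp' : p' < q) {x y : ℂ} (hx : x ∈ (C p).trace) (hy : y ∈ (C p').trace)
    {φ : ℂ → ℂ} (hφ : (C q).HolomorphicInside φ) :
    (2 * Real.pi * I)⁻¹ * (C q).integral
        (fun z => φ z * (UHat h T η lam x z * UHat h T η lam z y)) =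
      ∑ k, φ (lam k) * (kernelRes h T η lam x k * UHat h T η lam (lam k) y) := by
  obtain ⟨Ω, ho, hd, he⟩ := hφ.mul
    ((hC.holomorphicInside_pole_right hp hx).mul (hC.holomorphicInside_pole_left hp' hy))
  have key := hC.integral_mul_kernelWeight (h := h) (T := T) hdist q (ι := Empty)
    (b := Empty.elim) (r := Empty.elim) (fun i => i.elim) (fun i => i.elim) (fun i => i.elim)
    (H := fun z => kernelWeight h T η lam y * (φ z * (kernelPole η x z * kernelPole η z y)))
    ho ((hd.const_mul _).mono sdiff_subset) he (fun i => i.elim)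
  rw [Finset.univ_eq_empty (α := Empty), Finset.sum_empty, add_zero] at key
  rw [← funext fun z => (by rw [UHat_eq, UHat_eq]; ring :
    φ z * (UHat h T η lam x z * UHat h T η lam z y) = kernelWeight h T η lam y *
      (φ z * (kernelPole η x z * kernelPole η z y)) * kernelWeight h T η lam z)] at key
  rw [key]
  refine Finset.sum_congr rfl fun k _ => ?_
  rw [kernelRes, UHat_eq]
  ring

omit hC in
lemma neg_root_ne_root (hsum : ∀ j k, sinh (lam j + lam k) ≠ 0) (i a : Fin N) :
    -lam i ≠ lam a := fun h0 => hsum a i (by rw [← h0, neg_add_cancel, sinh_zero])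

omit hC in
lemma neg_root_injective (hdist : ∀ j k, j ≠ k → sinh (lam j - lam k) ≠ 0) :
    Function.Injective fun a => -lam a := fun j k hjk => by
  by_contra hne
  exact hdist j k hne (by rw [neg_injective hjk, sub_self, sinh_zero])

/-- An integration in the middle of the chain: the pole at `-lam k` meets a zero of the weight. -/
lemma integral_UHat_mul_kernelRes (hdist : ∀ j k, j ≠ k → sinh (lam j - lam k) ≠ 0)
    (hsum : ∀ j k, sinh (lam j + lam k) ≠ 0) {p q : ℕ}
    (hp : p < q) {x : ℂ} (hx : x ∈ (C p).trace) (k : Fin N) :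
    (2 * Real.pi * I)⁻¹ * (C q).integral
        (fun z => UHat h T η lam x z * kernelRes h T η lam z k) =
      ∑ l, kernelRes h T η lam x l * matU h T η lam l k := by
  have hxh := hC.holomorphicInside_pole_right hp hx
  obtain ⟨Ω, ho, hd, he⟩ := hxh
  set ρ := weightAtRoot h T η lam k (lam k) with hρ
  have key := hC.integral_mul_kernelWeight (h := h) (T := T) hdist q (ι := Unit)
    (b := fun _ => -lam k) (r := fun _ => 0) (Function.injective_of_subsingleton _)
    (fun _ => hC.neg_root q k) (fun _ a => neg_root_ne_root hsum k a)
    (H := fun z => ρ * (kernelPole η x z * kernelPole η z (lam k)))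
    (Ω := Ω ∩ ({z | |z.im| < Real.pi / 2} ∩ {z | sinh (z - lam k + η) ≠ 0}))
    (ho.inter (isOpen_strip.inter (isOpen_ne_fun (by fun_prop) continuous_const)))
    (by
      rintro z ⟨⟨hz1, hz2, hz3⟩, hz4⟩
      refine (((hd.differentiableAt (ho.mem_nhds hz1)).mul
        (differentiableAt_kernelPole_left (fun h0 => hz4 ⟨(), ?_⟩) hz3)).const_mul
          _).differentiableWithinAt
      refine (eq_of_sinh_sub_eq_zero hz2 ?_ ?_).symm
      · exact hC.abs_im_lt_of_encircles (hC.neg_root q k)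
      · rw [← h0]
        congr 1
        ring)
    (by
      intro w hw
      by_cases h1 : w ∈ Ω
      swap
      · exact he w h1
      by_cases h2 : |w.im| < Real.pi / 2
      swap
      · exact (C q).excludes_of_strip (hC.strip q) (not_lt.1 h2)
      have h3 : sinh (w - lam k + η) = 0 := by
        by_contra h3
        exact hw ⟨h1, h2, h3⟩
      refine Contour.excludes_of_sinh_eq_zero (hC.root_sub q k) ?_
      rw [← h3]
      congr 1
      ring)
    (by
      intro _
      have hW : DifferentiableAt ℂ (kernelWeight h T η lam) (-lam k) :=
        differentiableAt_kernelWeight h T (fun a => by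
          rw [← neg_ne_zero, ← sinh_neg]
          convert hsum a k using 2
          ring) (hC.sinh_add_add_ne_zero (hC.neg_root q k))
      have hP : DifferentiableAt ℂ (fun z => kernelPole η x z) (-lam k) :=
        hd.differentiableAt (ho.mem_nhds ((hC.neg_root q k).mem_of_excludes he))
      have hS : DifferentiableAt ℂ (fun z => (sinh (z - lam k + η))⁻¹) (-lam k) :=
        DifferentiableAt.inv (by fun_prop) (hC.sinh_sub_add_ne_zero (hC.neg_root q k) k)
      have hlim := tendsto_mul_inv_sinh ((hW.mul (hP.mul hS)).const_mul ρ).continuousAt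
      have h0 : kernelWeight h T η lam (-lam k) = 0 := by
        rw [kernelWeight_eq_atNeg h T η lam k, neg_add_cancel, sinh_zero, zero_mul]
      simp only [Pi.mul_apply, h0, zero_mul, mul_zero] at hlim
      refine hlim.congr fun z => ?_
      simp only [kernelPole, mul_inv]
      rw [show lam k + z = z - -lam k by ring]
      ring)
  rw [Finset.sum_const_zero, add_zero] at key
  rw [← funext fun z => (by rw [UHat_eq, kernelRes]; ring :
    UHat h T η lam x z * kernelRes h T η lam z k =
      ρ * (kernelPole η x z * kernelPole η z (lam k)) * kernelWeight h T η lam z)] at key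
  rw [key]
  refine Finset.sum_congr rfl fun l _ => ?_
  rw [matU_eq, kernelRes, kernelRes]
  ring

omit hC in
lemma eventually_sinh_sub_ne_zero (p : ℂ) : ∀ᶠ z in 𝓝[≠] p, sinh (z - p) ≠ 0 := by
  have h1 : HasDerivAt (fun z => sinh (z - p)) 1 p := by
    have := ((hasDerivAt_id p).sub_const p).csinh
    simpa using this
  exact h1.eventually_ne one_ne_zero

omit hC in
lemma tendsto_mul_sinh_div (hdist : ∀ j k, j ≠ k → sinh (lam j - lam k) ≠ 0) (a k l : Fin N) :
    Tendsto (fun z => (z - -lam a) * (sinh (z - -lam a) *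
      ((sinh (z - -lam k))⁻¹ * (sinh (z - -lam l))⁻¹))) (𝓝[≠] (-lam a))
      (𝓝 (if a = k ∧ k = l then 1 else 0)) := by
  have hcont : ∀ m, a ≠ m → ContinuousAt (fun z => (sinh (z - -lam m))⁻¹) (-lam a) := by
    intro m hm
    refine ContinuousAt.inv₀ (by fun_prop) ?_
    rw [neg_sub_neg]
    exact hdist m a hm.symm
  have hzero : ∀ g : ℂ → ℂ, ContinuousAt g (-lam a) →
      Tendsto (fun z => (z - -lam a) * g z) (𝓝[≠] (-lam a)) (𝓝 0) := by
    intro g hg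
    have h1 : ContinuousAt (fun z => (z - -lam a) * g z) (-lam a) := by fun_prop
    have h2 := h1.tendsto
    simp only [sub_self, zero_mul] at h2
    exact h2.mono_left nhdsWithin_le_nhds
  by_cases hk : a = k
  · subst hk
    by_cases hl : a = l
    · subst hl
      rw [if_pos ⟨rfl, rfl⟩]
      refine (tendsto_mul_inv_sinh (p := -lam a) (g := fun _ => 1) continuousAt_const).congr' ?_
      filter_upwards [eventually_sinh_sub_ne_zero (-lam a)] with z hz
      field_simp
    · rw [if_neg fun h0 => hl h0.2]
      refine (hzero _ (hcont l hl)).congr' ?_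
      filter_upwards [eventually_sinh_sub_ne_zero (-lam a)] with z hz
      rw [mul_inv_cancel_left₀ hz]
  · rw [if_neg fun h0 => hk h0.1]
    by_cases hl : a = l
    · subst hl
      refine (hzero _ (hcont k hk)).congr' ?_
      filter_upwards [eventually_sinh_sub_ne_zero (-lam a)] with z hz
      rw [mul_comm (sinh (z - -lam k))⁻¹, mul_inv_cancel_left₀ hz]
    · exact hzero _ (ContinuousAt.mul (by fun_prop) ((hcont k hk).mul (hcont l hl)))

/-- The outermost integration, which closes the cycle: the pole at `-lam k` contributes if the
chain starts and ends at `lam k`. -/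
lemma integral_kernelRes_mul_UHat (hdist : ∀ j k, j ≠ k → sinh (lam j - lam k) ≠ 0)
    (hsum : ∀ j k, sinh (lam j + lam k) ≠ 0) (q : ℕ) (k l : Fin N) :
    (2 * Real.pi * I)⁻¹ * (C q).integral
        (fun z => kernelRes h T η lam z k * UHat h T η lam (lam l) z) =
      (matU h T η lam * matU h T η lam) l k + if k = l then -fHat h T η lam (lam k) else 0 := by
  set ρ := weightAtRoot h T η lam k (lam k) with hρ
  have key := hC.integral_mul_kernelWeight (h := h) (T := T) hdist q
    (b := fun a => -lam a)
    (r := fun a => if a = k then (if k = l then -fHat h T η lam (lam k) else 0) else 0)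
    (neg_root_injective hdist) (fun a => hC.neg_root q a) (fun i a => neg_root_ne_root hsum i a)
    (H := fun z => ρ * (kernelPole η (lam l) z * kernelPole η z (lam k)))
    (Ω := {z | |z.im| < Real.pi / 2} ∩
      ({z | sinh (lam l - z + η) ≠ 0} ∩ {z | sinh (z - lam k + η) ≠ 0}))
    (isOpen_strip.inter ((isOpen_ne_fun (by fun_prop) continuous_const).inter
      (isOpen_ne_fun (by fun_prop) continuous_const)))
    (by
      rintro z ⟨⟨hz1, hz2, hz3⟩, hz4⟩
      have hne : ∀ a, sinh (z + lam a) ≠ 0 := fun a h0 => by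
        refine hz4 ⟨a, (eq_of_sinh_sub_eq_zero hz1 ?_ ?_).symm⟩
        · exact hC.abs_im_lt_of_encircles (hC.neg_root q a)
        · rwa [sub_neg_eq_add]
      refine (((differentiableAt_kernelPole_right (hne l) hz2).mul
        (differentiableAt_kernelPole_left ?_ hz3)).const_mul _).differentiableWithinAt
      rw [add_comm]
      exact hne k)
    (by
      intro w hw
      by_cases h2 : |w.im| < Real.pi / 2
      swap
      · exact (C q).excludes_of_strip (hC.strip q) (not_lt.1 h2)
      by_cases h3 : sinh (w - lam k + η) = 0
      · refine Contour.excludes_of_sinh_eq_zero (hC.root_sub q k) ?_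
        rw [← h3]
        congr 1
        ring
      · have h4 : sinh (lam l - w + η) = 0 := by
          by_contra h4
          exact hw ⟨h2, h4, h3⟩
        refine Contour.excludes_of_sinh_eq_zero (hC.root_add q l) ?_
        rw [← neg_eq_zero, ← sinh_neg, ← h4]
        congr 1
        ring)
    (by
      intro a
      have hV : DifferentiableAt ℂ (weightAtNeg h T η lam a) (-lam a) :=
        differentiableAt_weightAtNeg h T (fun b => by
          rw [← neg_ne_zero, ← sinh_neg]
          convert hsum b a using 2
          ring) (hC.sinh_add_add_ne_zero (hC.neg_root q a))
      have hS : DifferentiableAt ℂ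
          (fun z => (sinh (z - lam k + η) * sinh (lam l - z + η))⁻¹) (-lam a) :=
        DifferentiableAt.inv (by fun_prop) (mul_ne_zero
          (hC.sinh_sub_add_ne_zero (hC.neg_root q a) k)
          (hC.sinh_root_sub_add_ne_zero (hC.neg_root q a) l))
      have hlim := (tendsto_mul_sinh_div hdist a k l).mul
        (((hV.mul_const ρ).mul hS).continuousAt.tendsto.mono_left nhdsWithin_le_nhds)
      have hval : (if a = k ∧ k = l then (1 : ℂ) else 0) *
          (weightAtNeg h T η lam a (-lam a) * ρ *
            (sinh (-lam a - lam k + η) * sinh (lam l - -lam a + η))⁻¹) =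
          if a = k then (if k = l then -fHat h T η lam (lam k) else 0) else 0 := by
        by_cases hk : a = k
        · subst hk
          by_cases hl : a = l
          · subst hl
            rw [if_pos ⟨rfl, rfl⟩, if_pos rfl, if_pos rfl, one_mul, sub_neg_eq_add]
            refine weightAtNeg_mul_weightAtRoot h T a
              (hC.sinh_sub_add_ne_zero (hC.neg_root q a) a)
              (hC.sinh_add_add_ne_zero (hC.root q a) a)
              (fun b hb => hdist a b hb.symm) fun b => hsum b a
          · rw [if_neg fun h0 => hl h0.2, if_pos rfl, if_neg hl, zero_mul]
        · rw [if_neg fun h0 => hk h0.1, if_neg hk, zero_mul]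
      rw [← hval]
      refine hlim.congr fun z => ?_
      simp only [kernelWeight_eq_atNeg h T η lam a, kernelPole, mul_inv, Pi.mul_apply]
      rw [show lam k + z = z - -lam k by ring, show z + lam l = z - -lam l by ring,
        show z + lam a = z - -lam a by ring]
      ring)
  rw [Finset.sum_ite_eq', if_pos (Finset.mem_univ k)] at key
  rw [← funext fun z => (by rw [UHat_eq, kernelRes]; ring :
    kernelRes h T η lam z k * UHat h T η lam (lam l) z =
      ρ * (kernelPole η (lam l) z * kernelPole η z (lam k)) * kernelWeight h T η lam z)] at key
  rw [key, Matrix.mul_apply]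
  congr 1
  refine Finset.sum_congr rfl fun j _ => ?_
  rw [matU_eq, matU_eq, kernelRes, kernelRes]
  ring

/-- The integral over a cycle of length one, with its pole at the origin. -/
lemma integral_UHat_diag (hN : 0 < N) (hdist : ∀ j k, j ≠ k → sinh (lam j - lam k) ≠ 0)
    (hsum : ∀ j k, sinh (lam j + lam k) ≠ 0) {β : ℂ} (hβ : sinh (β / N) ≠ 0)
    (hβη : sinh (β / N - η) ≠ 0) (q : ℕ) {φ : ℂ → ℂ} (hφ : (C q).HolomorphicInside φ) :
    (2 * Real.pi * I)⁻¹ * (C q).integral (fun z => φ z * UHat h T η lam z z) =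
      (∑ k, φ (lam k) * matU h T η lam k k) - φ 0 * (aHat h T η β lam 0 / 2) := by
  have hη := hC.sinh_eta_ne_zero hN
  have hφ0 := hφ.differentiableAt (hC.origin q)
  obtain ⟨Ω, ho, hd, he⟩ := hφ
  have hl0 : ∀ a, sinh (lam a) ≠ 0 := fun a h0 => by
    refine hsum a a ?_
    rw [← two_mul, sinh_two_mul, h0, mul_zero, zero_mul]
  have key := hC.integral_mul_kernelWeight (h := h) (T := T) hdist q (ι := Unit)
    (b := fun _ => 0) (r := fun _ => -(φ 0 * (aHat h T η β lam 0 / 2)))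
    (Function.injective_of_subsingleton _)
    (fun _ => hC.origin q) (fun _ a h0 => hl0 a (by rw [← h0, sinh_zero]))
    (H := fun z => φ z * kernelPole η z z) (Ω := Ω ∩ {z | |z.im| < Real.pi / 2})
    (ho.inter isOpen_strip)
    (by
      rintro z ⟨⟨hz1, hz2⟩, hz4⟩
      have h1 : sinh (z + z) * sinh (z - z + η) ≠ 0 := by
        refine mul_ne_zero (fun h0 => hz4 ⟨(), ?_⟩) (by rwa [sub_self, zero_add])
        obtain ⟨m, hm⟩ := sinh_eq_zero_iff.1 h0
        have hm' : z - -z = m * (Real.pi * I) := by rw [← hm]; ring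
        have := eq_of_sinh_sub_eq_zero (z := z) (w := -z) hz2 (by rwa [neg_im, abs_neg])
          (by rw [sub_neg_eq_add, h0])
        rw [eq_comm]
        exact self_eq_neg.1 this
      refine DifferentiableAt.differentiableWithinAt
        ((hd.differentiableAt (ho.mem_nhds hz1)).mul ?_)
      unfold kernelPole
      exact DifferentiableAt.inv (by fun_prop) h1)
    (by
      intro w hw
      by_cases h1 : w ∈ Ω
      · exact (C q).excludes_of_strip (hC.strip q) (not_lt.1 fun h2 => hw ⟨h1, h2⟩)
      · exact he w h1)
    (by
      intro _
      have hW : DifferentiableAt ℂ (kernelWeight h T η lam) 0 :=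
        differentiableAt_kernelWeight h T (fun a => by
          rw [zero_sub, sinh_neg]
          exact neg_ne_zero.2 (hl0 a)) (hC.sinh_add_add_ne_zero (hC.origin q))
      have hS : DifferentiableAt ℂ (fun z => (2 * cosh z * sinh η)⁻¹) 0 :=
        DifferentiableAt.inv (by fun_prop) (by simp [hη])
      have hlim := tendsto_mul_inv_sinh ((hφ0.mul hS).mul hW).continuousAt
      have hval : φ 0 * (2 * cosh 0 * sinh η)⁻¹ * kernelWeight h T η lam 0 =
          -(φ 0 * (aHat h T η β lam 0 / 2)) := by
        have e1 : ∏ a, (sinh (lam a + 0) * sinh (0 - lam a + η)) /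
            (sinh (0 - lam a) * sinh (lam a + 0 + η)) =
            ∏ a, sinh (lam a - η) / sinh (lam a + η) := by
          refine Finset.prod_congr rfl fun a _ => ?_
          have s1 : sinh (0 - lam a + η) = -sinh (lam a - η) := by
            rw [← sinh_neg]; congr 1; ring
          have s2 : sinh (0 - lam a) = -sinh (lam a) := by rw [zero_sub, sinh_neg]
          rw [s1, s2, add_zero, mul_neg, neg_mul, neg_div_neg_eq, mul_div_mul_left _ _ (hl0 a)]
        rw [← exp_mul_prod_eq_aHat_zero h T hβ hβη, kernelWeight, e1, cosh_zero, mul_zero, zero_add]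
        field_simp
      simp only [Pi.mul_apply] at hlim
      rw [hval] at hlim
      refine hlim.congr fun z => ?_
      simp only [kernelPole, sub_zero, sub_self, zero_add, ← two_mul, sinh_two_mul, mul_inv]
      ring)
  rw [Finset.univ_unique (α := Unit), Finset.sum_singleton] at key
  rw [← funext fun z => (by rw [UHat_eq]; ring :
    φ z * UHat h T η lam z z = φ z * kernelPole η z z * kernelWeight h T η lam z)] at key
  rw [key, sub_eq_add_neg]
  congr 1
  refine Finset.sum_congr rfl fun j _ => ?_
  rw [matU_eq, kernelRes]
  ring

end AdaptedContours

/-! ### Iterated integrals over the cycle -/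

lemma multiIntegral_const_mul (c : ℂ) (n : ℕ) (C : ℕ → Contour) (G : (Fin n → ℂ) → ℂ) :
    multiIntegral n C (fun w => c * G w) = c * multiIntegral n C G := by
  induction n generalizing C with
  | zero => rfl
  | succ n ih =>
    simp only [multiIntegral, ih]
    exact Contour.integral_const_mul _ _ _

lemma Contour.integral_sum_sum_const_mul (C : Contour) {ι κ : Type*} [Fintype ι] [Fintype κ]
    (c : ι → κ → ℂ) (f : ι → κ → ℂ → ℂ) (hf : ∀ i j, ContinuousOn (f i j) C.trace) :
    C.integral (fun z => ∑ i, ∑ j, c i j * f i j z) = ∑ i, ∑ j, c i j * C.integral (f i j) := by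
  have h1 : ∀ i j, ContinuousOn (fun z => c i j * f i j z) C.trace := fun i j =>
    continuousOn_const.mul (hf i j)
  rw [C.integral_finset_sum (f := fun i z => ∑ j, c i j * f i j z) _ fun i _ =>
    continuousOn_finsetSum _ fun j _ => h1 i j]
  refine Finset.sum_congr rfl fun i _ => ?_
  rw [C.integral_finset_sum (f := fun j z => c i j * f i j z) _ fun j _ => h1 i j]
  exact Finset.sum_congr rfl fun j _ => C.integral_const_mul _ _

namespace AdaptedContours

variable {N : ℕ} {h T : ℝ} {η : ℂ} {lam : Fin N → ℂ} {C : ℕ → Contour}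
  (hC : AdaptedContours η lam C)

omit hC in
lemma _root_.OpenXXZ.Contour.HolomorphicInside.continuousOn {C : Contour} {φ : ℂ → ℂ}
    (hφ : C.HolomorphicInside φ) : ContinuousOn φ C.trace := by
  obtain ⟨Ω, ho, hd, he⟩ := hφ
  exact hd.continuousOn.mono (C.trace_subset he)

include hC

lemma abs_im_lt_of_mem_trace {q : ℕ} {z : ℂ} (hz : z ∈ (C q).trace) : |z.im| < Real.pi / 2 := by
  obtain ⟨t, ht, rfl⟩ := hz
  exact hC.strip q t ht

omit hC in
lemma sinh_sub_ne_zero_of_mem_trace {C : Contour} {z w : ℂ} (hz : z ∈ C.trace)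
    (hw : ∀ m : ℤ, C.Excludes (w + m * (Real.pi * I))) : sinh (z - w) ≠ 0 :=
  fun h0 => (Contour.excludes_of_sinh_eq_zero hw h0).notMem hz

lemma sinh_sub_ne_zero_of_encircles {q : ℕ} {z w : ℂ} (hz : z ∈ (C q).trace)
    (hw : (C q).Encircles w) : sinh (z - w) ≠ 0 := fun h0 => by
  rw [eq_of_sinh_sub_eq_zero (hC.abs_im_lt_of_mem_trace hz) (hC.abs_im_lt_of_encircles hw) h0] at hz
  exact hw.notMem hz

lemma continuousOn_kernelWeight (q : ℕ) :
    ContinuousOn (kernelWeight h T η lam) (C q).trace := fun z hz => by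
  refine (differentiableAt_kernelWeight h T
    (fun a => hC.sinh_sub_ne_zero_of_encircles hz (hC.root q a)) fun a => ?_).continuousAt.continuousWithinAt
  have := sinh_sub_ne_zero_of_mem_trace hz (hC.neg_root_sub q a)
  rwa [show z - (-lam a - η) = lam a + z + η by ring] at this

lemma continuousOn_UHat_right {p q : ℕ} (hpq : p < q) {x : ℂ} (hx : x ∈ (C p).trace) :
    ContinuousOn (fun z => UHat h T η lam x z) (C q).trace := by
  simp only [UHat_eq]
  exact (hC.holomorphicInside_pole_right hpq hx).continuousOn.mul (hC.continuousOn_kernelWeight q)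

lemma continuousOn_kernelRes (q : ℕ) (k : Fin N) :
    ContinuousOn (fun z => kernelRes h T η lam z k) (C q).trace := fun z hz => by
  refine ContinuousAt.continuousWithinAt (DifferentiableAt.continuousAt (𝕜 := ℂ)
    (DifferentiableAt.mul_const (differentiableAt_kernelPole_left ?_ ?_) _))
  · have := hC.sinh_sub_ne_zero_of_encircles hz (hC.neg_root q k)
    rwa [sub_neg_eq_add, add_comm] at this
  · have := sinh_sub_ne_zero_of_mem_trace hz (hC.root_sub q k)
    rwa [show z - (lam k - η) = z - lam k + η by ring] at this

lemma continuousOn_UHat_root (q : ℕ) (l : Fin N) :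
    ContinuousOn (fun z => UHat h T η lam (lam l) z) (C q).trace := by
  simp only [UHat_eq]
  refine ContinuousOn.mul (fun z hz => ?_) (hC.continuousOn_kernelWeight q)
  refine ContinuousAt.continuousWithinAt (DifferentiableAt.continuousAt (𝕜 := ℂ)
    (differentiableAt_kernelPole_right ?_ ?_))
  · have := hC.sinh_sub_ne_zero_of_encircles hz (hC.neg_root q l)
    rwa [sub_neg_eq_add] at this
  · have := sinh_sub_ne_zero_of_mem_trace hz (hC.root_add q l)
    rwa [show z - (lam l + η) = -(lam l - z + η) by ring, sinh_neg, neg_ne_zero] at this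

/-- All integrations but the outermost, performed from the inside: an open chain of kernels
becomes a power of `U`. -/
lemma multiIntegral_chain (hdist : ∀ j k, j ≠ k → sinh (lam j - lam k) ≠ 0)
    (hsum : ∀ j k, sinh (lam j + lam k) ≠ 0) (n : ℕ) {p p' s : ℕ} (hp : p < s) (hp' : p' < s)
    {x y : ℂ} (hx : x ∈ (C p).trace) (hy : y ∈ (C p').trace) {φ : ℂ → ℂ}
    (hφ : (C (n + s)).HolomorphicInside φ) :
    ((2 * Real.pi * I) ^ (n + 1))⁻¹ * multiIntegral (n + 1) (fun i => C (i + s)) (fun w =>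
      φ (w (Fin.last n)) * ((∏ i : Fin (n + 1),
        UHat h T η lam ((Fin.cons x w : Fin (n + 2) → ℂ) i.castSucc) (w i)) *
          UHat h T η lam (w (Fin.last n)) y)) =
      ∑ k, ∑ l, φ (lam k) * (kernelRes h T η lam x l * (matU h T η lam ^ n) l k *
        UHat h T η lam (lam k) y) := by
  induction n generalizing p s x with
  | zero =>
    have key := hC.integral_UHat_mul_UHat (h := h) (T := T) hdist hp hp' hx hy (φ := φ)
      (by simpa using hφ)
    simp only [zero_add, multiIntegral, pow_one]
    have h0 : ∀ z : ℂ, φ ((Fin.cons z Fin.elim0 : Fin 1 → ℂ) (Fin.last 0)) * ((∏ i : Fin 1,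
        UHat h T η lam ((Fin.cons x (Fin.cons z Fin.elim0 : Fin 1 → ℂ) : Fin 2 → ℂ) i.castSucc)
          ((Fin.cons z Fin.elim0 : Fin 1 → ℂ) i)) *
            UHat h T η lam ((Fin.cons z Fin.elim0 : Fin 1 → ℂ) (Fin.last 0)) y) =
        φ z * (UHat h T η lam x z * UHat h T η lam z y) := by
      intro z
      simp
    simp only [h0]
    rw [key]
    refine Finset.sum_congr rfl fun k _ => ?_
    rw [← Finset.mul_sum]
    simp [Matrix.one_apply]
  | succ n ih =>
    have hpi : (2 * Real.pi * I : ℂ) ≠ 0 := by simp [Real.pi_ne_zero]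
    have hstep : ∀ t ∈ Icc (0 : ℝ) 1,
        multiIntegral (n + 1) (fun i => C (i + 1 + s)) (fun w =>
          φ ((Fin.cons ((C s).toFun t) w : Fin (n + 2) → ℂ) (Fin.last (n + 1))) *
            ((∏ i : Fin (n + 2), UHat h T η lam
              ((Fin.cons x (Fin.cons ((C s).toFun t) w : Fin (n + 2) → ℂ) :
                Fin (n + 3) → ℂ) i.castSucc)
              ((Fin.cons ((C s).toFun t) w : Fin (n + 2) → ℂ) i)) *
            UHat h T η lam
              ((Fin.cons ((C s).toFun t) w : Fin (n + 2) → ℂ) (Fin.last (n + 1))) y)) =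
        ∑ k, ∑ m, (2 * Real.pi * I) ^ (n + 1) * φ (lam k) * (matU h T η lam ^ n) m k *
          UHat h T η lam (lam k) y *
          (UHat h T η lam x ((C s).toFun t) * kernelRes h T η lam ((C s).toFun t) m) := by
      intro t ht
      have hz := (C s).mem_trace ht
      generalize (C s).toFun t = z at hz ⊢
      have h1 := ih (p := s) (s := s + 1) (x := z) (Nat.lt_succ_self s) (by omega) hz
        (by rwa [show n + (s + 1) = n + 1 + s by ring])
      rw [inv_mul_eq_iff_eq_mul₀ (pow_ne_zero _ hpi)] at h1
      have h2 : (fun i => C (i + 1 + s)) = fun i => C (i + (s + 1)) := by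
        funext i
        congr 1
        ring
      rw [h2]
      have h3 : ∀ w : Fin (n + 1) → ℂ,
          φ ((Fin.cons z w : Fin (n + 2) → ℂ) (Fin.last (n + 1))) *
            ((∏ i : Fin (n + 2), UHat h T η lam
              ((Fin.cons x (Fin.cons z w : Fin (n + 2) → ℂ) : Fin (n + 3) → ℂ) i.castSucc)
              ((Fin.cons z w : Fin (n + 2) → ℂ) i)) *
            UHat h T η lam ((Fin.cons z w : Fin (n + 2) → ℂ) (Fin.last (n + 1))) y) =
          UHat h T η lam x z * (φ (w (Fin.last n)) * ((∏ i : Fin (n + 1),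
            UHat h T η lam ((Fin.cons z w : Fin (n + 2) → ℂ) i.castSucc) (w i)) *
              UHat h T η lam (w (Fin.last n)) y)) := by
        intro w
        rw [Fin.prod_univ_succ, ← Fin.succ_last]
        simp only [Fin.cons_succ, Fin.castSucc_zero, Fin.cons_zero, ← Fin.succ_castSucc]
        ring
      simp only [h3]
      rw [multiIntegral_const_mul, h1, Finset.mul_sum, Finset.mul_sum]
      refine Finset.sum_congr rfl fun k _ => ?_
      rw [Finset.mul_sum, Finset.mul_sum]
      refine Finset.sum_congr rfl fun m _ => ?_
      ring
    have hcont : ∀ m, ContinuousOn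
        (fun z => UHat h T η lam x z * kernelRes h T η lam z m) (C s).trace := fun m =>
      (hC.continuousOn_UHat_right hp hx).mul (hC.continuousOn_kernelRes s m)
    rw [multiIntegral]
    simp only [zero_add]
    rw [(C s).integral_congr (g := fun z => ∑ k, ∑ m, (2 * Real.pi * I) ^ (n + 1) * φ (lam k) *
        (matU h T η lam ^ n) m k * UHat h T η lam (lam k) y *
          (UHat h T η lam x z * kernelRes h T η lam z m)) hstep,
      (C s).integral_sum_sum_const_mul (fun k m => (2 * Real.pi * I) ^ (n + 1) * φ (lam k) *
        (matU h T η lam ^ n) m k * UHat h T η lam (lam k) y)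
        (fun _ m z => UHat h T η lam x z * kernelRes h T η lam z m) fun _ m => hcont m,
      Finset.mul_sum]
    refine Finset.sum_congr rfl fun k _ => ?_
    rw [Finset.mul_sum]
    have hB : ∀ m, (C s).integral (fun z => UHat h T η lam x z * kernelRes h T η lam z m) =
        2 * Real.pi * I * ∑ l, kernelRes h T η lam x l * matU h T η lam l m := fun m => by
      rw [← inv_mul_eq_iff_eq_mul₀ hpi]
      exact hC.integral_UHat_mul_kernelRes hdist hsum hp hx m
    simp only [hB]
    simp only [pow_succ' (matU h T η lam) n, Matrix.mul_apply, Finset.mul_sum, Finset.sum_mul]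
    rw [Finset.sum_comm]
    refine Finset.sum_congr rfl fun l _ => Finset.sum_congr rfl fun m _ => ?_
    rw [show n + 1 + 1 = n + 2 by ring]
    field_simp
    ring

/-- The cyclic integrals of length at least two. -/
lemma cyclicIntegral_succ (hdist : ∀ j k, j ≠ k → sinh (lam j - lam k) ≠ 0)
    (hsum : ∀ j k, sinh (lam j + lam k) ≠ 0) (n : ℕ) {φ : ℂ → ℂ}
    (hφ : (C (n + 1)).HolomorphicInside φ) :
    cyclicIntegral h T η lam C (n + 1) φ =
      ∑ k, φ (lam k) * ((matU h T η lam ^ (n + 2)) k k -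
        fHat h T η lam (lam k) * (matU h T η lam ^ n) k k) := by
  have hpi : (2 * Real.pi * I : ℂ) ≠ 0 := by simp [Real.pi_ne_zero]
  have hstep : ∀ t ∈ Icc (0 : ℝ) 1,
      multiIntegral (n + 1) (fun i => C (i + 1)) (fun w =>
        φ ((Fin.cons ((C 0).toFun t) w : Fin (n + 2) → ℂ) (Fin.last (n + 1))) *
          ∏ i : Fin (n + 2), UHat h T η lam ((Fin.cons ((C 0).toFun t) w : Fin (n + 2) → ℂ) i)
            ((Fin.cons ((C 0).toFun t) w : Fin (n + 2) → ℂ) (i + 1))) =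
      ∑ k, ∑ l, (2 * Real.pi * I) ^ (n + 1) * φ (lam k) * (matU h T η lam ^ n) l k *
        (kernelRes h T η lam ((C 0).toFun t) l * UHat h T η lam (lam k) ((C 0).toFun t)) := by
    intro t ht
    have hz := (C 0).mem_trace ht
    generalize (C 0).toFun t = z at hz ⊢
    have h1 := hC.multiIntegral_chain (h := h) (T := T) hdist hsum n zero_lt_one zero_lt_one hz hz
      hφ
    rw [inv_mul_eq_iff_eq_mul₀ (pow_ne_zero _ hpi)] at h1
    have h3 : ∀ w : Fin (n + 1) → ℂ,
        φ ((Fin.cons z w : Fin (n + 2) → ℂ) (Fin.last (n + 1))) *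
          ∏ i : Fin (n + 2), UHat h T η lam ((Fin.cons z w : Fin (n + 2) → ℂ) i)
            ((Fin.cons z w : Fin (n + 2) → ℂ) (i + 1)) =
        φ (w (Fin.last n)) * ((∏ i : Fin (n + 1),
          UHat h T η lam ((Fin.cons z w : Fin (n + 2) → ℂ) i.castSucc) (w i)) *
            UHat h T η lam (w (Fin.last n)) z) := by
      intro w
      rw [Fin.prod_univ_castSucc, Fin.last_add_one]
      simp only [Fin.coeSucc_eq_succ, Fin.cons_succ, Fin.cons_zero, ← Fin.succ_last]
    simp only [h3]
    rw [h1, Finset.mul_sum]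
    refine Finset.sum_congr rfl fun k _ => ?_
    rw [Finset.mul_sum]
    refine Finset.sum_congr rfl fun l _ => ?_
    ring
  have hcont : ∀ k l, ContinuousOn
      (fun z => kernelRes h T η lam z l * UHat h T η lam (lam k) z) (C 0).trace := fun k l =>
    (hC.continuousOn_kernelRes 0 l).mul (hC.continuousOn_UHat_root 0 k)
  rw [cyclicIntegral, multiIntegral,
    (C 0).integral_congr (g := fun z => ∑ k, ∑ l, (2 * Real.pi * I) ^ (n + 1) * φ (lam k) *
      (matU h T η lam ^ n) l k * (kernelRes h T η lam z l * UHat h T η lam (lam k) z)) hstep,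
    (C 0).integral_sum_sum_const_mul (fun k l => (2 * Real.pi * I) ^ (n + 1) * φ (lam k) *
      (matU h T η lam ^ n) l k)
      (fun k l z => kernelRes h T η lam z l * UHat h T η lam (lam k) z) hcont, Finset.mul_sum]
  refine Finset.sum_congr rfl fun k _ => ?_
  rw [Finset.mul_sum]
  have hB : ∀ l, ((2 * Real.pi * I : ℂ) ^ (n + 1 + 1))⁻¹ * ((2 * Real.pi * I) ^ (n + 1) *
      φ (lam k) * (matU h T η lam ^ n) l k * (C 0).integral (fun z =>
        kernelRes h T η lam z l * UHat h T η lam (lam k) z)) =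
      φ (lam k) * ((matU h T η lam * matU h T η lam) k l * (matU h T η lam ^ n) l k +
        if l = k then -fHat h T η lam (lam l) * (matU h T η lam ^ n) l k else 0) := by
    intro l
    have := hC.integral_kernelRes_mul_UHat (h := h) (T := T) hdist hsum 0 l k
    rw [inv_mul_eq_iff_eq_mul₀ hpi] at this
    rw [this]
    split_ifs with hlk <;> field_simp <;> ring
  simp only [hB]
  rw [← Finset.mul_sum, Finset.sum_add_distrib, Finset.sum_ite_eq', if_pos (Finset.mem_univ k),
    ← Matrix.mul_apply, ← sq, ← pow_add, add_comm 2 n]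
  ring

/-- The cyclic integral of length one. -/
lemma cyclicIntegral_zero (hN : 0 < N) (hdist : ∀ j k, j ≠ k → sinh (lam j - lam k) ≠ 0)
    (hsum : ∀ j k, sinh (lam j + lam k) ≠ 0) {β : ℂ} (hβ : sinh (β / N) ≠ 0)
    (hβη : sinh (β / N - η) ≠ 0) {φ : ℂ → ℂ} (hφ : (C 0).HolomorphicInside φ) :
    cyclicIntegral h T η lam C 0 φ =
      (∑ k, φ (lam k) * matU h T η lam k k) - φ 0 * (aHat h T η β lam 0 / 2) := by
  rw [← hC.integral_UHat_diag hN hdist hsum hβ hβη 0 hφ, cyclicIntegral, multiIntegral]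
  simp [multiIntegral]

end AdaptedContours

/-! ### Power series and the logarithm of a determinant -/

/-- A power series with bounded coefficients is holomorphic in the unit disc. -/
lemma differentiableAt_tsum_mul_pow {c : ℕ → ℂ} {M : ℝ} (hc : ∀ j, ‖c j‖ ≤ M) {x : ℂ}
    (hx : ‖x‖ < 1) : DifferentiableAt ℂ (fun x => ∑' j, c j * x ^ j) x := by
  obtain ⟨ρ, hxρ, hρ⟩ := exists_between hx
  have hρ0 : 0 ≤ ρ := (norm_nonneg x).trans hxρ.le
  refine (differentiableOn_tsum_of_summable_norm (u := fun j => M * ρ ^ j)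
    ((summable_geometric_of_lt_one hρ0 hρ).mul_left M) (fun j => by fun_prop)
    (Metric.isOpen_ball (x := (0 : ℂ)) (ε := ρ)) fun j w hw => ?_).differentiableAt
    (Metric.isOpen_ball.mem_nhds (mem_ball_zero_iff.2 hxρ))
  rw [mem_ball_zero_iff] at hw
  rw [norm_mul, norm_pow]
  have := hc j
  gcongr
  exact (norm_nonneg _).trans this

lemma summable_mul_pow {c : ℕ → ℂ} {M : ℝ} (hc : ∀ j, ‖c j‖ ≤ M) {x : ℂ}
    (hx : ‖x‖ < 1) : Summable fun j => c j * x ^ j := by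
  refine Summable.of_norm_bounded
    ((summable_geometric_of_lt_one (norm_nonneg x) hx).mul_left M) fun j => ?_
  rw [norm_mul, norm_pow]
  have := hc j
  gcongr

/-- Summation of an absolutely convergent double series along the antidiagonals. -/
lemma hasSum_sum_antidiagonal {a : ℕ × ℕ → ℂ} (ha : Summable a) :
    HasSum (fun n => ∑ q ∈ Finset.HasAntidiagonal.antidiagonal n, a q) (∑' q, a q) := by
  have h1 := Finset.HasAntidiagonal.sigmaAntidiagonalEquivProd.hasSum_iff.2 ha.hasSum
  exact h1.sigma fun n => (Finset.HasAntidiagonal.antidiagonal n).hasSum a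

lemma hasSum_neg_log {z : ℂ} (hz : ‖z‖ < 1) :
    HasSum (fun n : ℕ => z ^ (n + 1) / (n + 1)) (-log (1 - z)) := by
  have h1 := (hasSum_nat_add_iff' 1).2 (hasSum_taylorSeries_neg_log hz)
  simpa using h1

lemma hasSum_log_sub_log {z : ℂ} (hz : ‖z‖ < 1) :
    HasSum (fun n : ℕ => 2 * z ^ (2 * n + 1) / (2 * n + 1)) (log (1 + z) - log (1 - z)) := by
  have h1 := (hasSum_taylorSeries_neg_log hz).sub
    (hasSum_taylorSeries_neg_log (z := -z) (by rwa [norm_neg]))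
  have h2 : Function.Injective fun n : ℕ => 2 * n + 1 := fun a b hab => by
    simp only at hab
    omega
  rw [sub_neg_eq_add, sub_neg_eq_add, neg_add_eq_sub, ← h2.hasSum_iff] at h1
  · refine h1.congr_fun fun n => ?_
    have hodd : Odd (2 * n + 1) := ⟨n, rfl⟩
    simp only [Function.comp_apply, hodd.neg_pow]
    push_cast
    ring
  · intro n hn
    have hev : Even n := by
      rw [← Nat.not_odd_iff_even]
      rintro ⟨m, rfl⟩
      exact hn ⟨m, rfl⟩
    simp [hev.neg_pow]

/-- A branch of the quotient `(1 + z) / (1 - z)`. -/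
lemma log_div_one_sub {z : ℂ} (hz : ‖z‖ < 1) :
    log ((1 + z) / (1 - z)) = log (1 + z) - log (1 - z) := by
  have hre : |z.re| < 1 := (abs_re_le_norm z).trans_lt hz
  rw [abs_lt] at hre
  have h1 : 0 < (1 + z).re := by simp; linarith
  have h2 : 0 < (1 - z).re := by simp; linarith
  have hn1 : 1 + z ≠ 0 := fun h => by simp [h] at h1
  have hn2 : 1 - z ≠ 0 := fun h => by simp [h] at h2
  have ha1 := abs_lt.1 (abs_arg_lt_pi_div_two_iff.2 (Or.inl h1))
  have ha2 := abs_lt.1 (abs_arg_lt_pi_div_two_iff.2 (Or.inl h2))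
  have harg : (1 - z).arg ≠ Real.pi := by
    have := Real.pi_pos
    linarith
  have hpi := Real.pi_pos
  have key := (log_mul_eq_add_log_iff hn1 (inv_ne_zero hn2)).2 (by
    rw [arg_inv, if_neg harg]
    constructor <;> linarith)
  rw [div_eq_mul_inv, key, log_inv _ harg, sub_eq_add_neg (log _)]

section Matrix

variable {n : ℕ}

/-- Jacobi's formula along the line `1 + κ M`. -/
lemma hasDerivAt_det_one_add_smul (M : Matrix (Fin n) (Fin n) ℂ) {κ : ℂ}
    {R : Matrix (Fin n) (Fin n) ℂ} (hR : (1 + κ • M) * R = 1) :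
    HasDerivAt (fun κ : ℂ => (1 + κ • M).det) ((1 + κ • M).det * (R * M).trace) κ := by
  -- factor out `1 + κ M`, which reduces the claim to the derivative at `1`
  have h1 : ∀ w : ℂ, (1 + w • M).det = (1 + κ • M).det * (1 + (w - κ) • (R * M)).det := by
    intro w
    rw [← Matrix.det_mul]
    congr 1
    rw [mul_add, mul_one, Matrix.mul_smul, ← mul_assoc, hR, one_mul]
    module
  have h2 : HasDerivAt (fun w : ℂ => (1 + (w - κ) • (R * M)).det) (R * M).trace κ := by
    have h3 : HasDerivAt (fun s : ℂ => 1 + (R * M).trace * s +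
        ((1 + (Polynomial.X : Polynomial ℂ) • (R * M).map Polynomial.C).det.divX.divX.eval s) * s ^ 2)
        (R * M).trace 0 := by
      have ha : HasDerivAt (fun s : ℂ => (R * M).trace * s) (R * M).trace 0 := by
        simpa using (hasDerivAt_id (0 : ℂ)).const_mul (R * M).trace
      have hb := ((1 + (Polynomial.X : Polynomial ℂ) •
        (R * M).map Polynomial.C).det.divX.divX.hasDerivAt (0 : ℂ)).fun_mul
          (hasDerivAt_pow 2 (0 : ℂ))
      refine ((ha.const_add 1).fun_add hb).congr_deriv ?_
      simp
    have h4 : HasDerivAt (fun s : ℂ => (1 + s • (R * M)).det) (R * M).trace 0 := by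
      refine h3.congr_of_eventuallyEq (Eventually.of_forall fun s => ?_)
      exact Matrix.det_one_add_smul s (R * M)
    have h5 : HasDerivAt (fun w : ℂ => w - κ) 1 κ := (hasDerivAt_id κ).sub_const κ
    have h6 := HasDerivAt.comp κ (h₂ := fun s : ℂ => (1 + s • (R * M)).det)
      (by rw [sub_self]; exact h4) h5
    simpa [Function.comp_def] using h6
  exact (h2.const_mul ((1 + κ • M).det)).congr_of_eventuallyEq (Eventually.of_forall h1)

lemma exists_norm_pow_apply_le (M : Matrix (Fin n) (Fin n) ℂ) :
    ∃ B : ℝ, 1 ≤ B ∧ ∀ m i j, ‖(M ^ m) i j‖ ≤ B ^ m := by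
  obtain ⟨b, hb⟩ : ∃ b : ℝ, ∀ i j, ‖M i j‖ ≤ b := by
    refine ⟨∑ i, ∑ j, ‖M i j‖, fun i j => ?_⟩
    exact (Finset.single_le_sum (f := fun j => ‖M i j‖) (fun _ _ => norm_nonneg _)
      (Finset.mem_univ j)).trans (Finset.single_le_sum (f := fun i => ∑ j, ‖M i j‖)
        (fun _ _ => Finset.sum_nonneg fun _ _ => norm_nonneg _) (Finset.mem_univ i))
  refine ⟨max 1 (n * b), le_max_left _ _, fun m => ?_⟩
  set B := max 1 (n * b)
  have hB : 0 ≤ B := zero_le_one.trans (le_max_left _ _)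
  induction m with
  | zero =>
    intro i j
    rw [pow_zero, pow_zero, Matrix.one_apply]
    split_ifs <;> simp
  | succ m ih =>
    intro i j
    have hbi : 0 ≤ b := (norm_nonneg _).trans (hb i j)
    rw [pow_succ, Matrix.mul_apply]
    calc ‖∑ k, (M ^ m) i k * M k j‖ ≤ ∑ _k : Fin n, B ^ m * b := by
          refine norm_sum_le_of_le _ fun k _ => ?_
          rw [norm_mul]
          gcongr
          · exact ih i k
          · exact hb k j
      _ = B ^ m * (n * b) := by
          simp
          ring
      _ ≤ B ^ (m + 1) := by
          rw [pow_succ]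
          gcongr
          exact le_max_right _ _

/-- `det (1 + κ M) = exp (tr log (1 + κ M))` for small `κ`. -/
lemma exists_det_one_add_smul_eq_exp (M : Matrix (Fin n) (Fin n) ℂ) :
    ∃ r : ℝ, 0 < r ∧ ∀ κ : ℂ, ‖κ‖ < r →
      ∃ L, HasSum (fun m : ℕ => (-1) ^ m * κ ^ (m + 1) * (M ^ (m + 1)).trace / (m + 1)) L ∧
        (1 + κ • M).det = exp L := by
  obtain ⟨B, hB1, hB⟩ := exists_norm_pow_apply_le M
  have hB0 : 0 < B := by linarith
  have htr : ∀ m, ‖(M ^ m).trace‖ ≤ n * B ^ m := fun m => by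
    calc ‖(M ^ m).trace‖ ≤ ∑ _i : Fin n, B ^ m := norm_sum_le_of_le _ fun i _ => hB m i i
      _ = n * B ^ m := by simp
  set r : ℝ := 1 / (2 * B) with hr
  have hrpos : 0 < r := by positivity
  have hrB : r * B = 1 / 2 := by
    rw [hr]
    field_simp
  set a : ℕ → ℂ → ℂ := fun m κ => (-1) ^ m * κ ^ (m + 1) * (M ^ (m + 1)).trace / (m + 1) with ha
  set a' : ℕ → ℂ → ℂ := fun m κ => (-κ) ^ m * (M ^ (m + 1)).trace with ha'
  set u : ℕ → ℝ := fun m => n * B * (1 / 2) ^ m with hu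
  have hsu : Summable u := (summable_geometric_of_lt_one (by norm_num) (by norm_num)).mul_left _
  have hpowB : ∀ m : ℕ, ∀ κ : ℂ, ‖κ‖ < r → ‖κ‖ ^ m * B ^ m ≤ (1 / 2) ^ m := fun m κ hκ => by
    rw [← mul_pow, ← hrB]
    gcongr
  have ha'b : ∀ m, ∀ κ ∈ Metric.ball (0 : ℂ) r, ‖a' m κ‖ ≤ u m := by
    intro m κ hκ
    rw [mem_ball_zero_iff] at hκ
    calc ‖a' m κ‖ = ‖κ‖ ^ m * ‖(M ^ (m + 1)).trace‖ := by rw [ha', norm_mul, norm_pow, norm_neg]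
      _ ≤ ‖κ‖ ^ m * (n * B ^ (m + 1)) := by
          gcongr
          exact htr _
      _ = n * B * (‖κ‖ ^ m * B ^ m) := by ring
      _ ≤ u m := by
          rw [hu]
          exact mul_le_mul_of_nonneg_left (hpowB m κ hκ) (by positivity)
  have hderiv : ∀ m, ∀ κ ∈ Metric.ball (0 : ℂ) r, HasDerivAt (a m) (a' m κ) κ := by
    intro m κ _
    have h1 := (((hasDerivAt_pow (m + 1) κ).const_mul ((-1) ^ m)).mul_const
      (M ^ (m + 1)).trace).div_const ((m : ℂ) + 1)
    refine h1.congr_deriv ?_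
    have : (m : ℂ) + 1 ≠ 0 := Nat.cast_add_one_ne_zero m
    simp only [ha']
    rw [neg_pow κ m, Nat.add_sub_cancel]
    push_cast
    field_simp
  have h0mem : (0 : ℂ) ∈ Metric.ball (0 : ℂ) r := Metric.mem_ball_self hrpos
  have hpre : IsPreconnected (Metric.ball (0 : ℂ) r) := (convex_ball _ _).isPreconnected
  have hs0 : Summable fun m => a m 0 := by
    have : (fun m => a m 0) = fun _ => 0 := by
      funext m
      simp [ha]
    rw [this]
    exact summable_zero
  have hL : ∀ κ ∈ Metric.ball (0 : ℂ) r,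
      HasDerivAt (fun κ => ∑' m, a m κ) (∑' m, a' m κ) κ := fun κ hκ =>
    hasDerivAt_tsum_of_isPreconnected hsu Metric.isOpen_ball hpre hderiv ha'b h0mem hs0 hκ
  have hsummable : ∀ κ ∈ Metric.ball (0 : ℂ) r, Summable fun m => a m κ := fun κ hκ =>
    summable_of_summable_hasDerivAt_of_isPreconnected hsu Metric.isOpen_ball hpre hderiv ha'b
      h0mem hs0 hκ
  -- the inverse of `1 + κ M`, as a Neumann series
  have hinv : ∀ κ ∈ Metric.ball (0 : ℂ) r, ∃ R : Matrix (Fin n) (Fin n) ℂ,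
      (1 + κ • M) * R = 1 ∧ (R * M).trace = ∑' m, a' m κ := by
    intro κ hκ
    have hκ' := mem_ball_zero_iff.1 hκ
    have hS : Summable fun m : ℕ => (-κ) ^ m • M ^ m := by
      refine Pi.summable.2 fun i => Pi.summable.2 fun j => ?_
      refine Summable.of_norm_bounded (g := fun m : ℕ => (1 / 2 : ℝ) ^ m)
        (summable_geometric_of_lt_one (by norm_num) (by norm_num)) fun m => ?_
      calc ‖((-κ) ^ m • M ^ m) i j‖ = ‖κ‖ ^ m * ‖(M ^ m) i j‖ := by
            rw [Matrix.smul_apply, smul_eq_mul, norm_mul, norm_pow, norm_neg]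
        _ ≤ ‖κ‖ ^ m * B ^ m := by
            gcongr
            exact hB m i j
        _ ≤ (1 / 2) ^ m := hpowB m κ hκ'
    refine ⟨∑' m : ℕ, (-κ) ^ m • M ^ m, ?_, ?_⟩
    · have h1 := hS.tsum_eq_zero_add
      have h2 : ((-κ) • M) * ∑' m : ℕ, (-κ) ^ m • M ^ m = ∑' m : ℕ, (-κ) ^ (m + 1) • M ^ (m + 1) := by
        rw [← hS.tsum_mul_left]
        refine tsum_congr fun m => ?_
        rw [smul_mul_smul_comm, pow_succ' (-κ), pow_succ' M]
      rw [← h2] at h1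
      rw [neg_smul, neg_mul, pow_zero, pow_zero, one_smul] at h1
      rw [add_mul, one_mul]
      exact eq_add_neg_iff_add_eq.1 h1
    · have h1 := (hS.hasSum.mul_right M).map (Matrix.traceAddMonoidHom (Fin n) ℂ)
        (Continuous.matrix_trace continuous_id)
      refine (h1.tsum_eq.symm.trans (tsum_congr fun m => ?_))
      simp only [Function.comp_apply, Matrix.traceAddMonoidHom_apply, ha']
      rw [smul_mul_assoc, ← pow_succ, Matrix.trace_smul, smul_eq_mul]
  -- by Jacobi's formula this product has derivative `0`
  have hconst : ∀ κ ∈ Metric.ball (0 : ℂ) r,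
      exp (-∑' m, a m κ) * (1 + κ • M).det = 1 := by
    intro κ hκ
    have hd : ∀ κ ∈ Metric.ball (0 : ℂ) r,
        HasDerivAt (fun κ => exp (-∑' m, a m κ) * (1 + κ • M).det) 0 κ := by
      intro κ hκ
      obtain ⟨R, hR, htrR⟩ := hinv κ hκ
      refine (((hL κ hκ).fun_neg.cexp).fun_mul (hasDerivAt_det_one_add_smul M hR)).congr_deriv ?_
      rw [htrR]
      ring
    have := (convex_ball (0 : ℂ) r).is_const_of_fderivWithin_eq_zero (𝕜 := ℂ)
      (f := fun κ => exp (-∑' m, a m κ) * (1 + κ • M).det)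
      (fun κ hκ => (hd κ hκ).differentiableAt.differentiableWithinAt) (fun κ hκ => by
        rw [fderivWithin_of_isOpen Metric.isOpen_ball hκ]
        ext
        simp [(hd κ hκ).deriv]) hκ h0mem
    rw [this]
    simp [ha]
  refine ⟨r, hrpos, fun κ hκ => ?_⟩
  have hκ' : κ ∈ Metric.ball (0 : ℂ) r := mem_ball_zero_iff.2 hκ
  refine ⟨_, (hsummable κ hκ').hasSum, ?_⟩
  have := hconst κ hκ'
  rw [exp_neg, inv_mul_eq_one₀ (exp_ne_zero _)] at this
  exact this.symm

end Matrix

/-! ### Summation of the series -/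

section Series

variable {N : ℕ} (h T : ℝ) (η β : ℂ) (lam : Fin N → ℂ)

/-- The points at which a cyclic integral evaluates its test function: the roots and the origin. -/
def nodes (o : Option (Fin N)) : ℂ := o.elim 0 lam

/-- The weights of the evaluations making up the cyclic integral of length `n + 1`. -/
def nodeWeight : ℕ → Option (Fin N) → ℂ
  | 0, none => -(aHat h T η β lam 0 / 2)
  | 0, some k => matU h T η lam k k
  | _ + 1, none => 0
  | n + 1, some k => (matU h T η lam ^ (n + 2)) k k -
      fHat h T η lam (lam k) * (matU h T η lam ^ n) k k

/-- The coefficient of `κ ^ (2 n + 1) / (2 n + 1)` in the series. -/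
def oddCoeff (n : ℕ) : ℂ :=
  (matU h T η lam ^ (2 * n + 1)).trace - aHat h T η β lam 0 ^ (2 * n + 1) / 2

/-- The coefficient of `-κ ^ (2 (n + 1)) / (2 (n + 1))` in the series. -/
def evenCoeff (n : ℕ) : ℂ :=
  (matU h T η lam ^ (2 * (n + 1))).trace - ∑ p, fHat h T η lam (lam p) ^ (n + 1)

variable {h T η β lam}

/-- The contributions along an antidiagonal telescope at every root, and at the origin because
`f̂(0) = â(0) ^ 2`. -/
lemma sum_antidiagonal_nodeWeight_odd (hβ : sinh (β / N) ≠ 0) (hβη : sinh (β / N - η) ≠ 0)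
    (n : ℕ) :
    ∑ q ∈ Finset.HasAntidiagonal.antidiagonal n, ∑ o, fHat h T η lam (nodes lam o) ^ q.2 *
      nodeWeight h T η β lam (2 * q.1) o = oddCoeff h T η β lam n := by
  have hstep : ∀ o (n : ℕ), ∑ q ∈ Finset.HasAntidiagonal.antidiagonal (n + 1),
      fHat h T η lam (nodes lam o) ^ q.2 * nodeWeight h T η β lam (2 * q.1) o =
      nodeWeight h T η β lam (2 * (n + 1)) o + fHat h T η lam (nodes lam o) *
        ∑ q ∈ Finset.HasAntidiagonal.antidiagonal n, fHat h T η lam (nodes lam o) ^ q.2 *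
          nodeWeight h T η β lam (2 * q.1) o := by
    intro o n
    rw [Finset.Nat.sum_antidiagonal_succ', Finset.mul_sum, pow_zero, one_mul]
    congr 1
    refine Finset.sum_congr rfl fun q _ => ?_
    rw [pow_succ]
    ring
  have hsome : ∀ k (n : ℕ), ∑ q ∈ Finset.HasAntidiagonal.antidiagonal n,
      fHat h T η lam (nodes lam (some k)) ^ q.2 * nodeWeight h T η β lam (2 * q.1) (some k) =
      (matU h T η lam ^ (2 * n + 1)) k k := by
    intro k n
    induction n with
    | zero => simp [nodeWeight]
    | succ n ih =>
      rw [hstep, ih, show 2 * (n + 1) = 2 * n + 1 + 1 by ring, nodeWeight]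
      simp [nodes]
  have hnone : ∀ n : ℕ, ∑ q ∈ Finset.HasAntidiagonal.antidiagonal n,
      fHat h T η lam (nodes lam none) ^ q.2 * nodeWeight h T η β lam (2 * q.1) none =
      -(aHat h T η β lam 0 ^ (2 * n + 1) / 2) := by
    intro n
    induction n with
    | zero => simp [nodeWeight]
    | succ n ih =>
      rw [hstep, ih, show 2 * (n + 1) = 2 * n + 1 + 1 by ring, nodeWeight]
      simp only [nodes, Option.elim_none, fHat_zero h T hβ hβη]
      ring
  rw [Finset.sum_comm, Fintype.sum_option, hnone, oddCoeff, Matrix.trace]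
  simp only [hsome, Matrix.diag_apply]
  ring

/-- In even order the telescoping leaves the boundary terms `f̂(lam k) ^ (n + 1)`. -/
lemma sum_antidiagonal_nodeWeight_even (n : ℕ) :
    ∑ q ∈ Finset.HasAntidiagonal.antidiagonal n, ∑ o, fHat h T η lam (nodes lam o) ^ q.2 *
      nodeWeight h T η β lam (2 * q.1 + 1) o = evenCoeff h T η lam n := by
  have hsome : ∀ k (n : ℕ), ∑ q ∈ Finset.HasAntidiagonal.antidiagonal n,
      fHat h T η lam (nodes lam (some k)) ^ q.2 * nodeWeight h T η β lam (2 * q.1 + 1) (some k) =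
      (matU h T η lam ^ (2 * (n + 1))) k k - fHat h T η lam (lam k) ^ (n + 1) := by
    intro k n
    induction n with
    | zero => simp [nodeWeight]
    | succ n ih =>
      rw [Finset.Nat.sum_antidiagonal_succ', pow_zero, one_mul]
      simp only [pow_succ _ (Prod.snd _), mul_comm _ (fHat h T η lam (nodes lam (some k))),
        mul_assoc]
      rw [← Finset.mul_sum, ih]
      simp only [nodeWeight, nodes, Option.elim_some]
      rw [show 2 * (n + 1) + 2 = 2 * (n + 1 + 1) by ring]
      ring
  have hnone : ∀ n : ℕ, ∑ q ∈ Finset.HasAntidiagonal.antidiagonal n,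
      fHat h T η lam (nodes lam none) ^ q.2 * nodeWeight h T η β lam (2 * q.1 + 1) none = 0 :=
    fun n => Finset.sum_eq_zero fun q _ => by simp [nodeWeight]
  rw [Finset.sum_comm, Fintype.sum_option, hnone, evenCoeff, Matrix.trace, zero_add,
    ← Finset.sum_sub_distrib]
  simp only [hsome, Matrix.diag_apply]

namespace AdaptedContours

variable {C : ℕ → Contour} (hC : AdaptedContours η lam C)
include hC

lemma encircles_nodes (q : ℕ) (o : Option (Fin N)) : (C q).Encircles (nodes lam o) := by
  cases o with
  | none => exact hC.origin q
  | some k => exact hC.root q k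

/-- A cyclic integral is a finite combination of the values of its test function at the nodes. -/
lemma cyclicIntegral_eq (hN : 0 < N) (hdist : ∀ j k, j ≠ k → sinh (lam j - lam k) ≠ 0)
    (hsum : ∀ j k, sinh (lam j + lam k) ≠ 0) (hβ : sinh (β / N) ≠ 0)
    (hβη : sinh (β / N - η) ≠ 0) (n : ℕ) {φ : ℂ → ℂ} (hφ : (C n).HolomorphicInside φ) :
    cyclicIntegral h T η lam C n φ =
      ∑ o, φ (nodes lam o) * nodeWeight h T η β lam n o := by
  rw [Fintype.sum_option]
  cases n with
  | zero =>
    rw [hC.cyclicIntegral_zero hN hdist hsum hβ hβη hφ]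
    simp only [nodes, nodeWeight, Option.elim_none, Option.elim_some]
    ring
  | succ n =>
    rw [hC.cyclicIntegral_succ hdist hsum n hφ]
    simp only [nodes, nodeWeight, Option.elim_none, Option.elim_some]
    ring

lemma norm_lt_one_of_encircles {q : ℕ} {κ : ℂ}
    (hκ : ∀ t ∈ Icc (0 : ℝ) 1, ‖κ ^ 2 * fHat h T η lam ((C q).toFun t)‖ < 1) {w : ℂ}
    (hw : (C q).Encircles w) : ‖κ ^ 2 * fHat h T η lam w‖ < 1 := by
  by_contra! hge
  obtain ⟨Ω, ho, hd, he⟩ := hC.holomorphicInside_fHat (h := h) (T := T) q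
  refine hw.not_excludes ((C q).excludes_of_norm_ge ho (hd.const_mul (κ ^ 2)) he ?_
    (hw.mem_of_excludes he) hge)
  rintro _ ⟨t, ht, rfl⟩
  exact hκ t ht

/-- The summed geometric-type series is holomorphic inside the contour, since `|κ² f̂| < 1` there
by the maximum principle. -/
lemma holomorphicInside_tsum {q : ℕ} {κ : ℂ}
    (hκ : ∀ t ∈ Icc (0 : ℝ) 1, ‖κ ^ 2 * fHat h T η lam ((C q).toFun t)‖ < 1) {b : ℕ → ℂ} {M : ℝ}
    (hb : ∀ j, ‖(b j)⁻¹‖ ≤ M) :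
    (C q).HolomorphicInside fun w => ∑' j, (κ ^ 2 * fHat h T η lam w) ^ j / b j := by
  obtain ⟨Ω, ho, hd, he⟩ := hC.holomorphicInside_fHat (h := h) (T := T) q
  have hd' := hd.const_mul (κ ^ 2)
  refine ⟨Ω ∩ (fun w => κ ^ 2 * fHat h T η lam w) ⁻¹' Metric.ball 0 1,
    hd'.continuousOn.isOpen_inter_preimage ho Metric.isOpen_ball, fun w hw => ?_, fun w hw => ?_⟩
  · have h1 := differentiableAt_tsum_mul_pow hb (mem_ball_zero_iff.1 hw.2)
    have h2 := h1.comp w (hd'.differentiableAt (ho.mem_nhds hw.1))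
    simp only [div_eq_inv_mul]
    exact h2.differentiableWithinAt
  · by_cases h1 : w ∈ Ω
    swap
    · exact he w h1
    have h2 : 1 ≤ ‖κ ^ 2 * fHat h T η lam w‖ := by
      by_contra! h2
      exact hw ⟨h1, mem_ball_zero_iff.2 h2⟩
    refine (C q).excludes_of_norm_ge ho hd' he ?_ h1 h2
    rintro _ ⟨t, ht, rfl⟩
    exact hκ t ht

variable (hN : 0 < N) (hdist : ∀ j k, j ≠ k → sinh (lam j - lam k) ≠ 0)
  (hsum : ∀ j k, sinh (lam j + lam k) ≠ 0) (hβ : sinh (β / N) ≠ 0) (hβη : sinh (β / N - η) ≠ 0)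
include hN hdist hsum hβ hβη

/-- The inner series may be integrated termwise. -/
lemma hasSum_cyclicIntegral {n : ℕ} {κ : ℂ}
    (hκ : ∀ t ∈ Icc (0 : ℝ) 1, ‖κ ^ 2 * fHat h T η lam ((C n).toFun t)‖ < 1) {b : ℕ → ℂ} {M : ℝ}
    (hb : ∀ j, ‖(b j)⁻¹‖ ≤ M) :
    HasSum (fun j => κ ^ (2 * j) / b j *
        cyclicIntegral h T η lam C n fun w => fHat h T η lam w ^ j)
      (cyclicIntegral h T η lam C n fun w => ∑' j, (κ ^ 2 * fHat h T η lam w) ^ j / b j) := by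
  rw [hC.cyclicIntegral_eq hN hdist hsum hβ hβη n (hC.holomorphicInside_tsum hκ hb)]
  have h1 : ∀ j, κ ^ (2 * j) / b j * cyclicIntegral h T η lam C n (fun w => fHat h T η lam w ^ j) =
      ∑ o, (κ ^ 2 * fHat h T η lam (nodes lam o)) ^ j / b j * nodeWeight h T η β lam n o := by
    intro j
    rw [hC.cyclicIntegral_eq hN hdist hsum hβ hβη n ((hC.holomorphicInside_fHat n).pow j),
      Finset.mul_sum]
    refine Finset.sum_congr rfl fun o _ => ?_
    rw [mul_pow, pow_mul]
    ring
  simp only [h1]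
  refine hasSum_sum fun o _ => HasSum.mul_right _ (Summable.hasSum ?_)
  simp only [div_eq_inv_mul]
  exact summable_mul_pow hb (hC.norm_lt_one_of_encircles hκ (hC.encircles_nodes n o))

/-- Where it converges, the series is a power series in `κ` with explicit coefficients. -/
lemma seriesF_hasSum {κ : ℂ} (hκ : SeriesConverges h T η lam C κ) :
    ∃ S₁ S₂, HasSum (fun n : ℕ => κ ^ (2 * n + 1) / (2 * n + 1) * oddCoeff h T η β lam n) S₁ ∧
      HasSum (fun n : ℕ => κ ^ (2 * (n + 1)) / (2 * (n + 1)) * evenCoeff h T η lam n) S₂ ∧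
      seriesF h T η lam C κ = S₁ - S₂ := by
  obtain ⟨h1, h2, h3⟩ := hκ
  refine ⟨_, _, (hasSum_sum_antidiagonal h2).congr_fun fun n => ?_,
    (hasSum_sum_antidiagonal h3).congr_fun fun n => ?_, ?_⟩
  · rw [← sum_antidiagonal_nodeWeight_odd hβ hβη, Finset.mul_sum]
    refine Finset.sum_congr rfl fun q hq => ?_
    rw [hC.cyclicIntegral_eq hN hdist hsum hβ hβη _ ((hC.holomorphicInside_fHat _).pow q.2)]
    have hq' := Finset.HasAntidiagonal.mem_antidiagonal.1 hq
    rw [← hq']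
    push_cast
    rfl
  · rw [← sum_antidiagonal_nodeWeight_even (β := β), Finset.mul_sum]
    refine Finset.sum_congr rfl fun q hq => ?_
    rw [hC.cyclicIntegral_eq hN hdist hsum hβ hβη _ ((hC.holomorphicInside_fHat _).pow q.2)]
    have hq' := Finset.HasAntidiagonal.mem_antidiagonal.1 hq
    rw [← hq', show q.1 + 1 + q.2 = q.1 + q.2 + 1 by ring]
    push_cast
    rw [show (q.1 : ℂ) + 1 + q.2 = q.1 + q.2 + 1 by ring]
  · rw [seriesF, h2.tsum_prod, h3.tsum_prod]
    congr 1
    · refine tsum_congr fun k => ?_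
      have hb : ∀ j : ℕ, ‖(2 * ((k : ℂ) + j) + 1)⁻¹‖ ≤ 1 := fun j => by
        have : (2 * ((k : ℂ) + j) + 1) = ((2 * (k + j) + 1 : ℕ) : ℂ) := by push_cast; ring
        rw [this, norm_inv, Complex.norm_natCast]
        exact inv_le_one_of_one_le₀ (by exact_mod_cast Nat.le_add_left 1 _)
      rw [← ((hC.hasSum_cyclicIntegral hN hdist hsum hβ hβη (h1 (2 * k)) hb).mul_left
        (κ ^ (2 * k + 1))).tsum_eq]
      refine tsum_congr fun j => ?_
      rw [show 2 * (k + j) + 1 = 2 * k + 1 + 2 * j by ring, pow_add κ (2 * k + 1)]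
      ring
    · refine tsum_congr fun k => ?_
      have hb : ∀ j : ℕ, ‖(2 * ((k : ℂ) + 1 + j))⁻¹‖ ≤ 1 := fun j => by
        have : (2 * ((k : ℂ) + 1 + j)) = ((2 * (k + 1 + j) : ℕ) : ℂ) := by push_cast; ring
        rw [this, norm_inv, Complex.norm_natCast]
        exact inv_le_one_of_one_le₀ (by exact_mod_cast (by omega : 1 ≤ 2 * (k + 1 + j)))
      rw [← ((hC.hasSum_cyclicIntegral hN hdist hsum hβ hβη (h1 (2 * k + 1)) hb).mul_left
        (κ ^ (2 * (k + 1)))).tsum_eq]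
      refine tsum_congr fun j => ?_
      rw [show 2 * (k + 1 + j) = 2 * (k + 1) + 2 * j by ring, pow_add κ (2 * (k + 1))]
      ring

lemma exists_seriesConverges :
    ∃ r : ℝ, 0 < r ∧ ∀ κ : ℂ, ‖κ‖ < r → SeriesConverges h T η lam C κ := by
  obtain ⟨B, hB1, hB⟩ := exists_norm_pow_apply_le (matU h T η lam)
  have hB0 : 0 ≤ B := zero_le_one.trans hB1
  obtain ⟨F, hF⟩ := (C 0).isCompact_trace.exists_bound_of_continuousOn
    (hC.holomorphicInside_fHat (h := h) (T := T) 0).continuousOn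
  set G := 1 + |F| + ∑ o, ‖fHat h T η lam (nodes lam o)‖ with hG
  have hsumnn : 0 ≤ ∑ o, ‖fHat h T η lam (nodes lam o)‖ :=
    Finset.sum_nonneg fun _ _ => norm_nonneg _
  have hG1 : 1 ≤ G := by
    rw [hG]
    linarith [abs_nonneg F]
  have hG0 : 0 ≤ G := zero_le_one.trans hG1
  have hGF : ∀ w ∈ (C 0).trace, ‖fHat h T η lam w‖ ≤ G := fun w hw =>
    (hF w hw).trans (by rw [hG]; linarith [le_abs_self F])
  have hGo : ∀ o, ‖fHat h T η lam (nodes lam o)‖ ≤ G := fun o => by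
    have := Finset.single_le_sum (f := fun o => ‖fHat h T η lam (nodes lam o)‖)
      (fun _ _ => norm_nonneg _) (Finset.mem_univ o)
    rw [hG]
    linarith [abs_nonneg F]
  set K := B + G + ‖aHat h T η β lam 0 / 2‖ with hK
  have hx0 := norm_nonneg (aHat h T η β lam 0 / 2)
  have hK0 : 0 ≤ K := by positivity
  have hw : ∀ n o, ‖nodeWeight h T η β lam n o‖ ≤ K * B ^ n := by
    rintro (_ | n) (_ | k)
    · rw [nodeWeight, norm_neg, pow_zero, mul_one]
      linarith
    · rw [nodeWeight, pow_zero, mul_one]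
      have := hB 1 k k
      rw [pow_one, pow_one] at this
      linarith
    · rw [nodeWeight, norm_zero]
      positivity
    · rw [nodeWeight]
      have h1 := hB (n + 2) k k
      have h2 := hB n k k
      have h3 := hGo (some k)
      have h4 : B ^ n ≤ B ^ (n + 1) := pow_le_pow_right₀ hB1 (Nat.le_succ n)
      have h5 : 0 ≤ B ^ (n + 1) := by positivity
      calc _ ≤ B ^ (n + 2) + G * B ^ n := by
            refine norm_sub_le_of_le h1 ?_
            rw [norm_mul]
            gcongr
            exact h3
        _ ≤ B * B ^ (n + 1) + G * B ^ (n + 1) := by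
            rw [pow_succ' B (n + 1)]
            gcongr
        _ ≤ K * B ^ (n + 1) := by
            rw [← add_mul]
            gcongr
            linarith
  set D := (Fintype.card (Option (Fin N)) : ℝ) * K with hD
  have hD0 : 0 ≤ D := by positivity
  have hcyc : ∀ n j, ‖cyclicIntegral h T η lam C n fun w => fHat h T η lam w ^ j‖ ≤
      D * (G ^ j * B ^ n) := by
    intro n j
    rw [hC.cyclicIntegral_eq hN hdist hsum hβ hβη n ((hC.holomorphicInside_fHat n).pow j)]
    calc _ ≤ ∑ _o : Option (Fin N), G ^ j * (K * B ^ n) := by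
          refine norm_sum_le_of_le _ fun o _ => ?_
          rw [norm_mul, norm_pow]
          have := hGo o
          have := hw n o
          gcongr
      _ = D * (G ^ j * B ^ n) := by
          rw [Finset.sum_const, Finset.card_univ, nsmul_eq_mul, hD]
          ring
  -- with this radius, `|κ|² G` and `|κ|² B²`, the ratios of the double series, are at most `1 / 4`
  have hr : 0 < 1 / (2 * G * B) := by positivity
  refine ⟨1 / (2 * G * B), hr, fun κ hκ => ?_⟩
  have hκ0 := norm_nonneg κ
  have hκ1 : ‖κ‖ * G * B ≤ 1 / 2 := by
    rw [lt_div_iff₀ (by positivity)] at hκ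
    linarith
  have hκG : ‖κ‖ * G ≤ 1 / 2 := (le_mul_of_one_le_right (by positivity) hB1).trans hκ1
  have hκB : ‖κ‖ * B ≤ 1 / 2 :=
    le_trans (by gcongr; exact le_mul_of_one_le_right hκ0 hG1) hκ1
  have hκ2 : ‖κ‖ ≤ 1 / 2 := (le_mul_of_one_le_right hκ0 hG1).trans hκG
  have hGq : ‖κ‖ ^ 2 * G ≤ 1 / 4 := by nlinarith
  have hBq : ‖κ‖ ^ 2 * B ^ 2 ≤ 1 / 4 := by
    rw [← mul_pow]
    exact (pow_le_pow_left₀ (by positivity) hκB 2).trans (by norm_num)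
  have h0 : ∀ t ∈ Icc (0 : ℝ) 1, ‖κ ^ 2 * fHat h T η lam ((C 0).toFun t)‖ < 1 := by
    intro t ht
    have := hGF _ ((C 0).mem_trace ht)
    calc _ = ‖κ‖ ^ 2 * ‖fHat h T η lam ((C 0).toFun t)‖ := by rw [norm_mul, norm_pow]
      _ ≤ ‖κ‖ ^ 2 * G := by gcongr
      _ < 1 := by linarith
  have hgeom : Summable fun q : ℕ × ℕ => D * B * ((1 / 4 : ℝ) ^ q.1 * (1 / 4 : ℝ) ^ q.2) :=
    ((summable_geometric_of_lt_one (by norm_num) (by norm_num)).mul_of_nonneg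
      (summable_geometric_of_lt_one (by norm_num) (by norm_num))
      (fun _ => by positivity) fun _ => by positivity).mul_left _
  have hpow : ∀ k j : ℕ, ‖κ‖ ^ (2 * (k + j)) * (G ^ j * B ^ (2 * k)) ≤
      (1 / 4) ^ k * (1 / 4) ^ j := by
    intro k j
    calc _ = (‖κ‖ ^ 2 * B ^ 2) ^ k * (‖κ‖ ^ 2 * G) ^ j := by
          rw [mul_pow, mul_pow, ← pow_mul, ← pow_mul, ← pow_mul, mul_add, pow_add]
          ring
      _ ≤ _ := by gcongr
  refine ⟨fun p t ht => ?_, Summable.of_norm_bounded hgeom fun q => ?_,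
    Summable.of_norm_bounded hgeom fun q => ?_⟩
  -- `C 0` encircles the points of all other contours, where the maximum principle applies
  · rcases Nat.eq_zero_or_pos p with rfl | hp
    · exact h0 t ht
    · exact hC.norm_lt_one_of_encircles h0 ((hC.encased 0 p hp).1 t ht)
  · have hb : 1 ≤ ‖(2 * ((q.1 : ℂ) + q.2) + 1)‖ := by
      have : (2 * ((q.1 : ℂ) + q.2) + 1) = ((2 * (q.1 + q.2) + 1 : ℕ) : ℂ) := by push_cast; ring
      rw [this, Complex.norm_natCast]
      exact_mod_cast Nat.le_add_left 1 _
    rw [norm_mul, norm_div, norm_pow, pow_succ]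
    calc _ ≤ ‖κ‖ ^ (2 * (q.1 + q.2)) * ‖κ‖ * (D * (G ^ q.2 * B ^ (2 * q.1))) := by
          gcongr
          · exact div_le_self (by positivity) hb
          · exact hcyc _ _
      _ = D * ‖κ‖ * (‖κ‖ ^ (2 * (q.1 + q.2)) * (G ^ q.2 * B ^ (2 * q.1))) := by ring
      _ ≤ D * B * ((1 / 4 : ℝ) ^ q.1 * (1 / 4 : ℝ) ^ q.2) := by
          have := hpow q.1 q.2
          gcongr
          linarith
  · have hb : 1 ≤ ‖(2 * ((q.1 : ℂ) + 1 + q.2))‖ := by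
      have : (2 * ((q.1 : ℂ) + 1 + q.2)) = ((2 * (q.1 + 1 + q.2) : ℕ) : ℂ) := by push_cast; ring
      rw [this, Complex.norm_natCast]
      exact_mod_cast (by omega : 1 ≤ 2 * (q.1 + 1 + q.2))
    rw [norm_mul, norm_div, norm_pow, show 2 * (q.1 + 1 + q.2) = 2 * (q.1 + q.2) + 2 by ring,
      pow_add]
    calc _ ≤ ‖κ‖ ^ (2 * (q.1 + q.2)) * ‖κ‖ ^ 2 * (D * (G ^ q.2 * B ^ (2 * q.1 + 1))) := by
          gcongr
          · exact div_le_self (by positivity) hb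
          · exact hcyc _ _
      _ = D * B * ‖κ‖ ^ 2 * (‖κ‖ ^ (2 * (q.1 + q.2)) * (G ^ q.2 * B ^ (2 * q.1))) := by ring
      _ ≤ D * B * 1 * ((1 / 4 : ℝ) ^ q.1 * (1 / 4 : ℝ) ^ q.2) := by
          have := hpow q.1 q.2
          gcongr
          nlinarith
      _ = _ := by ring

/-- The determinant formula for small coupling, by comparison of logarithms. -/
lemma exists_det_eq_prefactor_mul_exp (hBethe : BetheEquations h T η β lam) :
    ∃ r : ℝ, 0 < r ∧ ∀ κ : ℂ, ‖κ‖ < r → SeriesConverges h T η lam C κ ∧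
      (1 + κ • matU h T η lam).det =
        prefactor h T η β lam κ * exp (seriesF h T η lam C κ) := by
  obtain ⟨r₁, hr₁, hconv⟩ := hC.exists_seriesConverges (h := h) (T := T) hN hdist hsum hβ hβη
  obtain ⟨r₂, hr₂, hdet⟩ := exists_det_one_add_smul_eq_exp (matU h T η lam)
  set x := aHat h T η β lam 0 with hx
  obtain ⟨r₃, hr₃, hsmall⟩ : ∃ r₃ : ℝ, 0 < r₃ ∧ ∀ κ : ℂ, ‖κ‖ < r₃ →
      ‖κ * x‖ < 1 ∧ ∀ p, ‖κ ^ 2 * aHat h T η β lam (-lam p)‖ < 1 := by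
    have hev : ∀ᶠ κ : ℂ in 𝓝 0, ‖κ * x‖ < 1 ∧
        ∀ p, ‖κ ^ 2 * aHat h T η β lam (-lam p)‖ < 1 := by
      refine Eventually.and ?_ (eventually_all.2 fun p => ?_)
      · have : Tendsto (fun κ : ℂ => ‖κ * x‖) (𝓝 0) (𝓝 ‖(0 : ℂ) * x‖) :=
          Continuous.tendsto (by fun_prop) _
        exact this.eventually_lt_const (by simp)
      · have : Tendsto (fun κ : ℂ => ‖κ ^ 2 * aHat h T η β lam (-lam p)‖) (𝓝 0)
            (𝓝 ‖(0 : ℂ) ^ 2 * aHat h T η β lam (-lam p)‖) :=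
          Continuous.tendsto (by fun_prop) _
        exact this.eventually_lt_const (by simp)
    obtain ⟨ε, hε, hball⟩ := Metric.eventually_nhds_iff_ball.1 hev
    exact ⟨ε, hε, fun κ hκ => hball κ (mem_ball_zero_iff.2 hκ)⟩
  refine ⟨min r₁ (min r₂ r₃), by positivity, fun κ hκ => ?_⟩
  have hκ1 := hκ.trans_le (min_le_left _ _)
  have hκ2 := hκ.trans_le ((min_le_right _ _).trans (min_le_left _ _))
  have hκ3 := hκ.trans_le ((min_le_right _ _).trans (min_le_right _ _))
  refine ⟨hconv κ hκ1, ?_⟩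
  obtain ⟨L, hL, hdetL⟩ := hdet κ hκ2
  obtain ⟨hsx, hsa⟩ := hsmall κ hκ3
  obtain ⟨S₁, S₂, hS₁, hS₂, hS⟩ := hC.seriesF_hasSum hN hdist hsum hβ hβη (hconv κ hκ1)
  -- the odd and the even part of `log det`
  have hodd := hS₁.add ((hasSum_log_sub_log hsx).mul_left (1 / 4))
  have heven := (hS₂.add (hasSum_sum (s := Finset.univ) fun p _ =>
    (hasSum_neg_log (z := -(κ ^ 2 * aHat h T η β lam (-lam p)))
      (by rw [norm_neg]; exact hsa p)).mul_left (1 / 2))).neg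
  have hLuniq := HasSum.even_add_odd
    (f := fun m : ℕ => (-1) ^ m * κ ^ (m + 1) * (matU h T η lam ^ (m + 1)).trace / (m + 1))
    (hodd.congr_fun fun n => by
      have h2 : (2 * (n : ℂ) + 1) ≠ 0 := by exact_mod_cast Nat.succ_ne_zero (2 * n)
      rw [oddCoeff, ← hx, mul_pow, pow_mul (-1 : ℂ), neg_one_sq, one_pow]
      push_cast
      field_simp
      ring)
    (heven.congr_fun fun n => by
      have h2 : ((n : ℂ) + 1) ≠ 0 := Nat.cast_add_one_ne_zero n
      rw [evenCoeff]
      simp only [fHat_root h T hBethe]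
      rw [← Finset.mul_sum, ← Finset.sum_div]
      simp only [neg_pow (κ ^ 2 * _), neg_pow (aHat h T η β lam _), mul_pow, ← Finset.mul_sum,
        ← pow_mul, mul_left_comm ((-1 : ℂ) ^ (n + 1))]
      have h3 : (-1 : ℂ) ^ (2 * n + 1) = -1 := by
        rw [pow_succ, pow_mul, neg_one_sq, one_pow, one_mul]
      rw [h3, show 2 * n + 1 + 1 = 2 * (n + 1) by ring]
      push_cast
      rw [show (2 * (n : ℂ) + 1 + 1) = 2 * (n + 1) by ring]
      field_simp
      ring)
  have hLeq := hL.unique hLuniq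
  have hne : ∀ p, 1 + κ ^ 2 * aHat h T η β lam (-lam p) ≠ 0 := fun p h0 => by
    have := hsa p
    rw [eq_neg_of_add_eq_zero_right h0] at this
    simp at this
  have hnex : (1 + κ * x) / (1 - κ * x) ≠ 0 := by
    refine div_ne_zero (fun h0 => ?_) fun h0 => ?_
    · rw [eq_neg_of_add_eq_zero_right h0] at hsx
      simp at hsx
    · rw [← sub_eq_zero.1 h0] at hsx
      simp at hsx
  rw [hdetL, hLeq, prefactor, cpow_def_of_ne_zero hnex, log_div_one_sub hsx,
    Finset.prod_congr rfl fun p _ => cpow_def_of_ne_zero (hne p) _, ← exp_sum, ← exp_add,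
    ← exp_add, hS]
  congr 1
  simp only [sub_neg_eq_add, ← Finset.mul_sum, ← Finset.sum_mul, Finset.sum_neg_distrib]
  ring

end AdaptedContours

end Series

/-! ### Analytic continuation along a path -/

section Continuation

variable {a b : ℂ} {γ : Path a b} {g : ℂ → ℂ} {G G' : unitInterval → ℂ → ℂ}

/-- Two analytic continuations of the same germ agree: the set of times at which they do is open
and closed, by the identity theorem on small discs. -/
lemma IsContinuationAlong.eventuallyEq (hG : IsContinuationAlong γ g G)
    (hG' : IsContinuationAlong γ g G') (t : unitInterval) : G t =ᶠ[𝓝 (γ t)] G' t := by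
  have hloc : IsLocallyConstant fun t => G t =ᶠ[𝓝 (γ t)] G' t := by
    refine (IsLocallyConstant.iff_eventually_eq _).2 fun t => ?_
    obtain ⟨ε, hε, hball⟩ := Metric.eventually_nhds_iff_ball.1
      ((hG.analytic t).eventually_analyticAt.and (hG'.analytic t).eventually_analyticAt)
    filter_upwards [hG.compatible t, hG'.compatible t,
      γ.continuous.continuousAt.eventually (Metric.ball_mem_nhds (γ t) hε)] with s h1 h2 h3
    refine propext ⟨fun h => ?_, fun h => ?_⟩
    · exact (AnalyticOnNhd.eqOn_of_preconnected_of_eventuallyEq (fun z hz => (hball z hz).1)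
        (fun z hz => (hball z hz).2) (convex_ball _ _).isPreconnected h3
        ((h1.symm.trans h).trans h2)).eventuallyEq_of_mem (Metric.ball_mem_nhds _ hε)
    · have := (AnalyticOnNhd.eqOn_of_preconnected_of_eventuallyEq (fun z hz => (hball z hz).1)
        (fun z hz => (hball z hz).2) (convex_ball _ _).isPreconnected (Metric.mem_ball_self hε)
        h).eventuallyEq_of_mem (Metric.isOpen_ball.mem_nhds h3)
      exact (h1.trans this).trans h2.symm
  have h0 : G 0 =ᶠ[𝓝 (γ 0)] G' 0 := by
    rw [γ.source]
    exact hG.start.trans hG'.start.symm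
  exact (hloc.apply_eq_of_preconnectedSpace 0 t).mp h0

lemma IsContinuationAlong.continuesTo (hG : IsContinuationAlong γ g G) :
    ContinuesTo γ g (G 1 b) := by
  refine ⟨⟨G, hG⟩, fun G' hG' => ?_⟩
  have := (hG'.eventuallyEq hG 1).eq_of_nhds
  rwa [γ.target] at this

lemma isContinuationAlong_const (hg : ∀ t, AnalyticAt ℂ g (γ t)) :
    IsContinuationAlong γ g fun _ => g :=
  ⟨.rfl, hg, fun _ => .of_forall fun _ => .rfl⟩

/-- A factor of a continuable product inherits the continuation. -/
lemma IsContinuationAlong.div {D e : ℂ → ℂ} (hG : IsContinuationAlong γ g G)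
    (hG0 : ∀ t, G t (γ t) ≠ 0) (hD : ∀ t, AnalyticAt ℂ D (γ t)) (hg0 : g a ≠ 0)
    (hDe : ∀ᶠ z in 𝓝 a, D z = g z * e z) : IsContinuationAlong γ e fun t z => D z / G t z where
  start := by
    have h1 : ContinuousAt (G 0) a := by
      have := (hG.analytic 0).continuousAt
      rwa [γ.source] at this
    have h2 : G 0 a ≠ 0 := by rwa [hG.start.eq_of_nhds]
    filter_upwards [hG.start, hDe, h1.eventually_ne h2] with z h3 h4 h5
    rw [h4, ← h3, mul_div_cancel_left₀ _ h5]
  analytic t := (hD t).div (hG.analytic t) (hG0 t)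
  compatible t := by
    filter_upwards [hG.compatible t] with s hs
    filter_upwards [hs] with z hz
    rw [hz]

/-- The principal logarithm of a function without zeros on the path, with value `1` at its
starting point, continues along the path: lift the image path through the covering `exp` and
correct the lift by the principal logarithm of a quotient close to `1`. -/
lemma exists_isContinuationAlong_log {q : ℂ → ℂ} (hq : ∀ t, AnalyticAt ℂ q (γ t))
    (hq0 : ∀ t, q (γ t) ≠ 0) (ha : q a = 1) :
    ∃ L, IsContinuationAlong γ (fun z => log (q z)) L ∧
      ∀ t, ∀ᶠ z in 𝓝 (γ t), exp (L t z) = q z := by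
  have hcont : Continuous fun t => q (γ t) := continuous_iff_continuousAt.2 fun t =>
    (hq t).continuousAt.comp γ.continuous.continuousAt
  obtain ⟨u, hu, hu0⟩ := isCoveringMap_exp.exists_path_lifts
    (γ := ⟨fun t => ⟨q (γ t), hq0 t⟩, hcont.subtype_mk _⟩) (e := 0)
    (Subtype.ext (by simp [ha]))
  have hexp : ∀ t, exp (u t) = q (γ t) := fun t => congrArg Subtype.val (congrFun hu t)
  have hev : ∀ t, ∀ᶠ z in 𝓝 (γ t), exp (u t + log (q z / q (γ t))) = q z := fun t => by
    filter_upwards [(hq t).continuousAt.eventually_ne (hq0 t)] with z hz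
    rw [exp_add, hexp, exp_log (div_ne_zero hz (hq0 t)), mul_div_cancel₀ _ (hq0 t)]
  refine ⟨fun t z => u t + log (q z / q (γ t)), ⟨?_, fun t => ?_, fun t => ?_⟩, hev⟩
  · refine .of_forall fun z => ?_
    simp [hu0, ha]
  · refine analyticAt_const.add (((hq t).div analyticAt_const (hq0 t)).clog ?_)
    rw [Pi.div_apply, div_self (hq0 t)]
    exact one_mem_slitPlane
  · -- the two determinations differ by a small number with exponential `1`
    have hc : ContinuousAt (fun p : unitInterval × ℂ =>
        u p.1 + log (q p.2 / q (γ p.1)) - (u t + log (q p.2 / q (γ t)))) (t, γ t) := by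
      have h1 : ContinuousAt (fun p : unitInterval × ℂ => q p.2) (t, γ t) :=
        ContinuousAt.comp (f := Prod.snd) (hq t).continuousAt continuousAt_snd
      have h2 : ContinuousAt (fun p : unitInterval × ℂ => q (γ p.1)) (t, γ t) :=
        (hcont.comp continuous_fst).continuousAt
      have h3 : ContinuousAt (fun p : unitInterval × ℂ => u p.1) (t, γ t) :=
        (u.continuous.comp continuous_fst).continuousAt
      refine (h3.add ((h1.div h2 (hq0 t)).clog ?_)).sub
        (continuousAt_const.add ((h1.div_const _).clog ?_)) <;>
      · simp only [Pi.div_apply]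
        rw [div_self (hq0 t)]
        exact one_mem_slitPlane
    have hsmall := hc.eventually (Metric.ball_mem_nhds _ one_pos)
    have hne : ∀ᶠ p : unitInterval × ℂ in 𝓝 (t, γ t), q p.2 ≠ 0 :=
      (continuous_snd.tendsto (t, γ t)).eventually ((hq t).continuousAt.eventually_ne (hq0 t))
    have hpath : Tendsto (fun s => (s, γ s)) (𝓝 t) (𝓝 (t, γ t)) :=
      (continuous_id.prodMk γ.continuous).continuousAt
    filter_upwards [hpath.eventually (hsmall.and hne).eventually_nhds] with s hs
    have hslice : Tendsto (fun z => (s, z)) (𝓝 (γ s)) (𝓝 (s, γ s)) :=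
      (continuous_const.prodMk continuous_id).continuousAt
    filter_upwards [hslice.eventually hs] with z hz
    obtain ⟨hz1, hz2⟩ := hz
    simp only [sub_self, div_self (hq0 t), dist_zero_right] at hz1
    set w := u s + log (q z / q (γ s)) - (u t + log (q z / q (γ t))) with hw
    have hw1 : exp w = 1 := by
      rw [hw, exp_sub, exp_add, exp_add, hexp, hexp, exp_log (div_ne_zero hz2 (hq0 t)),
        exp_log (div_ne_zero hz2 (hq0 s)), mul_div_cancel₀ _ (hq0 t), mul_div_cancel₀ _ (hq0 s),
        div_self hz2]
    have him := abs_le.1 ((abs_im_le_norm w).trans hz1.le)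
    have hw0 := log_exp (x := w) (by linarith [Real.pi_gt_three]) (by linarith [Real.pi_gt_three])
    rw [hw1, log_one] at hw0
    exact sub_eq_zero.1 hw0.symm

end Continuation

/-! ### Continuation of the prefactor -/

section Prefactor

lemma differentiable_det_one_add_smul {n : ℕ} (M : Matrix (Fin n) (Fin n) ℂ) :
    Differentiable ℂ fun κ : ℂ => (1 + κ • M).det := by
  simp only [Matrix.det_apply, Matrix.add_apply, Matrix.smul_apply, smul_eq_mul]
  fun_prop

lemma one_add_div_one_sub_mem_slitPlane_iff {w : ℂ} :
    (1 + w) / (1 - w) ∈ slitPlane ↔ normSq w < 1 ∨ w.im ≠ 0 := by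
  rcases eq_or_ne w 1 with rfl | hw
  · simp
  have hpos : 0 < normSq (1 - w) := normSq_pos.2 (sub_ne_zero.2 hw.symm)
  have hre : ((1 + w) / (1 - w)).re = (1 - normSq w) / normSq (1 - w) := by
    rw [div_re, ← add_div]
    congr 1
    simp [normSq_apply]
    ring
  have him : ((1 + w) / (1 - w)).im = 2 * w.im / normSq (1 - w) := by
    rw [div_im, ← sub_div]
    congr 1
    simp
    ring
  rw [mem_slitPlane_iff, hre, him, div_pos_iff_of_pos_right hpos, sub_pos]
  simp [hpos.ne']

lemma one_add_mul_div_mem_slitPlane {x : ℂ} (hx : (1 + x) / (1 - x) ∈ slitPlane) {s : ℝ}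
    (hs : s ∈ Icc (0 : ℝ) 1) : (1 + s * x) / (1 - s * x) ∈ slitPlane := by
  rw [one_add_div_one_sub_mem_slitPlane_iff] at hx ⊢
  rcases hs.1.eq_or_lt with rfl | h0
  · simp
  refine hx.imp (fun h => ?_) fun h => ?_
  · rw [normSq_mul, normSq_ofReal]
    have := normSq_nonneg x
    nlinarith [hs.2, mul_le_one₀ hs.2 hs.1 hs.2]
  · rw [im_ofReal_mul]
    exact mul_ne_zero h0.ne' h

variable {N : ℕ} {h T : ℝ} {η β : ℂ} {lam : Fin N → ℂ}

lemma prefactor_eq_exp {κ : ℂ} (hκ : IsRegularCoupling h T η β lam κ) :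
    prefactor h T η β lam κ =
      exp (∑ p, 1 / 2 * log (1 + κ ^ 2 * aHat h T η β lam (-lam p)) +
        1 / 4 * log ((1 + κ * aHat h T η β lam 0) / (1 - κ * aHat h T η β lam 0))) := by
  rw [prefactor, cpow_def_of_ne_zero (div_ne_zero hκ.2.1 hκ.2.2), exp_add, exp_sum, mul_comm (1 / 4)]
  congr 1
  refine Finset.prod_congr rfl fun p _ => ?_
  rw [cpow_def_of_ne_zero (hκ.1 p), mul_comm]

lemma isRegularCoupling_zero : IsRegularCoupling h T η β lam 0 := by
  simp [IsRegularCoupling]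

lemma eventually_isRegularCoupling {κ : ℂ} (hκ : IsRegularCoupling h T η β lam κ) :
    ∀ᶠ z in 𝓝 κ, IsRegularCoupling h T η β lam z := by
  have hc1 : ∀ p, ContinuousAt (fun z : ℂ => 1 + z ^ 2 * aHat h T η β lam (-lam p)) κ :=
    fun p => by fun_prop
  have hc2 : ContinuousAt (fun z : ℂ => 1 + z * aHat h T η β lam 0) κ := by fun_prop
  have hc3 : ContinuousAt (fun z : ℂ => 1 - z * aHat h T η β lam 0) κ := by fun_prop
  filter_upwards [eventually_all.2 fun p => (hc1 p).eventually_ne (hκ.1 p),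
    hc2.eventually_ne hκ.2.1, hc3.eventually_ne hκ.2.2] with z h1 h2 h3
  exact ⟨h1, h2, h3⟩

/-- The prefactor continues along every path of regular couplings, without zeros, and the fourth
power of the continuation is single-valued. -/
lemma exists_isContinuationAlong_prefactor {a b : ℂ} (ha : a = 0) (γ : Path a b)
    (hγ : ∀ t, IsRegularCoupling h T η β lam (γ t)) :
    ∃ G, IsContinuationAlong γ (prefactor h T η β lam) G ∧ (∀ t z, G t z ≠ 0) ∧
      G 1 b ^ 4 = (∏ p, (1 + b ^ 2 * aHat h T η β lam (-lam p)) ^ 2) *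
        ((1 + b * aHat h T η β lam 0) / (1 - b * aHat h T η β lam 0)) := by
  subst ha
  have h1 : ∀ p, ∃ L, IsContinuationAlong γ
      (fun z => log (1 + z ^ 2 * aHat h T η β lam (-lam p))) L ∧
      ∀ t, ∀ᶠ z in 𝓝 (γ t), exp (L t z) = 1 + z ^ 2 * aHat h T η β lam (-lam p) := fun p =>
    exists_isContinuationAlong_log (q := fun z => 1 + z ^ 2 * aHat h T η β lam (-lam p))
      (fun t => by fun_prop) (fun t => (hγ t).1 p) (by simp)
  choose L hL hLexp using h1
  obtain ⟨M, hM, hMexp⟩ := exists_isContinuationAlong_log (γ := γ)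
    (q := fun z => (1 + z * aHat h T η β lam 0) / (1 - z * aHat h T η β lam 0))
    (fun t => by
      have := (hγ t).2.2
      fun_prop (disch := assumption)) (fun t => div_ne_zero (hγ t).2.1 (hγ t).2.2) (by simp)
  refine ⟨fun t z => exp (∑ p, 1 / 2 * L p t z + 1 / 4 * M t z), ⟨?_, fun t => ?_, fun t => ?_⟩,
    fun t z => exp_ne_zero _, ?_⟩
  · filter_upwards [eventually_all.2 fun p => (hL p).start, hM.start,
      eventually_isRegularCoupling
        (isRegularCoupling_zero (h := h) (T := T) (η := η) (β := β) (lam := lam))] with z h2 h3 h4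
    simp only [prefactor_eq_exp h4, h2, h3]
  · refine AnalyticAt.cexp ((Finset.analyticAt_fun_sum _ fun p _ =>
      analyticAt_const.mul ((hL p).analytic t)).add (analyticAt_const.mul (hM.analytic t)))
  · filter_upwards [eventually_all.2 fun p => (hL p).compatible t, hM.compatible t] with s h2 h3
    filter_upwards [eventually_all.2 fun p => h2 p, h3] with z h4 h5
    simp only [h4, h5]
  · have h2 := fun p => (hLexp p 1).self_of_nhds
    have h3 := (hMexp 1).self_of_nhds
    simp only [γ.target] at h2 h3
    rw [← h3, ← exp_nat_mul, mul_add, exp_add, Finset.mul_sum, exp_sum]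
    congr 1
    · refine Finset.prod_congr rfl fun p _ => ?_
      rw [← h2 p, ← exp_nat_mul]
      congr 1
      push_cast
      ring
    · congr 1
      push_cast
      ring

lemma analyticAt_prefactor {κ : ℂ}
    (h1 : ∀ p, 1 + κ ^ 2 * aHat h T η β lam (-lam p) ∈ slitPlane)
    (h2 : (1 + κ * aHat h T η β lam 0) / (1 - κ * aHat h T η β lam 0) ∈ slitPlane) :
    IsRegularCoupling h T η β lam κ ∧ AnalyticAt ℂ (prefactor h T η β lam) κ := by
  have h3 := div_ne_zero_iff.1 (slitPlane_ne_zero h2)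
  refine ⟨⟨fun p => slitPlane_ne_zero (h1 p), h3⟩, ?_⟩
  have h4 := h3.2
  refine (Finset.analyticAt_fun_prod _ fun p _ => ?_).mul ?_
  · exact AnalyticAt.cpow (by fun_prop) analyticAt_const (h1 p)
  · exact AnalyticAt.cpow (by fun_prop (disch := assumption)) analyticAt_const h2

/-- Along the segment `[0, 1]` the principal determinations are the continued ones. -/
lemma analyticAt_prefactor_ofReal
    (h1 : ∀ p, 1 + aHat h T η β lam (-lam p) ∈ slitPlane)
    (h2 : (1 + aHat h T η β lam 0) / (1 - aHat h T η β lam 0) ∈ slitPlane) {s : ℝ}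
    (hs : s ∈ Icc (0 : ℝ) 1) :
    IsRegularCoupling h T η β lam s ∧ AnalyticAt ℂ (prefactor h T η β lam) s := by
  refine analyticAt_prefactor (fun p => ?_) (one_add_mul_div_mem_slitPlane h2 hs)
  have := starConvex_one_slitPlane.add_smul_mem (h1 p) (sq_nonneg s) (pow_le_one₀ hs.1 hs.2)
  simpa using this

lemma prefactor_ne_zero {κ : ℂ} (hκ : IsRegularCoupling h T η β lam κ) :
    prefactor h T η β lam κ ≠ 0 := by
  rw [prefactor_eq_exp hκ]
  exact exp_ne_zero _

end Prefactor

/-! ### The sum of the series on the boundary of the disc of convergence -/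

section Boundary

lemma continuousOn_tsum_mul_pow {c : ℕ → ℂ} (hc : Summable c) (m : ℕ → ℕ) :
    ContinuousOn (fun z : ℂ => ∑' n, c n * z ^ m n) (Metric.closedBall 0 1) := by
  refine continuousOn_tsum (fun n => by fun_prop) hc.norm fun n z hz => ?_
  rw [norm_mul, norm_pow]
  exact mul_le_of_le_one_right (norm_nonneg _)
    (pow_le_one₀ (norm_nonneg _) (mem_closedBall_zero_iff.1 hz))

lemma differentiableOn_tsum_mul_sq_pow {c : ℕ → ℂ} (hc : Summable c) :
    DifferentiableOn ℂ (fun z : ℂ => ∑' n, c n * (z ^ 2) ^ n) (Metric.ball 0 1) := by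
  intro z hz
  have hz' : ‖z ^ 2‖ < 1 := by
    rw [norm_pow]
    exact pow_lt_one₀ (norm_nonneg _) (mem_ball_zero_iff.1 hz) two_ne_zero
  have h1 := differentiableAt_tsum_mul_pow
    (fun j => hc.norm.le_tsum j fun _ _ => norm_nonneg _) hz'
  exact (h1.comp z (differentiableAt_pow 2)).differentiableWithinAt

variable {N : ℕ} {h T : ℝ} {η β : ℂ} {lam : Fin N → ℂ} {C : ℕ → Contour}

/-- If the series converges at `κ = 1`, its sums near `κ = 0` are the values of a function that is
analytic in the unit disc and continuous up to the boundary, with the expected value at `1`. -/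
lemma AdaptedContours.exists_continuousOn_closedBall (hC : AdaptedContours η lam C) (hN : 0 < N)
    (hdist : ∀ j k, j ≠ k → sinh (lam j - lam k) ≠ 0)
    (hsum : ∀ j k, sinh (lam j + lam k) ≠ 0) (hβ : sinh (β / N) ≠ 0) (hβη : sinh (β / N - η) ≠ 0)
    (h1 : SeriesConverges h T η lam C 1) :
    ∃ S : ℂ → ℂ, ContinuousOn S (Metric.closedBall 0 1) ∧
      DifferentiableOn ℂ S (Metric.ball 0 1) ∧ S 1 = seriesF h T η lam C 1 ∧
      ∀ κ, SeriesConverges h T η lam C κ → S κ = seriesF h T η lam C κ := by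
  obtain ⟨S₁, S₂, hS₁, hS₂, hS⟩ := hC.seriesF_hasSum hN hdist hsum hβ hβη h1
  have hc₁ := hS₁.summable
  have hc₂ := hS₂.summable
  set c₁ : ℕ → ℂ := fun n => 1 ^ (2 * n + 1) / (2 * n + 1) * oddCoeff h T η β lam n with hc₁_def
  set c₂ : ℕ → ℂ := fun n => 1 ^ (2 * (n + 1)) / (2 * (n + 1)) * evenCoeff h T η lam n with hc₂_def
  refine ⟨fun z => z * ∑' n, c₁ n * (z ^ 2) ^ n - z ^ 2 * ∑' n, c₂ n * (z ^ 2) ^ n, ?_, ?_, ?_, ?_⟩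
  · simp only [← pow_mul]
    exact (continuousOn_id.mul (continuousOn_tsum_mul_pow hc₁ _)).sub
      ((continuousOn_pow 2).mul (continuousOn_tsum_mul_pow hc₂ _))
  · exact (differentiableOn_id.mul (differentiableOn_tsum_mul_sq_pow hc₁)).sub
      ((differentiable_pow 2).differentiableOn.mul (differentiableOn_tsum_mul_sq_pow hc₂))
  · rw [hS, ← hS₁.tsum_eq, ← hS₂.tsum_eq]
    simp only [one_pow, one_mul, mul_one]
  · intro κ hκ
    obtain ⟨R₁, R₂, hR₁, hR₂, hR⟩ := hC.seriesF_hasSum hN hdist hsum hβ hβη hκ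
    rw [hR, ← hR₁.tsum_eq, ← hR₂.tsum_eq]
    simp only [← tsum_mul_left]
    congr 2 <;>
    · funext n
      simp only [hc₁_def, hc₂_def]
      ring

/-- The principal value at `κ = 1`: continuation along the segment, and Abel summation of the series
at its end point. -/
lemma AdaptedContours.continuesTo_segment (hC : AdaptedContours η lam C) (hN : 0 < N)
    (hdist : ∀ j k, j ≠ k → sinh (lam j - lam k) ≠ 0)
    (hsum : ∀ j k, sinh (lam j + lam k) ≠ 0) (hβ : sinh (β / N) ≠ 0) (hβη : sinh (β / N - η) ≠ 0)
    (hBethe : BetheEquations h T η β lam)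
    (h1 : ∀ p, 1 + aHat h T η β lam (-lam p) ∈ slitPlane)
    (h2 : (1 + aHat h T η β lam 0) / (1 - aHat h T η β lam 0) ∈ slitPlane) :
    ContinuesTo (Path.segment (0 : ℂ) 1) (fun κ => exp (seriesF h T η lam C κ))
      ((1 + matU h T η lam).det / prefactor h T η β lam 1) ∧
    (SeriesConverges h T η lam C 1 → (1 + matU h T η lam).det / prefactor h T η β lam 1 =
      exp (seriesF h T η lam C 1)) := by
  obtain ⟨r, hr, hdet⟩ := hC.exists_det_eq_prefactor_mul_exp hN hdist hsum hβ hβη hBethe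
  have hball := Metric.ball_mem_nhds (0 : ℂ) hr
  have hana : ∀ s ∈ Icc (0 : ℝ) 1,
      IsRegularCoupling h T η β lam s ∧ AnalyticAt ℂ (prefactor h T η β lam) s :=
    fun s hs => analyticAt_prefactor_ofReal h1 h2 hs
  have hD := fun κ => (differentiable_det_one_add_smul (matU h T η lam)).analyticAt κ
  have hseg : ∀ t, Path.segment (0 : ℂ) 1 t = ((t : ℝ) : ℂ) := fun t => by
    simp [Path.segment_apply, AffineMap.lineMap_apply]
  have hdiv : ∀ᶠ κ in 𝓝 (0 : ℂ), (1 + κ • matU h T η lam).det =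
      prefactor h T η β lam κ * exp (seriesF h T η lam C κ) :=
    eventually_of_mem hball fun κ hκ => (hdet κ (mem_ball_zero_iff.1 hκ)).2
  refine ⟨?_, fun hconv => ?_⟩
  · have hG := (isContinuationAlong_const (γ := Path.segment (0 : ℂ) 1) fun t => by
      rw [hseg]
      exact (hana t t.2).2).div (fun t => by
        rw [hseg]
        exact prefactor_ne_zero (hana t t.2).1) (fun t => hD _)
      (prefactor_ne_zero isRegularCoupling_zero) hdiv
    simpa using hG.continuesTo
  · obtain ⟨S, hSc, hSd, hS1, hS⟩ :=
      hC.exists_continuousOn_closedBall hN hdist hsum hβ hβη hconv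
    set Q : ℂ → ℂ := fun κ => (1 + κ • matU h T η lam).det / prefactor h T η β lam κ with hQ
    have hQa : ∀ s ∈ Icc (0 : ℝ) 1, AnalyticAt ℂ Q s := fun s hs =>
      (hD _).div (hana s hs).2 (prefactor_ne_zero (hana s hs).1)
    have hmem : ∀ {s : ℝ}, s ∈ Ico (0 : ℝ) 1 → (s : ℂ) ∈ Metric.ball (0 : ℂ) 1 := fun hs => by
      rw [mem_ball_zero_iff, norm_real, Real.norm_of_nonneg hs.1]
      exact hs.2
    -- the identity theorem on the half-open segment, where both sides are analytic
    have hEq : EqOn Q (fun κ => exp (S κ)) ((fun s : ℝ => (s : ℂ)) '' Ico 0 1) := by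
      refine AnalyticOnNhd.eqOn_of_preconnected_of_eventuallyEq (𝕜 := ℂ) (z₀ := 0) ?_ ?_
        (isPreconnected_Ico.image _ continuous_ofReal.continuousOn) ⟨0, by simp⟩ ?_
      · rintro _ ⟨s, hs, rfl⟩
        exact hQa s (Ico_subset_Icc_self hs)
      · rintro _ ⟨s, hs, rfl⟩
        exact (hSd.analyticAt (Metric.isOpen_ball.mem_nhds (hmem hs))).cexp
      · filter_upwards [hball, eventually_isRegularCoupling
          (isRegularCoupling_zero (h := h) (T := T) (η := η) (β := β) (lam := lam))] with κ hκ hreg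
        obtain ⟨h3, h4⟩ := hdet κ (mem_ball_zero_iff.1 hκ)
        simp only [hQ]
        rw [hS κ h3, h4, mul_div_cancel_left₀ _ (prefactor_ne_zero hreg)]
    have hEq' : EqOn (fun s : ℝ => Q s) (fun s : ℝ => exp (S s)) (Icc 0 1) := by
      refine EqOn.of_subset_closure (s := Ico 0 1)
        (fun s hs => hEq ⟨s, hs, rfl⟩) ?_ ?_ Ico_subset_Icc_self (by simp [closure_Ico])
      · exact fun s hs => ((hQa s hs).continuousAt.comp
          continuous_ofReal.continuousAt).continuousWithinAt
      · refine (hSc.comp continuous_ofReal.continuousOn fun s hs => ?_).cexp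
        rw [mem_closedBall_zero_iff, norm_real, Real.norm_of_nonneg hs.1]
        exact hs.2
    have := hEq' (right_mem_Icc.2 zero_le_one)
    simpa [hQ, hS1] using this

end Boundary

end OpenXXZ

end

theorem mainTheorem4 {N : ℕ} (hN : 0 < N) (h T : ℝ) (hT : 0 < T) (η β : ℂ) (lam : Fin N → ℂ)
    (hβ : Complex.sinh (β / N) ≠ 0) (hβη : Complex.sinh (β / N - η) ≠ 0)
    (hBethe : OpenXXZ.BetheEquations h T η β lam)
    (hdist : ∀ j k, j ≠ k → Complex.sinh (lam j - lam k) ≠ 0)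
    (hsum : ∀ j k, Complex.sinh (lam j + lam k) ≠ 0)
    (C : ℕ → OpenXXZ.Contour) (hC : OpenXXZ.AdaptedContours η lam C) :
    (∃ r : ℝ, 0 < r ∧ ∀ κ : ℂ, ‖κ‖ < r →
      OpenXXZ.SeriesConverges h T η lam C κ ∧
      (1 + κ • OpenXXZ.matU h T η lam).det =
        OpenXXZ.prefactor h T η β lam κ * Complex.exp (OpenXXZ.seriesF h T η lam C κ)) ∧
    (∀ γ : Path (0 : ℂ) 1, (∀ t, OpenXXZ.IsRegularCoupling h T η β lam (γ t)) →
      ∃ P E : ℂ,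
        OpenXXZ.ContinuesTo γ (OpenXXZ.prefactor h T η β lam) P ∧
        P ^ 4 = (∏ p, (1 + OpenXXZ.aHat h T η β lam (-lam p)) ^ 2) *
          ((1 + OpenXXZ.aHat h T η β lam 0) / (1 - OpenXXZ.aHat h T η β lam 0)) ∧
        OpenXXZ.ContinuesTo γ (fun κ => Complex.exp (OpenXXZ.seriesF h T η lam C κ)) E ∧
        (1 + OpenXXZ.matU h T η lam).det = P * E) ∧
    ((∀ p, 1 + OpenXXZ.aHat h T η β lam (-lam p) ∈ Complex.slitPlane) →
      (1 + OpenXXZ.aHat h T η β lam 0) / (1 - OpenXXZ.aHat h T η β lam 0) ∈ Complex.slitPlane →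
      ∃ E : ℂ,
        OpenXXZ.ContinuesTo (Path.segment (0 : ℂ) 1)
          (fun κ => Complex.exp (OpenXXZ.seriesF h T η lam C κ)) E ∧
        (1 + OpenXXZ.matU h T η lam).det =
          (∏ p, (1 + OpenXXZ.aHat h T η β lam (-lam p)) ^ (1 / 2 : ℂ)) *
            ((1 + OpenXXZ.aHat h T η β lam 0) / (1 - OpenXXZ.aHat h T η β lam 0)) ^ (1 / 4 : ℂ) *
            E ∧
        (OpenXXZ.SeriesConverges h T η lam C 1 →
          E = Complex.exp (OpenXXZ.seriesF h T η lam C 1))) := by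

  obtain ⟨r, hr, hdet⟩ := hC.exists_det_eq_prefactor_mul_exp hN hdist hsum hβ hβη hBethe
  refine ⟨⟨r, hr, hdet⟩, fun γ hγ => ?_, fun h1 h2 => ?_⟩
  · obtain ⟨G, hG, hG0, hG4⟩ := OpenXXZ.exists_isContinuationAlong_prefactor rfl γ hγ
    have hE := hG.div (fun t => hG0 t _)
      (fun t => (OpenXXZ.differentiable_det_one_add_smul (OpenXXZ.matU h T η lam)).analyticAt _)
      (OpenXXZ.prefactor_ne_zero OpenXXZ.isRegularCoupling_zero)
      (Filter.eventually_of_mem (Metric.ball_mem_nhds (0 : ℂ) hr) fun κ hκ =>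
        (hdet κ (mem_ball_zero_iff.1 hκ)).2)
    refine ⟨G 1 1, _, hG.continuesTo, by simpa using hG4, hE.continuesTo, ?_⟩
    rw [one_smul, mul_div_cancel₀ _ (hG0 1 1)]
  · obtain ⟨hcont, hval⟩ :=
      hC.continuesTo_segment hN hdist hsum hβ hβη hBethe h1 h2
    have hreg := (OpenXXZ.analyticAt_prefactor_ofReal h1 h2 (Set.right_mem_Icc.2 zero_le_one)).1
    rw [Complex.ofReal_one] at hreg
    refine ⟨_, hcont, ?_, hval⟩
    have hpre := mul_div_cancel₀ (1 + OpenXXZ.matU h T η lam).det (OpenXXZ.prefactor_ne_zero hreg)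
    nth_rw 1 [OpenXXZ.prefactor] at hpre
    simpa only [one_pow, one_mul] using hpre.symm
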